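/- Setting. Let $N$ be a finite ground set with $n=|N|$. A family $\mathcal F\subseteq 2^N$ is down-closed if it is nonempty and contains all subsets of its members. A relaxation of $\mathcal F$ is a polytope $P\subseteq[0,1]^N$ having the same $\{0,1\}$-points as the convex hull of the characteristic vectors of the sets in $\mathcal F$. For $x\in[0,1]^N$, $R(x)$ is the random set that contains each $e\in N$ independently with probability $x_e$. A (randomized) greedy OCRS $\pi$ for $P$ assigns to each $x\in P$ a random nonempty down-closed subfamily $\mathcal F_{\pi,x}\subseteq\mathcal F$ (an arriving active element is selected whenever, together with the elements already selected, it forms a set of $\mathcal F_{\pi,x}$). For $b,c\in[0,1]$ it is $(b,c)$-selectable if for all $x\in b\cdot P$ and all $e\in N$ $$\Pr\bigl[I\cup\{e\}\in\mathcal F_{\pi,x}\ \text{ for all } I\subseteq R(x) \text{ with } I\in\mathcal F_{\pi,x}\bigr]\ \ge\ c,$$ where $R(x)$ and $\mathcal F_{\pi,x}$ are independent. The scheme is efficient if a polynomial time algorithm, given $x$, samples a polynomial time independence oracle for $\mathcal F_{\pi,x}$. Submodular stochastic probing with inner constraint $\mathcal F_{in}$ and outer constraint $\mathcal F_{out}$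 (both down-closed): each $e\in N$ is active independently with a given probability $p_e\in[0,1]$, and $f\colon 2^N\to\mathbb R_{\ge0}$ is monotone and submodular. An algorithm probes elements one by one; a probed element is selected exactly if it is active. An element may be probed only if adding it to the probed elements gives a set in $\mathcal F_{out}$ and adding it to the selected elements gives a set in $\mathcal F_{in}$. The value is $f(S)$ for the final set $S$ of selected elements. In the version with an almighty adversary, the elements of $N$ are revealed one by one in an order chosen by an adversary who knows all random choices of the algorithm and which elements are active; when an element is revealed, the algorithm decides irrevocably whether to probe it. A $\rho$-approximation is an algorithm for this version that respects the constraints and whose expected value, against every almighty adversary, is at least $\rho$ times the expected value of every feasible adaptive strategy that may itself choose the order of probing. Theorem. There is a function $\varepsilon\colon\mathbb N\to\mathbb R$ with $\varepsilon(n)\to0$ as $n\to\infty$ such that the following holds for all $b,c_{in},c_{out}\in[0,1]$. (a) Let $\mathcal F_{in},\mathcal F_{out}\subseteq 2^N$ be down-closed, let $P_{in}$, $P_{out}$ be relaxations of them, and suppose that there are a $(b,c_{in})$-selectable greedy OCRS $\pi_{in}$ for $P_{in}$ and a $(b,c_{out})$-selectable greedy OCRS $\pi_{out}$ for $P_{out}$.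 Then for all $p$ and $f$ as above there is a $\bigl(1-e^{-b}-\varepsilon(|N|)\bigr)\,c_{in}\,c_{out}$-approximation for submodular stochastic probing with inner constraint $\mathcal F_{in}$ and outer constraint $\mathcal F_{out}$, where the order is chosen by an almighty adversary. (b) Moreover, for every class of such instances $(\mathcal F_{in},\mathcal F_{out},P_{in},P_{out},\pi_{in},\pi_{out})$ on which $\pi_{in}$ and $\pi_{out}$ are efficient, an approximation with this guarantee is achieved by a single algorithm that runs in polynomial time on all instances of the class, given $b$ and $p$, separation oracles for $P_{in}$ and $P_{out}$ and a value oracle for $f$. Running times in (b), including that in the definition of efficiency, count the steps of randomized real random access machine programs (field operations on and comparisons of reals, index operations, biased coins) with oracles; oracle and subroutine calls also pay for the lengths of the lists passed. "Polynomial" means polynomial in the instance size, a number that is at least $|N|$. -/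

import Mathlib

open Filter Topology

noncomputable section

namespace OCRS

open scoped Classical Pointwise

/-! ### Constraint families, relaxations and random sets -/

/-- The characteristic vector of a set. -/
def charVec {N : Type} (S : Finset N) : N → ℝ := fun e => if e ∈ S then 1 else 0

/-- The set of `{0,1}`-vectors. -/
def zeroOneVecs (N : Type) : Set (N → ℝ) := {x | ∀ e, x e = 0 ∨ x e = 1}

/-- The convex hull of the characteristic vectors of the feasible sets. -/
def feasiblePolytope {N : Type} (F : Set (Finset N)) : Set (N → ℝ) :=
  convexHull ℝ (charVec '' F)

/-- A polytope `P ⊆ [0,1]^N` with the same `{0,1}`-points as the polytope of `F`. -/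
structure IsRelaxation {N : Type} (F : Set (Finset N)) (P : Set (N → ℝ)) : Prop where
  polytope : ∃ V : Finset (N → ℝ), P = convexHull ℝ (V : Set (N → ℝ))
  subset_cube : ∀ x ∈ P, ∀ e, 0 ≤ x e ∧ x e ≤ 1
  same_points : P ∩ zeroOneVecs N = feasiblePolytope F ∩ zeroOneVecs N

/-- A down-closed family of feasible sets that contains at least one set (hence the empty set). -/
structure IsDownClosedFamily {N : Type} (F : Set (Finset N)) : Prop where
  down : ∀ S ∈ F, ∀ T ⊆ S, T ∈ F
  nonempty : F.Nonempty

/-- The probability that the random set `R(x)`, which contains every element `e` independently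
with probability `x e`, equals `R`. -/
def prodProb {N : Type} [Fintype N] (x : N → ℝ) (R : Finset N) : ℝ :=
  ∏ e, if e ∈ R then x e else 1 - x e

/-! ### Greedy online contention resolution schemes -/

/-- A (possibly randomized) greedy OCRS for the relaxation `P` of `F`: for each `x ∈ P` a law on
down-closed subfamilies of `F`. The subfamilies contain the empty set, as the scheme starts with
nothing selected. A deterministic scheme is the case of point masses. -/
structure GreedyOCRS {N : Type} (F : Set (Finset N)) (P : Set (N → ℝ)) where
  fam : (N → ℝ) → PMF (Finset (Finset N))
  subset_feasible : ∀ x ∈ P, ∀ G ∈ (fam x).support, ∀ S ∈ G, S ∈ F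
  down_closed : ∀ x ∈ P, ∀ G ∈ (fam x).support, ∀ S ∈ G, ∀ T ⊆ S, T ∈ G
  empty_mem : ∀ x ∈ P, ∀ G ∈ (fam x).support, ∅ ∈ G

/-- `e` is selectable for the realization `R` of `R(x)` and the family `G`. -/
def Selectable {N : Type} (G : Finset (Finset N)) (R : Finset N) (e : N) : Prop :=
  ∀ I ⊆ R, I ∈ G → insert e I ∈ G

/-- The probability, over independent `R(x)` and the random choice of the family, that `e` is
selectable. -/
def GreedyOCRS.selectProb {N : Type} [Fintype N] {F : Set (Finset N)} {P : Set (N → ℝ)}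
    (π : GreedyOCRS F P) (x : N → ℝ) (e : N) : ℝ :=
  ∑ R : Finset N, ∑ G : Finset (Finset N),
    prodProb x R * (π.fam x G).toReal * (if Selectable G R e then 1 else 0)

/-- `(b, c)`-selectability. -/
def GreedyOCRS.IsSelectable {N : Type} [Fintype N] {F : Set (Finset N)} {P : Set (N → ℝ)}
    (π : GreedyOCRS F P) (b c : ℝ) : Prop :=
  ∀ x ∈ b • P, ∀ e, c ≤ π.selectProb x e

/-! ### Submodular stochastic probing -/

/-- Non-negative monotone submodular objectives. -/
structure IsMonotoneSubmodular {N : Type} (f : Finset N → ℝ) : Prop where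
  nonneg : ∀ S, 0 ≤ f S
  mono : ∀ S T, S ⊆ T → f S ≤ f T
  submod : ∀ S T, f (S ∪ T) + f (S ∩ T) ≤ f S + f T

/-- An adaptive probing strategy that chooses the order itself: it stops, or probes an element and
continues according to whether this element is active. -/
inductive ProbeTree (N : Type) : Type
  | halt : ProbeTree N
  | probe (e : N) (ifActive ifInactive : ProbeTree N) : ProbeTree N

/-- The set of elements probed when `A` is the set of active elements. The selected elements are
the active ones among these. -/
def ProbeTree.probed {N : Type} (A : Finset N) : ProbeTree N → Finset N
  | .halt => ∅
  | .probe e t u => insert e (if e ∈ A then t.probed A else u.probed A)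

def ProbeTree.selected {N : Type} (A : Finset N) (T : ProbeTree N) : Finset N :=
  T.probed A ∩ A

/-- The outer constraint holds for the probed set and the inner one for the selected set. Since
`A` ranges over all sets, this says that no element is ever probed unless adding it to the probed
elements respects `Fout` and adding it to the selected elements respects `Finn`. -/
def ProbeTree.Legal {N : Type} (Finn Fout : Set (Finset N)) (T : ProbeTree N) : Prop :=
  ∀ A, T.probed A ∈ Fout ∧ T.selected A ∈ Finn

/-- Expected objective value when each `e` is active independently with probability `p e`. -/
def ProbeTree.value {N : Type} [Fintype N] (p : N → ℝ) (f : Finset N → ℝ) (T : ProbeTree N) : ℝ :=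
  ∑ A : Finset N, prodProb p A * f (T.selected A)

/-- What has happened so far, in chronological order: each revealed element, with `none` if it was
not probed and `some a` if it was probed, where `a` tells whether it was active. -/
abbrev History (N : Type) : Type := List (N × Option Bool)

def History.probed {N : Type} [Fintype N] (h : History N) : Finset N :=
  Finset.univ.filter fun e => ∃ a, (e, some a) ∈ h

def History.selected {N : Type} [Fintype N] (h : History N) : Finset N :=
  Finset.univ.filter fun e => (e, some true) ∈ h

/-- A randomized probing algorithm for an externally given order. The random choices (`Seed`) are
drawn up front; given these, the algorithm decides, from the history and the element that arrives,
whether this element is probed. -/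
structure ProbingAlgorithm (N : Type) where
  Seed : Type
  law : PMF Seed
  probe : Seed → History N → N → Bool

/-- Continue from the history `h` when the elements of the list are still to be revealed and `A` is
the set of active elements. -/
def ProbingAlgorithm.runFrom {N : Type} (alg : ProbingAlgorithm N) (s : alg.Seed) (A : Finset N) :
    List N → History N → History N
  | [], h => h
  | e :: l, h =>
    alg.runFrom s A l (h ++ [(e, if alg.probe s h e then some (decide (e ∈ A)) else none)])

/-- The order in which all elements are revealed. -/
abbrev RevealOrder (N : Type) : Type := {l : List N // l.Nodup ∧ ∀ e, e ∈ l}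

def ProbingAlgorithm.finalHistory {N : Type} (alg : ProbingAlgorithm N) (s : alg.Seed)
    (A : Finset N) (l : RevealOrder N) : History N :=
  alg.runFrom s A l.1 []

/-- The constraints hold for each outcome of the random choices, each set of active elements and
each order. -/
def ProbingAlgorithm.Legal {N : Type} [Fintype N] (Finn Fout : Set (Finset N))
    (alg : ProbingAlgorithm N) : Prop :=
  ∀ s ∈ alg.law.support, ∀ (A : Finset N) (l : RevealOrder N),
    (alg.finalHistory s A l).probed ∈ Fout ∧ (alg.finalHistory s A l).selected ∈ Finn

/-- An almighty adversary chooses the order knowing all random choices of the algorithm and the set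
of active elements. -/
abbrev AlmightyAdversary {N : Type} (alg : ProbingAlgorithm N) : Type :=
  alg.Seed → Finset N → RevealOrder N

/-- Expected objective value against an almighty adversary. -/
def ProbingAlgorithm.value {N : Type} [Fintype N] (p : N → ℝ) (f : Finset N → ℝ)
    (alg : ProbingAlgorithm N) (adv : AlmightyAdversary alg) : ℝ :=
  ∑ A : Finset N, prodProb p A *
    ∑' s, (alg.law s).toReal * f (alg.finalHistory s A (adv s A)).selected

/-- `alg` respects the constraints and obtains, against each almighty adversary, at least `ρ` times
the expected value of each legal adaptive strategy that may choose the order itself. -/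
def IsApproximation {N : Type} [Fintype N] (Finn Fout : Set (Finset N)) (p : N → ℝ)
    (f : Finset N → ℝ) (ρ : ℝ) (alg : ProbingAlgorithm N) : Prop :=
  alg.Legal Finn Fout ∧
    ∀ adv : AlmightyAdversary alg, ∀ T : ProbeTree N, T.Legal Finn Fout →
      ρ * T.value p f ≤ alg.value p f adv

/-! ### A randomized real random access machine with oracles and a step count

Programs work with index registers (natural numbers) and arrays (of reals), both named by natural
numbers. Each arithmetic operation, comparison, memory access and coin costs one step. Loops are
bounded by the content of a register at their start, so that each program halts. -/

/-- Index expressions; subtraction is truncated. -/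
inductive IExp : Type
  | lit (k : ℕ)
  | var (v : ℕ)
  | add (i j : IExp)
  | sub (i j : IExp)

/-- Real expressions: the field operations on array entries and indices. -/
inductive RExp : Type
  | ofIdx (i : IExp)
  | get (a : ℕ) (i : IExp)
  | add (r s : RExp)
  | sub (r s : RExp)
  | mul (r s : RExp)
  | div (r s : RExp)

/-- Programs with oracles named by `κ`. When lists are passed around, the variable `v` stands
for the list of the first entries of the array `v`, their number being given by the register `v`. -/
inductive Cmd (κ : Type) : Type
  | skip
  | setIdx (v : ℕ) (i : IExp)
  | setReal (a : ℕ) (i : IExp) (r : RExp)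
  | coin (a : ℕ) (i : IExp) (r : RExp)
  | seq (c d : Cmd κ)
  | ifLt (r s : RExp) (c d : Cmd κ)
  | loop (i : IExp) (c : Cmd κ)
  | query (k : κ) (src dst : ℕ)
  | call (c : Cmd κ) (args : List ℕ) (dst : ℕ)

structure Store : Type where
  idx : ℕ → ℕ
  arr : ℕ → ℕ → ℝ

/-- The initial memory for a list of input lists. -/
def Store.ofLists (L : List (List ℝ)) : Store where
  idx v := (L.getD v []).length
  arr v k := (L.getD v []).getD k 0

/-- The list held by the variable `v`. -/
def Store.block (s : Store) (v : ℕ) : List ℝ := (List.range (s.idx v)).map (s.arr v)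

def Store.setBlock (s : Store) (v : ℕ) (l : List ℝ) : Store where
  idx := Function.update s.idx v l.length
  arr := Function.update s.arr v fun k => l.getD k 0

def Store.setEntry (s : Store) (a k : ℕ) (z : ℝ) : Store where
  idx := s.idx
  arr := Function.update s.arr a (Function.update (s.arr a) k z)

def IExp.eval (s : Store) : IExp → ℕ
  | .lit k => k
  | .var v => s.idx v
  | .add i j => i.eval s + j.eval s
  | .sub i j => i.eval s - j.eval s

def IExp.size : IExp → ℕ
  | .lit _ => 1
  | .var _ => 1
  | .add i j => i.size + j.size + 1
  | .sub i j => i.size + j.size + 1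

def RExp.eval (s : Store) : RExp → ℝ
  | .ofIdx i => (i.eval s : ℝ)
  | .get a i => s.arr a (i.eval s)
  | .add r t => r.eval s + t.eval s
  | .sub r t => r.eval s - t.eval s
  | .mul r t => r.eval s * t.eval s
  | .div r t => r.eval s / t.eval s

def RExp.size : RExp → ℕ
  | .ofIdx i => i.size + 1
  | .get _ i => i.size + 1
  | .add r t => r.size + t.size + 1
  | .sub r t => r.size + t.size + 1
  | .mul r t => r.size + t.size + 1
  | .div r t => r.size + t.size + 1

/-- Repeat `step` (memory to new memory and cost) `k` times, and pay one more step per round. -/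
def iterate {M : Type → Type} [Monad M] (step : Store → M (Store × ℕ)) :
    ℕ → Store → M (Store × ℕ)
  | 0, s => pure (s, 0)
  | k + 1, s => do
    let r ← step s
    let r' ← iterate step k r.1
    pure (r'.1, r.2 + r'.2 + 1)

/-- Execution: the new memory and the number of steps. Oracle calls and subroutine calls pay for the
lengths of the lists that are passed, subroutine calls also for the steps of the subroutine, which
starts with a fresh memory that holds its arguments and returns the list held by its variable `0`.
The monad `M` and `flip` fix the meaning of coins: `flip r` is a coin of bias `r`. -/
def Cmd.exec {κ : Type} {M : Type → Type} [Monad M] (flip : ℝ → M Bool)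
    (O : κ → List ℝ → List ℝ) : Cmd κ → Store → M (Store × ℕ)
  | .skip, s => pure (s, 1)
  | .setIdx v i, s => pure (⟨Function.update s.idx v (i.eval s), s.arr⟩, i.size + 1)
  | .setReal a i r, s =>
    pure (s.setEntry a (i.eval s) (r.eval s), i.size + r.size + 1)
  | .coin a i r, s => do
    let z ← flip (r.eval s)
    pure (s.setEntry a (i.eval s) (if z then 1 else 0), i.size + r.size + 1)
  | .seq c d, s => do
    let r ← c.exec flip O s
    let r' ← d.exec flip O r.1
    pure (r'.1, r.2 + r'.2)
  | .ifLt r t c d, s => do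
    let q ← (if r.eval s < t.eval s then c.exec flip O s else d.exec flip O s)
    pure (q.1, r.size + t.size + q.2 + 1)
  | .loop i c, s => do
    let q ← iterate (fun s' => c.exec flip O s') (i.eval s) s
    pure (q.1, i.size + q.2 + 1)
  | .query k src dst, s =>
    let input := s.block src
    let output := O k input
    pure (s.setBlock dst output, input.length + output.length + 1)
  | .call c args dst, s => do
    let inputs := args.map s.block
    let q ← c.exec flip O (Store.ofLists inputs)
    let output := q.1.block 0
    pure (s.setBlock dst output,
      (inputs.map List.length).sum + args.length + q.2 + output.length + 1)

/-- A coin that shows `true` with probability `r`, where `r` is first clamped to `[0,1]`. -/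
def biasedCoin (r : ℝ) : PMF Bool :=
  PMF.ofFintype
    (fun z => if z then ENNReal.ofReal (max 0 (min 1 r)) else ENNReal.ofReal (1 - max 0 (min 1 r)))
    (by
      have h0 : (0 : ℝ) ≤ max 0 (min 1 r) := le_max_left _ _
      have h1 : max 0 (min 1 r) ≤ 1 := max_le zero_le_one (min_le_left _ _)
      rw [Fintype.sum_bool]
      simp only [if_true, Bool.false_eq_true, if_false]
      rw [← ENNReal.ofReal_add h0 (sub_nonneg.2 h1)]
      simp)

/-- The law of the output list and the running time of a randomized computation. The running time
includes the length of the output. -/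
def Cmd.runRandom {κ : Type} (c : Cmd κ) (O : κ → List ℝ → List ℝ) (inputs : List (List ℝ)) :
    PMF (List ℝ × ℕ) :=
  (c.exec (M := PMF) biasedCoin O (Store.ofLists inputs)).map
    fun q => (q.1.block 0, q.2 + (q.1.block 0).length)

/-- The output list and the running time of a deterministic computation: there is no access to
randomness, a coin command writes `0`. -/
def Cmd.runDet {κ : Type} (c : Cmd κ) (O : κ → List ℝ → List ℝ) (inputs : List (List ℝ)) :
    List ℝ × ℕ :=
  let q : Store × ℕ := c.exec (M := Id) (fun _ => false) O (Store.ofLists inputs)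
  (q.1.block 0, q.2 + (q.1.block 0).length)

/-- A computation answers "yes" if the first entry of its output is `1`. -/
def Accepts (l : List ℝ) : Prop := l.getD 0 0 = 1

/-! ### Oracles and efficiency -/

/-- A separation oracle answers `none` on points of `P`, and a strictly separating direction on all
other points. -/
def IsSeparationOracle {N : Type} [Fintype N] (P : Set (N → ℝ))
    (sep : (N → ℝ) → Option (N → ℝ)) : Prop :=
  ∀ y, (y ∈ P ∧ sep y = none) ∨
    ∃ a, sep y = some a ∧ y ∉ P ∧ ∀ z ∈ P, ∑ e, a e * z e < ∑ e, a e * y e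

def listVec {n : ℕ} (l : List ℝ) : Fin n → ℝ := fun e => l.getD e 0

def listSet {n : ℕ} (l : List ℝ) : Finset (Fin n) :=
  Finset.univ.filter fun e => l.getD (e : ℕ) 0 = 1

def setList {n : ℕ} (S : Finset (Fin n)) : List ℝ := List.ofFn (charVec S)

/-- The empty answer means that the point belongs to the polytope. -/
def sepAnswer {n : ℕ} (sep : (Fin n → ℝ) → Option (Fin n → ℝ)) (l : List ℝ) : List ℝ :=
  match sep (listVec l) with
  | none => []
  | some a => List.ofFn a

/-- A family, indexed by the instances `i : ι`, of greedy OCRSs is efficient: there is a polynomial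
time algorithm which, given `x`, samples (a description, as a list `r.1`, of) a polynomial time
independence oracle for the random family of the scheme. The constraint of instance `i`, with
ground set `Fin (n i)` and size `size i`, is presented to algorithms by `acc i`. -/
def Efficient {ι : Type} (size n : ι → ℕ) (acc : ι → List ℝ → List ℝ)
    {F : ∀ i, Set (Finset (Fin (n i)))} {P : ∀ i, Set (Fin (n i) → ℝ)}
    (π : ∀ i, GreedyOCRS (F i) (P i)) : Prop :=
  ∃ (sample test : Cmd Unit) (q : Polynomial ℕ), ∀ i, ∀ x ∈ P i,
    (∀ r ∈ (sample.runRandom (fun _ => acc i) [List.ofFn x]).support,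
      r.2 ≤ q.eval (size i) ∧
      ∀ S : Finset (Fin (n i)),
        (test.runDet (fun _ => acc i) [setList S, r.1]).2 ≤ q.eval (size i)) ∧
    (sample.runRandom (fun _ => acc i) [List.ofFn x]).map
      (fun r => Finset.univ.filter fun S : Finset (Fin (n i)) =>
        Accepts (test.runDet (fun _ => acc i) [setList S, r.1]).1) = (π i).fam x

/-- The oracles of a probing algorithm: the presentation of the constraints, the two separation
oracles, and a value oracle for the objective. -/
inductive OracleName : Type
  | constraints
  | sepIn
  | sepOut
  | objective

def oracles {n : ℕ} (acc : List ℝ → List ℝ) (sepIn sepOut : (Fin n → ℝ) → Option (Fin n → ℝ))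
    (f : Finset (Fin n) → ℝ) : OracleName → List ℝ → List ℝ
  | .constraints => acc
  | .sepIn => sepAnswer sepIn
  | .sepOut => sepAnswer sepOut
  | .objective => fun l => [f (listSet l)]

/-- Input of the program that decides on probing: the output of the preparation, the elements
revealed so far, what happened to them (`0`: not probed, `1`: inactive, `2`: active), and the
element that arrives. -/
def decideInput {n : ℕ} (seed : List ℝ) (h : History (Fin n)) (e : Fin n) : List (List ℝ) :=
  [seed, h.map fun q => ((q.1 : ℕ) : ℝ),
    h.map fun q => match q.2 with
      | none => 0
      | some false => 1
      | some true => 2,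
    [((e : ℕ) : ℝ)]]

/-- The probing algorithm given by two programs: `prepare` makes all random choices, from the input
`b` and `p`, before the first element is revealed; `choose` then decides online about each
element. -/
def programAlgorithm {n : ℕ} (prepare choose : Cmd OracleName)
    (O : OracleName → List ℝ → List ℝ) (b : ℝ) (p : Fin n → ℝ) : ProbingAlgorithm (Fin n) where
  Seed := List ℝ
  law := (prepare.runRandom O [[b], List.ofFn p]).map Prod.fst
  probe seed h e := decide (Accepts (choose.runDet O (decideInput seed h e)).1)

/-- The preparation, and each online decision, takes at most `t` steps, whatever the coins show. -/
def RunsInTime {n : ℕ} (prepare choose : Cmd OracleName)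
    (O : OracleName → List ℝ → List ℝ) (b : ℝ) (p : Fin n → ℝ) (t : ℕ) : Prop :=
  ∀ r ∈ (prepare.runRandom O [[b], List.ofFn p]).support,
    r.2 ≤ t ∧
    ∀ h : History (Fin n), h.length ≤ n → ∀ e,
      (choose.runDet O (decideInput r.1 h e)).2 ≤ t

end OCRS

end

set_option linter.unusedSectionVars false

/-! Write `F(x) = setExp x f` for the multilinear extension of `f`. Both parts find a vector `y` of
probing probabilities with `y ∈ b • Pout` and `y ∘ p ∈ b • Pin` for which `F(y ∘ p)` is large, and
then round `y` with the two schemes.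

Rounding. Draw `R` from `R(y)` and one family from each scheme (the inner one at `y ∘ p`, the outer
one at `y`), and probe an arriving element of `R` whenever both families permit it. Let `A` be the
set of active elements. Probed elements always lie in `R` and selected ones in `R ∩ A`, so an
element of `R ∩ A` that is selectable for the outer family with respect to `R` and for the inner one
with respect to `R ∩ A` is selected in every order of arrival. The adversary therefore has no
influence on these `survivors`. To bound their value, build it up element by element: the marginal
value of `e` with respect to `R ∩ A` and both selectability probabilities are decreasing in `(R, A)`
and do not depend on whether `e` itself is present. The FKG inequality turns this into the factor
`cin * cout` in front of `F(y ∘ p)` (`setExp_survivors_ge`).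

Benchmark. Let `z e` be the probability that a legal strategy `T` probes `e`. This event is
independent of the activity of `e`, so `z ∈ Pout` and `p ∘ z ∈ Pin`. Submodularity bounds the value
of `T`, for every `u`, by `F(u)` plus the sum of the expected marginal values at `u` weighted by `p
e * z e` (`ProbeTree.value_le`). Hence a short step of length `s` in direction `p ∘ z` gains almost
`s` times the remaining gap (`setExp_step`); the gap decays exponentially, and `F(b • (p ∘ z))` is
at least `1 - exp (-b)` times the value of `T`. For part (a), `y` maximizes `F(y ∘ p)` over a
compact set that contains `b • z`.

Part (b) replaces the maximizer by a discrete continuous greedy method: `n ^ 2` steps of length `b /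
n ^ 2`, with marginal values estimated from `n ^ 4` samples and a direction found by approximate
linear optimization over both polytopes. The optimization is perceptron-like: while the best point
found is too poor, a whole box around a good point is separated from the current point, and each
correction brings the current point closer to the center of the box (`perceptronBest_ge`). Each
source of error costs `O(1 / n)`, and `8 / (n + 1)` covers all of them (`lexp_greedyLaw_ge`). What
remains is to write these steps as programs whose output laws are exactly the ones analysed and
whose running times have explicit polynomial bounds. -/

noncomputable section

namespace OCRS

open scoped Classical Pointwise

/-! ### Expectations over random sets with independent elements. -/

variable {N : Type} [Fintype N]

/-- Expectation of `h` over the random set `R(x)`. -/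
def setExp (x : N → ℝ) (h : Finset N → ℝ) : ℝ := ∑ R, prodProb x R * h R

lemma prodProb_nonneg {x : N → ℝ} (hx : ∀ e, 0 ≤ x e ∧ x e ≤ 1) (R : Finset N) :
    0 ≤ prodProb x R := by
  refine Finset.prod_nonneg fun e _ => ?_
  split_ifs
  · exact (hx e).1
  · linarith [(hx e).2]

lemma prodProb_eq_mul (x : N → ℝ) (R : Finset N) :
    prodProb x R = (∏ e ∈ R, x e) * ∏ e ∈ Rᶜ, (1 - x e) := by
  rw [prodProb, ← Finset.prod_mul_prod_compl R]
  congr 1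
  · exact Finset.prod_congr rfl fun e he => by simp [he]
  · exact Finset.prod_congr rfl fun e he => by
      simp [Finset.mem_compl.1 he]

lemma sum_prodProb (x : N → ℝ) : ∑ R, prodProb x R = 1 := by
  simp_rw [prodProb_eq_mul]
  rw [← Fintype.prod_add]
  simp

lemma setExp_const (x : N → ℝ) (c : ℝ) : setExp x (fun _ => c) = c := by
  rw [setExp, ← Finset.sum_mul, sum_prodProb, one_mul]

lemma setExp_add (x : N → ℝ) (h k : Finset N → ℝ) :
    setExp x (fun R => h R + k R) = setExp x h + setExp x k := by
  simp [setExp, mul_add, Finset.sum_add_distrib]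

lemma setExp_sub (x : N → ℝ) (h k : Finset N → ℝ) :
    setExp x (fun R => h R - k R) = setExp x h - setExp x k := by
  simp [setExp, mul_sub, Finset.sum_sub_distrib]

lemma setExp_const_mul (x : N → ℝ) (c : ℝ) (h : Finset N → ℝ) :
    setExp x (fun R => c * h R) = c * setExp x h := by
  simp only [setExp, Finset.mul_sum]
  exact Finset.sum_congr rfl fun _ _ => by ring

lemma setExp_mul_const (x : N → ℝ) (c : ℝ) (h : Finset N → ℝ) :
    setExp x (fun R => h R * c) = setExp x h * c := by
  simp only [mul_comm _ c, setExp_const_mul]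

lemma setExp_sum {κ : Type*} (x : N → ℝ) (s : Finset κ) (h : κ → Finset N → ℝ) :
    setExp x (fun R => ∑ i ∈ s, h i R) = ∑ i ∈ s, setExp x (h i) := by
  simp only [setExp, Finset.mul_sum]
  exact Finset.sum_comm

lemma setExp_comm (x y : N → ℝ) (h : Finset N → Finset N → ℝ) :
    setExp x (fun R => setExp y (h R)) = setExp y fun A => setExp x fun R => h R A := by
  simp only [setExp, Finset.mul_sum]
  rw [Finset.sum_comm]
  exact Finset.sum_congr rfl fun _ _ => Finset.sum_congr rfl fun _ _ => by ring

lemma setExp_mono {x : N → ℝ} (hx : ∀ e, 0 ≤ x e ∧ x e ≤ 1) {h k : Finset N → ℝ}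
    (hk : ∀ R, h R ≤ k R) : setExp x h ≤ setExp x k :=
  Finset.sum_le_sum fun R _ => mul_le_mul_of_nonneg_left (hk R) (prodProb_nonneg hx R)

lemma setExp_nonneg {x : N → ℝ} (hx : ∀ e, 0 ≤ x e ∧ x e ≤ 1) {h : Finset N → ℝ}
    (hk : ∀ R, 0 ≤ h R) : 0 ≤ setExp x h :=
  Finset.sum_nonneg fun R _ => mul_nonneg (prodProb_nonneg hx R) (hk R)

/-- Conditioning on whether `e` belongs to the random set. -/
lemma setExp_split (x : N → ℝ) (e : N) (h : Finset N → ℝ) :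
    setExp x h = x e * setExp x (fun R => h (insert e R))
      + (1 - x e) * setExp x (fun R => h (R.erase e)) := by
  have huniv : (Finset.univ : Finset (Finset N)) = (insert e (Finset.univ.erase e)).powerset := by
    simp
  have key : ∀ k : Finset N → ℝ, setExp x k = ∑ R ∈ (Finset.univ.erase e).powerset,
      (∏ a ∈ Finset.univ.erase e, if a ∈ R then x a else 1 - x a) *
        ((1 - x e) * k R + x e * k (insert e R)) := by
    intro k
    rw [setExp, huniv, Finset.sum_powerset_insert (Finset.notMem_erase e _),
      ← Finset.sum_add_distrib]
    refine Finset.sum_congr rfl fun R hR => ?_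
    have heR : e ∉ R := fun h' => by simpa using Finset.mem_powerset.1 hR h'
    have h1 : prodProb x R = (1 - x e) *
        ∏ a ∈ Finset.univ.erase e, if a ∈ R then x a else 1 - x a := by
      rw [prodProb, ← Finset.mul_prod_erase _ _ (Finset.mem_univ e)]
      simp [heR]
    have h2 : prodProb x (insert e R) = x e *
        ∏ a ∈ Finset.univ.erase e, if a ∈ R then x a else 1 - x a := by
      rw [prodProb, ← Finset.mul_prod_erase _ _ (Finset.mem_univ e)]
      congr 1
      · simp
      · refine Finset.prod_congr rfl fun a ha => ?_
        simp [Finset.ne_of_mem_erase ha]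
    rw [h1, h2]
    ring
  rw [key h, key, key, Finset.mul_sum, Finset.mul_sum, ← Finset.sum_add_distrib]
  refine Finset.sum_congr rfl fun R hR => ?_
  have heR : e ∉ R := fun h' => by simpa using Finset.mem_powerset.1 hR h'
  simp only [Finset.insert_idem, Finset.erase_insert heR, Finset.erase_eq_of_notMem heR]
  ring

lemma setExp_ite_mem (x : N → ℝ) (e : N) (h : Finset N → ℝ)
    (hh : ∀ R, h (insert e R) = h R) :
    setExp x (fun R => if e ∈ R then h R else 0) = x e * setExp x h := by
  rw [setExp_split x e]
  simp [hh, setExp_const]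

lemma setExp_inter_insert (x : N → ℝ) {e : N} {S : Finset N} (he : e ∉ S) (h : Finset N → ℝ) :
    setExp x (fun R => h (R ∩ insert e S)) =
      x e * setExp x (fun R => h (insert e (R ∩ S))) + (1 - x e) * setExp x (fun R => h (R ∩ S)) := by
  rw [setExp_split x e]
  congr 3 <;> funext R <;> congr 1 <;> ext a <;> by_cases ha : a = e <;> simp [ha, he]

/-- The expectation of a monotone function is monotone in the marginals. -/
lemma setExp_mono_marginal {x y : N → ℝ} (hx : ∀ e, 0 ≤ x e ∧ x e ≤ 1)
    (hy : ∀ e, 0 ≤ y e ∧ y e ≤ 1) (hxy : ∀ e, x e ≤ y e) {h : Finset N → ℝ}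
    (hh : ∀ S T, S ⊆ T → h S ≤ h T) : setExp x h ≤ setExp y h := by
  -- Only the coordinates in `S` are visible to `h`, so the induction exchanges one marginal at a
  -- time.
  have key : ∀ S : Finset N, ∀ h : Finset N → ℝ, (∀ S T, S ⊆ T → h S ≤ h T) →
      setExp x (fun R => h (R ∩ S)) ≤ setExp y fun R => h (R ∩ S) := by
    intro S
    induction S using Finset.induction_on with
    | empty => intro h _; simp [setExp_const]
    | insert e S he ih =>
      intro h hh
      rw [setExp_inter_insert x he, setExp_inter_insert y he]
      have h1 := ih h hh
      have h2 := ih (fun X => h (insert e X)) fun A B hAB => hh _ _ (Finset.insert_subset_insert e hAB)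
      have h3 : setExp x (fun R => h (R ∩ S)) ≤ setExp x fun R => h (insert e (R ∩ S)) :=
        setExp_mono hx fun R => hh _ _ (Finset.subset_insert _ _)
      nlinarith [hx e, hy e, hxy e]
  simpa using key Finset.univ h hh

/-- The union of two independent sets misses `e` with probability `(1 - x e) * (1 - y e)`,
independently over `e`. -/
lemma setExp_union (x y : N → ℝ) (h : Finset N → ℝ) :
    setExp x (fun R => setExp y fun D => h (R ∪ D)) =
      setExp (fun e => 1 - (1 - x e) * (1 - y e)) h := by
  have key : ∀ S : Finset N, ∀ h : Finset N → ℝ,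
      setExp x (fun R => setExp y fun D => h ((R ∪ D) ∩ S)) =
      setExp (fun e => 1 - (1 - x e) * (1 - y e)) fun R => h (R ∩ S) := by
    intro S
    induction S using Finset.induction_on with
    | empty => intro h; simp [setExp_const]
    | insert e S he ih =>
      intro h
      rw [setExp_inter_insert _ he, ← ih h, ← ih fun X => h (insert e X), setExp_split x e]
      have h1 : ∀ R D : Finset N, (insert e R ∪ D) ∩ insert e S = insert e ((R ∪ D) ∩ S) := by
        intro R D; ext a; by_cases ha : a = e <;> simp [ha]
      have h2 : ∀ R D : Finset N, (R ∪ insert e D) ∩ insert e S = insert e ((R ∪ D) ∩ S) := by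
        intro R D; ext a; by_cases ha : a = e <;> simp [ha]
      have h3 : ∀ R D : Finset N, (R.erase e ∪ D.erase e) ∩ insert e S = (R ∪ D) ∩ S := by
        intro R D; ext a; by_cases ha : a = e <;> simp [ha, he]
      have h4 : ∀ R, setExp y (fun D => h ((R.erase e ∪ D) ∩ insert e S)) =
          y e * setExp y (fun D => h (insert e ((R ∪ D) ∩ S))) +
            (1 - y e) * setExp y fun D => h ((R ∪ D) ∩ S) := by
        intro R
        rw [setExp_split y e]
        congr 3 <;> funext D
        · rw [h2]; congr 1; ext a; by_cases ha : a = e <;> simp [ha]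
        · rw [h3]
      simp only [h1, h4, setExp_add, setExp_const_mul]
      ring
  simpa using key Finset.univ h

/-- Identifies the active part of `R(y)` with `R(y ∘ p)`, which is the random set the inner scheme
has to deal with. -/
lemma setExp_inter (x y : N → ℝ) (h : Finset N → ℝ) :
    setExp x (fun R => setExp y fun D => h (R ∩ D)) = setExp (fun e => x e * y e) h := by
  have key : ∀ S : Finset N, ∀ h : Finset N → ℝ,
      setExp x (fun R => setExp y fun D => h ((R ∩ D) ∩ S)) =
      setExp (fun e => x e * y e) fun R => h (R ∩ S) := by
    intro S
    induction S using Finset.induction_on with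
    | empty => intro h; simp [setExp_const]
    | insert e S he ih =>
      intro h
      rw [setExp_inter_insert _ he, ← ih h, ← ih fun X => h (insert e X), setExp_split x e]
      have h1 : ∀ R D : Finset N, (insert e R ∩ insert e D) ∩ insert e S
          = insert e ((R ∩ D) ∩ S) := by
        intro R D; ext a; by_cases ha : a = e <;> simp [ha, and_assoc]
      have h2 : ∀ R D : Finset N, (insert e R ∩ D.erase e) ∩ insert e S = (R ∩ D) ∩ S := by
        intro R D; ext a; by_cases ha : a = e <;> simp [ha, he]
      have h3 : ∀ R D : Finset N, (R.erase e ∩ D) ∩ insert e S = (R ∩ D) ∩ S := by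
        intro R D; ext a; by_cases ha : a = e <;> simp [ha, he]
      have h4 : ∀ R, setExp y (fun D => h ((insert e R ∩ D) ∩ insert e S)) =
          y e * setExp y (fun D => h (insert e ((R ∩ D) ∩ S))) +
            (1 - y e) * setExp y fun D => h ((R ∩ D) ∩ S) := by
        intro R
        rw [setExp_split y e]
        simp only [h1, h2]
      simp only [h3, h4, setExp_add, setExp_const_mul]
      ring
  simpa using key Finset.univ h

/-- Each `e` lies in as many of `R`, `S` as of `R ∩ S`, `R ∪ S`. This is the lattice condition of
FKG, with equality. -/
lemma prodProb_mul_prodProb (x : N → ℝ) (R S : Finset N) :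
    prodProb x R * prodProb x S = prodProb x (R ∩ S) * prodProb x (R ∪ S) := by
  simp only [prodProb, ← Finset.prod_mul_distrib]
  refine Finset.prod_congr rfl fun e _ => ?_
  by_cases h1 : e ∈ R <;> by_cases h2 : e ∈ S <;> simp [h1, h2, mul_comm]

/-- Positive correlation of non-negative decreasing functions of two independent random sets. -/
lemma setExp_mul_le_of_antitone {x y : N → ℝ} (hx : ∀ e, 0 ≤ x e ∧ x e ≤ 1)
    (hy : ∀ e, 0 ≤ y e ∧ y e ≤ 1) {g h : Finset N → Finset N → ℝ}
    (hg0 : ∀ R A, 0 ≤ g R A) (hh0 : ∀ R A, 0 ≤ h R A)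
    (hg : ∀ R R' A A', R ⊆ R' → A ⊆ A' → g R' A' ≤ g R A)
    (hh : ∀ R R' A A', R ⊆ R' → A ⊆ A' → h R' A' ≤ h R A) :
    setExp x (fun R => setExp y (g R)) * setExp x (fun R => setExp y (h R)) ≤
      setExp x fun R => setExp y fun A => g R A * h R A := by
  -- `fkg` is about increasing functions; the order dual of the lattice of pairs of sets makes the
  -- decreasing ones increasing.
  have conv : ∀ k : Finset N → Finset N → ℝ, setExp x (fun R => setExp y (k R)) =
      ∑ z : (Finset N × Finset N)ᵒᵈ, (prodProb x (OrderDual.ofDual z).1 *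
        prodProb y (OrderDual.ofDual z).2) * k (OrderDual.ofDual z).1 (OrderDual.ofDual z).2 := by
    intro k
    rw [← Equiv.sum_comp OrderDual.toDual, Fintype.sum_prod_type]
    simp [setExp, Finset.mul_sum, mul_assoc]
  have h1 : ∑ z : (Finset N × Finset N)ᵒᵈ, (prodProb x (OrderDual.ofDual z).1 *
        prodProb y (OrderDual.ofDual z).2) = 1 := by
    have := conv fun _ _ => 1
    simp only [setExp_const, mul_one] at this
    exact this.symm
  rw [conv, conv, conv]
  refine (fkg (μ := fun z : (Finset N × Finset N)ᵒᵈ => prodProb x (OrderDual.ofDual z).1 *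
        prodProb y (OrderDual.ofDual z).2)
      (f := fun z => g (OrderDual.ofDual z).1 (OrderDual.ofDual z).2)
      (g := fun z => h (OrderDual.ofDual z).1 (OrderDual.ofDual z).2)
      (fun z => mul_nonneg (prodProb_nonneg hx _) (prodProb_nonneg hy _))
      (fun z => hg0 _ _) (fun z => hh0 _ _)
      (fun a b hab => ?_) (fun a b hab => ?_) ?_).trans ?_
  · have : OrderDual.ofDual b ≤ OrderDual.ofDual a := hab
    exact hg _ _ _ _ this.1 this.2
  · have : OrderDual.ofDual b ≤ OrderDual.ofDual a := hab
    exact hh _ _ _ _ this.1 this.2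
  · intro a b
    have e1 := prodProb_mul_prodProb x (OrderDual.ofDual a).1 (OrderDual.ofDual b).1
    have e2 := prodProb_mul_prodProb y (OrderDual.ofDual a).2 (OrderDual.ofDual b).2
    apply le_of_eq
    simp only [ofDual_inf, ofDual_sup, Prod.fst_sup, Prod.snd_sup, Prod.fst_inf, Prod.snd_inf,
      Finset.sup_eq_union, Finset.inf_eq_inter]
    calc _ = (prodProb x (OrderDual.ofDual a).1 * prodProb x (OrderDual.ofDual b).1) *
          (prodProb y (OrderDual.ofDual a).2 * prodProb y (OrderDual.ofDual b).2) := by ring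
      _ = _ := by rw [e1, e2]; ring
  · rw [h1, one_mul]

/-! ### Rounding with two greedy schemes -/

lemma Selectable.anti {N : Type} {G : Finset (Finset N)} {R R' : Finset N} {e : N}
    (h : Selectable G R' e) (hR : R ⊆ R') : Selectable G R e :=
  fun I hI hG => h I (hI.trans hR) hG

/-- A set `I` that contains `e` imposes no condition. So selectability of `e` is independent of the
presence of `e`, and conditioning on that presence is free. -/
lemma selectable_erase {N : Type} {G : Finset (Finset N)} {R : Finset N} {e : N} :
    Selectable G (R.erase e) e ↔ Selectable G R e := by
  refine ⟨fun h I hI hG => ?_, fun h => h.anti (Finset.erase_subset _ _)⟩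
  by_cases he : e ∈ I
  · rwa [Finset.insert_eq_of_mem he]
  · exact h I (fun a ha => Finset.mem_erase.2 ⟨fun h' => he (h' ▸ ha), hI ha⟩) hG

/-- The elements that are selected whatever the order of arrival. -/
def survivors {N : Type} (Gin Gout : Finset (Finset N)) (R A : Finset N) : Finset N :=
  (R ∩ A).filter fun e => Selectable Gin (R ∩ A) e ∧ Selectable Gout R e

/-- Probability that `e` is selectable for the realization `R`. -/
def selectFrac {N : Type} [Fintype N] (μ : PMF (Finset (Finset N))) (e : N) (R : Finset N) : ℝ :=
  ∑ G, (μ G).toReal * (if Selectable G R e then 1 else 0)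

section
variable {N : Type} [Fintype N]

lemma GreedyOCRS.selectProb_eq {F : Set (Finset N)} {P : Set (N → ℝ)} (π : GreedyOCRS F P)
    (x : N → ℝ) (e : N) : π.selectProb x e = setExp x (selectFrac (π.fam x) e) := by
  simp only [GreedyOCRS.selectProb, setExp, selectFrac, Finset.mul_sum, mul_assoc]

lemma sum_pmf_toReal {α : Type*} [Fintype α] (μ : PMF α) : ∑ a, (μ a).toReal = 1 := by
  rw [← ENNReal.toReal_sum fun a _ => μ.apply_ne_top a, ← tsum_fintype (L := .unconditional _),
    μ.tsum_coe, ENNReal.toReal_one]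

lemma selectFrac_nonneg (μ : PMF (Finset (Finset N))) (e : N) (R : Finset N) :
    0 ≤ selectFrac μ e R :=
  Finset.sum_nonneg fun G _ => mul_nonneg ENNReal.toReal_nonneg (by split_ifs <;> norm_num)

lemma selectFrac_anti (μ : PMF (Finset (Finset N))) (e : N) {R R' : Finset N} (h : R ⊆ R') :
    selectFrac μ e R' ≤ selectFrac μ e R := by
  refine Finset.sum_le_sum fun G _ => mul_le_mul_of_nonneg_left ?_ ENNReal.toReal_nonneg
  by_cases h1 : Selectable G R' e
  · simp [h1, h1.anti h]
  · rw [if_neg h1]; split_ifs <;> norm_num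

lemma selectFrac_congr (μ : PMF (Finset (Finset N))) (e : N) {R R' : Finset N}
    (h : R.erase e = R'.erase e) : selectFrac μ e R = selectFrac μ e R' := by
  simp only [selectFrac]
  refine Finset.sum_congr rfl fun G _ => ?_
  rw [← selectable_erase (R := R), h, selectable_erase]

lemma IsMonotoneSubmodular.marginal_anti {f : Finset N → ℝ} (hf : IsMonotoneSubmodular f) (e : N)
    {S T : Finset N} (h : S ⊆ T) : f (insert e T) - f T ≤ f (insert e S) - f S := by
  by_cases he : e ∈ T
  · rw [Finset.insert_eq_of_mem he, sub_self]
    linarith [hf.mono S _ (Finset.subset_insert e S)]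
  · have h1 := hf.submod (insert e S) T
    have h2 : insert e S ∪ T = insert e T := by
      ext a; simp only [Finset.mem_union, Finset.mem_insert]
      constructor
      · rintro ((h' | h') | h') <;> simp [h', h _]
      · rintro (h' | h') <;> simp [h']
    have h3 : insert e S ∩ T = S := by
      ext a; simp only [Finset.mem_inter, Finset.mem_insert]
      constructor
      · rintro ⟨h' | h', h''⟩
        · exact absurd (h' ▸ h'') he
        · exact h'
      · exact fun h' => ⟨Or.inr h', h h'⟩
    rw [h2, h3] at h1
    linarith

/-- Since `k` ignores whether `e` lies in either set, the event `e ∈ R ∩ A` is independent of it and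
factors out. -/
lemma setExp_prod_mem {y p : N → ℝ} (e : N) (k : Finset N → Finset N → ℝ)
    (h1 : ∀ R A, k (insert e R) A = k R A) (h2 : ∀ R A, k R (insert e A) = k R A) :
    setExp y (fun R => setExp p fun A => if e ∈ R ∩ A then k R A else 0) =
      y e * p e * setExp y fun R => setExp p (k R) := by
  have : ∀ R, setExp p (fun A => if e ∈ R ∩ A then k R A else 0) =
      if e ∈ R then p e * setExp p (k R) else 0 := by
    intro R
    by_cases hR : e ∈ R
    · rw [if_pos hR, ← setExp_ite_mem p e _ (h2 R)]
      simp [hR]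
    · simp [hR, setExp_const]
  simp only [this]
  rw [setExp_ite_mem y e (fun R => p e * setExp p (k R)), setExp_const_mul, mul_assoc]
  intro R
  simp only [funext (h1 R)]

/-- The value retained by the survivors of both schemes. -/
theorem setExp_survivors_ge {y p : N → ℝ} (hy : ∀ e, 0 ≤ y e ∧ y e ≤ 1)
    (hp : ∀ e, 0 ≤ p e ∧ p e ≤ 1) {μin μout : PMF (Finset (Finset N))} {cin cout : ℝ}
    (hcin : 0 ≤ cin) (hcin1 : cin ≤ 1) (hcout : 0 ≤ cout) (hcout1 : cout ≤ 1)
    (hin : ∀ e, cin ≤ setExp (fun e => y e * p e) (selectFrac μin e))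
    (hout : ∀ e, cout ≤ setExp y (selectFrac μout e))
    {f : Finset N → ℝ} (hf : IsMonotoneSubmodular f) :
    cin * cout * setExp (fun e => y e * p e) f ≤
      setExp y fun R => setExp p fun A => ∑ Gin, ∑ Gout,
        (μin Gin).toReal * (μout Gout).toReal * f (survivors Gin Gout R A) := by
  have hcc : cin * cout ≤ 1 := mul_le_one₀ hcin1 hcout hcout1
  have hcc0 : 0 ≤ cin * cout := mul_nonneg hcin hcout
  -- Growing `T` by one element decomposes both sides into marginal values, which are compared
  -- element by element. The base case uses `f ∅ ≥ 0` and `cin * cout ≤ 1`.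
  have key : ∀ T : Finset N, cin * cout * setExp (fun e => y e * p e) (fun X => f (X ∩ T)) ≤
      setExp y fun R => setExp p fun A => ∑ Gin, ∑ Gout,
        (μin Gin).toReal * (μout Gout).toReal * f (survivors Gin Gout R A ∩ T) := by
    intro T
    induction T using Finset.induction_on with
    | empty =>
      simp only [Finset.inter_empty, ← Finset.sum_mul, ← Finset.mul_sum, sum_pmf_toReal,
        setExp_const]
      nlinarith [hf.nonneg ∅]
    | insert e T he ih =>
      set m : Finset N → ℝ := fun X => f (insert e (X ∩ T)) - f (X ∩ T) with hm
      have hm0 : ∀ X, 0 ≤ m X := fun X => sub_nonneg.2 (hf.mono _ _ (Finset.subset_insert _ _))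
      have hmanti : ∀ X X', X ⊆ X' → m X' ≤ m X := fun X X' h =>
        hf.marginal_anti e (Finset.inter_subset_inter_right h)
      have hmer : ∀ X X', X.erase e = X'.erase e → m X = m X' := by
        intro X X' h
        have : X ∩ T = X' ∩ T := by
          have h' : ∀ Z : Finset N, Z ∩ T = Z.erase e ∩ T := by
            intro Z; ext a; by_cases ha : a = e <;> simp [ha, he]
          rw [h' X, h, ← h']
        simp only [hm, this]
      set k : Finset N → Finset N → ℝ := fun R A =>
        selectFrac μin e (R ∩ A) * selectFrac μout e R * m (R ∩ A) with hk
      -- The survivors are a subset of `R ∩ A`, so by submodularity a surviving `e` adds at least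
      -- its marginal value with respect to `R ∩ A`, a quantity that no longer involves the
      -- families.
      have step : ∀ R A, (∑ Gin, ∑ Gout,
            (μin Gin).toReal * (μout Gout).toReal * f (survivors Gin Gout R A ∩ T)) +
            (if e ∈ R ∩ A then k R A else 0) ≤
          ∑ Gin, ∑ Gout,
            (μin Gin).toReal * (μout Gout).toReal * f (survivors Gin Gout R A ∩ insert e T) := by
        intro R A
        have hk' : (if e ∈ R ∩ A then k R A else 0) = ∑ Gin, ∑ Gout,
            (μin Gin).toReal * (μout Gout).toReal *
              (if e ∈ survivors Gin Gout R A then m (R ∩ A) else 0) := by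
          by_cases heX : e ∈ R ∩ A
          · rw [if_pos heX, hk]
            simp only [selectFrac, Finset.sum_mul, Finset.mul_sum]
            refine Finset.sum_comm.trans ?_
            refine Finset.sum_congr rfl fun Gin _ => Finset.sum_congr rfl fun Gout _ => ?_
            have : e ∈ survivors Gin Gout R A ↔ Selectable Gin (R ∩ A) e ∧ Selectable Gout R e := by
              simp [survivors, Finset.mem_inter.1 heX]
            by_cases h1 : Selectable Gin (R ∩ A) e <;> by_cases h2 : Selectable Gout R e <;>
              simp [this, h1, h2]
          · have : ∀ Gin Gout, e ∉ survivors Gin Gout R A := fun _ _ h =>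
              heX (Finset.mem_filter.1 h).1
            simp [heX, this]
        rw [hk', ← Finset.sum_add_distrib]
        refine Finset.sum_le_sum fun Gin _ => ?_
        rw [← Finset.sum_add_distrib]
        refine Finset.sum_le_sum fun Gout _ => ?_
        rw [← mul_add]
        refine mul_le_mul_of_nonneg_left ?_ (mul_nonneg ENNReal.toReal_nonneg ENNReal.toReal_nonneg)
        by_cases heS : e ∈ survivors Gin Gout R A
        · rw [if_pos heS, Finset.inter_insert_of_mem heS]
          have h1 : survivors Gin Gout R A ⊆ R ∩ A := Finset.filter_subset _ _
          have := hf.marginal_anti e (Finset.inter_subset_inter_right (u := T) h1)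
          simp only [hm]
          linarith
        · rw [if_neg heS, add_zero]
          exact hf.mono _ _ (Finset.inter_subset_inter_left (Finset.subset_insert _ _))
      have hkE : setExp y (fun R => setExp p fun A => if e ∈ R ∩ A then k R A else 0) =
          y e * p e * setExp y fun R => setExp p (k R) := by
        refine setExp_prod_mem e k (fun R A => ?_) (fun R A => ?_)
        · have h1 : (insert e R ∩ A).erase e = (R ∩ A).erase e := by
            ext a; by_cases ha : a = e <;> simp [ha]
          have h2 : (insert e R).erase e = R.erase e := by
            ext a; by_cases ha : a = e <;> simp [ha]
          simp only [hk, selectFrac_congr μin e h1, selectFrac_congr μout e h2, hmer _ _ h1]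
        · have h1 : (R ∩ insert e A).erase e = (R ∩ A).erase e := by
            ext a; by_cases ha : a = e <;> simp [ha]
          simp only [hk, selectFrac_congr μin e h1, hmer _ _ h1]
      have hin' : cin ≤ setExp y fun R => setExp p fun A => selectFrac μin e (R ∩ A) := by
        rw [setExp_inter]; exact hin e
      have hout' : cout ≤ setExp y fun R => setExp p fun _ => selectFrac μout e R := by
        simp only [setExp_const]; exact hout e
      -- Two applications of FKG: first to the two selectability probabilities, then to their
      -- product and the marginal value.
      have c1 := setExp_mul_le_of_antitone hy hp
        (g := fun R A => selectFrac μin e (R ∩ A)) (h := fun R _ => selectFrac μout e R)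
        (fun _ _ => selectFrac_nonneg _ _ _) (fun _ _ => selectFrac_nonneg _ _ _)
        (fun R R' A A' h h' => selectFrac_anti _ _ (Finset.inter_subset_inter h h'))
        (fun R R' A A' h h' => selectFrac_anti _ _ h)
      have c2 := setExp_mul_le_of_antitone hy hp
        (g := fun R A => selectFrac μin e (R ∩ A) * selectFrac μout e R) (h := fun R A => m (R ∩ A))
        (fun _ _ => mul_nonneg (selectFrac_nonneg _ _ _) (selectFrac_nonneg _ _ _))
        (fun _ _ => hm0 _)
        (fun R R' A A' h h' => mul_le_mul (selectFrac_anti _ _ (Finset.inter_subset_inter h h'))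
          (selectFrac_anti _ _ h) (selectFrac_nonneg _ _ _) (selectFrac_nonneg _ _ _))
        (fun R R' A A' h h' => hmanti _ _ (Finset.inter_subset_inter h h'))
      have hM0 : 0 ≤ setExp y fun R => setExp p fun A => m (R ∩ A) :=
        setExp_nonneg hy fun R => setExp_nonneg hp fun A => hm0 _
      have c3 : cin * cout * (setExp y fun R => setExp p fun A => m (R ∩ A)) ≤
          setExp y fun R => setExp p (k R) :=
        (mul_le_mul_of_nonneg_right ((mul_le_mul hin' hout' hcout (hcin.trans hin')).trans c1)
          hM0).trans c2
      have hleft : setExp (fun e => y e * p e) (fun X => f (X ∩ insert e T)) =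
          setExp (fun e => y e * p e) (fun X => f (X ∩ T)) +
            y e * p e * setExp y fun R => setExp p fun A => m (R ∩ A) := by
        rw [setExp_inter, setExp_inter_insert _ he]
        simp only [hm, setExp_sub]
        ring
      have hsum := setExp_mono hy fun R => setExp_mono hp (step R)
      simp only [setExp_add] at hsum
      rw [hkE] at hsum
      refine le_trans ?_ hsum
      rw [hleft, mul_add]
      refine add_le_add ih ?_
      calc _ = y e * p e * (cin * cout * setExp y fun R => setExp p fun A => m (R ∩ A)) := by ring
        _ ≤ _ := mul_le_mul_of_nonneg_left c3 (mul_nonneg (hy e).1 (hp e).1)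
  simpa using key Finset.univ

/-! ### The greedy probing rule -/

lemma History.mem_probed {h : History N} {e : N} : e ∈ h.probed ↔ ∃ a, (e, some a) ∈ h := by
  simp [History.probed]

lemma History.mem_selected {h : History N} {e : N} : e ∈ h.selected ↔ (e, some true) ∈ h := by
  simp [History.selected]

lemma History.probed_append_none (h : History N) (e : N) :
    History.probed (h ++ [(e, none)]) = h.probed := by
  ext a; simp [History.mem_probed]

lemma History.selected_append_none (h : History N) (e : N) :
    History.selected (h ++ [(e, none)]) = h.selected := by
  ext a; simp [History.mem_selected]

lemma History.probed_append_some (h : History N) (e : N) (a : Bool) :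
    History.probed (h ++ [(e, some a)]) = insert e h.probed := by
  ext a
  simp only [History.mem_probed, List.mem_append, List.mem_singleton, Prod.mk.injEq,
    Option.some.injEq, Finset.mem_insert]
  constructor
  · rintro ⟨b, h' | h'⟩
    · exact Or.inr ⟨b, h'⟩
    · exact Or.inl h'.1
  · rintro (h' | ⟨b, h'⟩)
    · exact ⟨_, Or.inr ⟨h', rfl⟩⟩
    · exact ⟨b, Or.inl h'⟩

lemma History.selected_append_some (h : History N) (e : N) (a : Bool) :
    History.selected (h ++ [(e, some a)]) = if a then insert e h.selected else h.selected := by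
  cases a <;> ext b <;> simp [History.mem_selected, or_comm, eq_comm]

/-- With the seed `s` the algorithm probes the elements of `R` greedily for the families
`Gin` and `Gout`. -/
def ProbingAlgorithm.GreedyAt (alg : ProbingAlgorithm N) (s : alg.Seed) (R : Finset N)
    (Gin Gout : Finset (Finset N)) : Prop :=
  ∀ h e, alg.probe s h e = true ↔
    e ∈ R ∧ insert e (History.probed h) ∈ Gout ∧ insert e (History.selected h) ∈ Gin

/-- When a survivor `e` arrives, the probed set is a subset of `R` in `Gout` and the selected set is
a subset of `R ∩ A` in `Gin`. Selectability of `e`, applied to exactly these two sets, says that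
both may be extended by `e`; so `e` is probed and, being active, selected. -/
lemma ProbingAlgorithm.GreedyAt.runFrom {alg : ProbingAlgorithm N} {s : alg.Seed} {R : Finset N}
    {Gin Gout : Finset (Finset N)} (hg : alg.GreedyAt s R Gin Gout) (A : Finset N) (l : List N)
    (h : History N) (hout : h.probed ∈ Gout) (hin : h.selected ∈ Gin) (hR : h.probed ⊆ R)
    (hA : h.selected ⊆ R ∩ A) :
    (alg.runFrom s A l h).probed ∈ Gout ∧ (alg.runFrom s A l h).selected ∈ Gin ∧
      h.selected ⊆ (alg.runFrom s A l h).selected ∧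
      ∀ e ∈ l, e ∈ survivors Gin Gout R A → e ∈ (alg.runFrom s A l h).selected := by
  induction l generalizing h with
  | nil => simp [ProbingAlgorithm.runFrom, hout, hin]
  | cons e l ih =>
    simp only [ProbingAlgorithm.runFrom]
    by_cases hp : alg.probe s h e = true
    · obtain ⟨heR, ho, hi⟩ := (hg h e).1 hp
      simp only [hp, if_true]
      set a := decide (e ∈ A) with ha
      have hsel : h.selected ⊆ History.selected (h ++ [(e, some a)]) := by
        rw [History.selected_append_some]; split_ifs
        · exact Finset.subset_insert _ _
        · exact Finset.Subset.refl _
      obtain ⟨h1, h2, h3, h4⟩ := ih (h ++ [(e, some a)])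
        (by rwa [History.probed_append_some])
        (by rw [History.selected_append_some]; split_ifs <;> assumption)
        (by rw [History.probed_append_some]; exact Finset.insert_subset heR hR)
        (by
          rw [History.selected_append_some]
          split_ifs with h'
          · exact Finset.insert_subset (Finset.mem_inter.2 ⟨heR, by simpa [ha] using h'⟩) hA
          · exact hA)
      refine ⟨h1, h2, hsel.trans h3, fun e' he' hs => ?_⟩
      rcases List.mem_cons.1 he' with rfl | he'
      · have : e' ∈ A := (Finset.mem_inter.1 (Finset.mem_filter.1 hs).1).2
        apply h3
        rw [History.selected_append_some]
        simp [ha, this]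
      · exact h4 e' he' hs
    · simp only [hp]
      obtain ⟨h1, h2, h3, h4⟩ := ih (h ++ [(e, none)])
        (by rwa [History.probed_append_none]) (by rwa [History.selected_append_none])
        (by rwa [History.probed_append_none]) (by rwa [History.selected_append_none])
      rw [History.selected_append_none] at h3
      refine ⟨h1, h2, h3, fun e' he' hs => ?_⟩
      rcases List.mem_cons.1 he' with rfl | he'
      · exfalso
        obtain ⟨hX, hsi, hso⟩ := Finset.mem_filter.1 hs
        exact hp ((hg h e').2 ⟨(Finset.mem_inter.1 hX).1, hso _ hR hout, hsi _ hA hin⟩)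
      · exact h4 e' he' hs

/-- Greedy probing respects the families and selects all survivors, whatever the order. -/
lemma ProbingAlgorithm.GreedyAt.finalHistory {alg : ProbingAlgorithm N} {s : alg.Seed}
    {R : Finset N} {Gin Gout : Finset (Finset N)} (hg : alg.GreedyAt s R Gin Gout)
    (hin : ∅ ∈ Gin) (hout : ∅ ∈ Gout) (A : Finset N) (l : RevealOrder N) :
    (alg.finalHistory s A l).probed ∈ Gout ∧ (alg.finalHistory s A l).selected ∈ Gin ∧
      survivors Gin Gout R A ⊆ (alg.finalHistory s A l).selected := by
  have h0 : History.probed ([] : History N) = ∅ := by ext; simp [History.mem_probed]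
  have h1 : History.selected ([] : History N) = ∅ := by ext; simp [History.mem_selected]
  obtain ⟨h2, h3, -, h4⟩ := hg.runFrom A l.1 [] (by rwa [h0]) (by rwa [h1]) (by simp [h0])
    (by simp [h1])
  exact ⟨h2, h3, fun e he => h4 e (l.2.2 e) he⟩

end

/-! ### Relaxations -/

section
variable {N : Type}

lemma IsRelaxation.convex {F : Set (Finset N)} {P : Set (N → ℝ)} (h : IsRelaxation F P) :
    Convex ℝ P := by
  obtain ⟨V, rfl⟩ := h.polytope
  exact convex_convexHull ℝ _

lemma IsRelaxation.charVec_mem {F : Set (Finset N)} {P : Set (N → ℝ)} (h : IsRelaxation F P)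
    {S : Finset N} (hS : S ∈ F) : charVec S ∈ P := by
  have : charVec S ∈ feasiblePolytope F ∩ zeroOneVecs N :=
    ⟨subset_convexHull ℝ _ ⟨S, hS, rfl⟩, fun e => by unfold charVec; split_ifs <;> simp⟩
  rw [← h.same_points] at this
  exact this.1

lemma IsRelaxation.feasiblePolytope_subset {F : Set (Finset N)} {P : Set (N → ℝ)}
    (h : IsRelaxation F P) : feasiblePolytope F ⊆ P :=
  convexHull_min (by rintro _ ⟨S, hS, rfl⟩; exact h.charVec_mem hS) h.convex

lemma charVec_empty : charVec (∅ : Finset N) = 0 := by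
  funext e; simp [charVec]

lemma IsDownClosedFamily.empty_mem {F : Set (Finset N)} (h : IsDownClosedFamily F) : ∅ ∈ F := by
  obtain ⟨S, hS⟩ := h.nonempty
  exact h.down S hS _ (Finset.empty_subset _)

lemma IsRelaxation.zero_mem {F : Set (Finset N)} {P : Set (N → ℝ)} (h : IsRelaxation F P)
    (hF : IsDownClosedFamily F) : (0 : N → ℝ) ∈ P :=
  charVec_empty (N := N) ▸ h.charVec_mem hF.empty_mem

lemma IsRelaxation.smul_subset {F : Set (Finset N)} {P : Set (N → ℝ)} (h : IsRelaxation F P)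
    (hF : IsDownClosedFamily F) {b : ℝ} (hb : 0 ≤ b) (hb1 : b ≤ 1) : b • P ⊆ P := by
  rintro _ ⟨x, hx, rfl⟩
  exact h.convex.smul_mem_of_zero_mem (h.zero_mem hF) hx ⟨hb, hb1⟩

/-- If `{e}` is infeasible then, by down-closedness, no feasible set contains `e`, and coordinate
`e` vanishes on the polytope of `F`. Hence a separation oracle can recognize the usable elements. -/
lemma IsRelaxation.singleton_mem_iff {F : Set (Finset N)} {P : Set (N → ℝ)}
    (h : IsRelaxation F P) (hF : IsDownClosedFamily F) {e : N} :
    charVec {e} ∈ P ↔ {e} ∈ F := by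
  refine ⟨fun he => ?_, fun he => h.charVec_mem he⟩
  have h1 : charVec {e} ∈ P ∩ zeroOneVecs N :=
    ⟨he, fun a => by unfold charVec; split_ifs <;> simp⟩
  rw [h.same_points] at h1
  by_contra hne
  have h2 : feasiblePolytope F ⊆ {x | x e ≤ 0} := by
    refine convexHull_min ?_ ?_
    · rintro _ ⟨S, hS, rfl⟩
      have : e ∉ S := fun heS => hne (hF.down S hS _ (Finset.singleton_subset_iff.2 heS))
      simp [charVec, this]
    · exact convex_halfSpace_le (f := fun x : N → ℝ => x e) ⟨fun _ _ => rfl, fun _ _ => rfl⟩ 0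
  have := h2 h1.1
  simp [charVec] at this
  linarith

end

/-! ### Adaptive strategies -/

section
variable {N : Type} [Fintype N]

/-- The activity of `e` becomes known only by probing `e`, so it cannot influence whether `e` is
ever probed. -/
lemma ProbeTree.mem_probed_congr (T : ProbeTree N) {e : N} {A A' : Finset N}
    (h : A.erase e = A'.erase e) : e ∈ T.probed A ↔ e ∈ T.probed A' := by
  induction T with
  | halt => simp [ProbeTree.probed]
  | probe a t u iht ihu =>
    simp only [ProbeTree.probed, Finset.mem_insert]
    by_cases ha : e = a
    · simp [ha]
    · have : a ∈ A ↔ a ∈ A' := by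
        have := Finset.ext_iff.1 h a
        simpa [Ne.symm (a := e) (b := a) ha] using this
      simp only [ha, false_or, this]
      split_ifs <;> assumption

/-- The probability that the strategy probes `e`. -/
def ProbeTree.probeProb (p : N → ℝ) (T : ProbeTree N) (e : N) : ℝ :=
  setExp p fun A => if e ∈ T.probed A then 1 else 0

/-- The activity of `e` and the event that `e` is probed are independent. -/
lemma ProbeTree.selected_marginal (p : N → ℝ) (T : ProbeTree N) (e : N) :
    setExp p (fun A => if e ∈ T.selected A then 1 else 0) = p e * T.probeProb p e := by
  rw [ProbeTree.probeProb, ← setExp_ite_mem p e]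
  · congr 1; funext A
    by_cases h1 : e ∈ A <;> simp [ProbeTree.selected, h1]
  · intro A
    have : e ∈ T.probed (insert e A) ↔ e ∈ T.probed A := T.mem_probed_congr (by
      ext a; by_cases ha : a = e <;> simp [ha])
    simp only [this]

lemma setExp_charVec_mem {F : Set (Finset N)} {p : N → ℝ} (hp : ∀ e, 0 ≤ p e ∧ p e ≤ 1)
    (φ : Finset N → Finset N) (hφ : ∀ A, φ A ∈ F) :
    (fun e => setExp p fun A => if e ∈ φ A then 1 else 0) ∈ feasiblePolytope F := by
  have : (fun e => setExp p fun A => if e ∈ φ A then 1 else 0) =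
      ∑ A, prodProb p A • charVec (φ A) := by
    funext e
    simp [setExp, charVec]
  rw [this]
  exact (convex_convexHull ℝ _).sum_mem (fun A _ => prodProb_nonneg hp A) (sum_prodProb p)
    fun A _ => subset_convexHull ℝ _ ⟨φ A, hφ A, rfl⟩

lemma ProbeTree.Legal.probeProb_mem {Finn Fout : Set (Finset N)} {T : ProbeTree N}
    (hT : T.Legal Finn Fout) {p : N → ℝ} (hp : ∀ e, 0 ≤ p e ∧ p e ≤ 1) :
    T.probeProb p ∈ feasiblePolytope Fout ∧
      (fun e => p e * T.probeProb p e) ∈ feasiblePolytope Finn := by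
  refine ⟨setExp_charVec_mem hp T.probed fun A => (hT A).1, ?_⟩
  simp only [← ProbeTree.selected_marginal]
  exact setExp_charVec_mem hp T.selected fun A => (hT A).2

lemma ProbeTree.Legal.probeProb_eq_zero {Finn Fout : Set (Finset N)}
    (hin : IsDownClosedFamily Finn) (hout : IsDownClosedFamily Fout) {T : ProbeTree N}
    (hT : T.Legal Finn Fout) (p : N → ℝ) {e : N} (he : ¬ ({e} ∈ Finn ∧ {e} ∈ Fout)) :
    T.probeProb p e = 0 := by
  have : ∀ A, e ∉ T.probed A := by
    intro A hA
    -- With `e` made active, `e` is still probed and thus selected, so legality applies to the inner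
    -- constraint too.
    have h1 : e ∈ T.probed (insert e A) := (T.mem_probed_congr (by
      ext a; by_cases ha : a = e <;> simp [ha])).2 hA
    refine he ⟨hin.down _ (hT (insert e A)).2 _ ?_, hout.down _ (hT A).1 _ ?_⟩
    · simp [ProbeTree.selected, h1]
    · simpa using hA
  simp [ProbeTree.probeProb, this, setExp_const]

lemma IsMonotoneSubmodular.union_le {f : Finset N → ℝ} (hf : IsMonotoneSubmodular f)
    (R S : Finset N) : f (R ∪ S) ≤ f R + ∑ e ∈ S, (f (insert e R) - f R) := by
  induction S using Finset.induction_on with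
  | empty => simp
  | insert a S ha ih =>
    rw [Finset.sum_insert ha, Finset.union_insert]
    have := hf.marginal_anti a (Finset.subset_union_left (s₁ := R) (s₂ := S))
    linarith

/-- The expected marginal value of `e` with respect to the random set `R(u)`. -/
def expGain (f : Finset N → ℝ) (u : N → ℝ) (e : N) : ℝ :=
  setExp u fun R => f (insert e R) - f R

lemma expGain_nonneg {f : Finset N → ℝ} (hf : IsMonotoneSubmodular f) {u : N → ℝ}
    (hu : ∀ e, 0 ≤ u e ∧ u e ≤ 1) (e : N) : 0 ≤ expGain f u e :=
  setExp_nonneg hu fun R => sub_nonneg.2 (hf.mono _ _ (Finset.subset_insert _ _))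

/-- Add an independent `R(u)` to the selected set. Monotonicity and submodularity bound the value by
`f R` plus the marginals of the selected elements with respect to `R`, and `R` is independent of
which elements are selected. -/
lemma ProbeTree.value_le {p u : N → ℝ} (hp : ∀ e, 0 ≤ p e ∧ p e ≤ 1)
    (hu : ∀ e, 0 ≤ u e ∧ u e ≤ 1) {f : Finset N → ℝ} (hf : IsMonotoneSubmodular f)
    (T : ProbeTree N) :
    T.value p f ≤ setExp u f + ∑ e, p e * T.probeProb p e * expGain f u e := by
  have h1 : T.value p f ≤ setExp p fun A => setExp u fun R =>
      f R + ∑ e, (if e ∈ T.selected A then 1 else 0) * (f (insert e R) - f R) := by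
    refine setExp_mono hp fun A => ?_
    rw [← setExp_const u (f _)]
    refine setExp_mono hu fun R => (hf.mono _ _ Finset.subset_union_right).trans
      ((hf.union_le R (T.selected A)).trans (le_of_eq ?_))
    congr 1
    simp [ite_mul, Finset.sum_ite_mem]
  refine h1.trans (le_of_eq ?_)
  simp only [setExp_add, setExp_sum, setExp_const_mul, setExp_mul_const, setExp_const]
  congr 1
  refine Finset.sum_congr rfl fun e _ => ?_
  rw [ProbeTree.selected_marginal]
  rfl

lemma ProbeTree.value_nonneg {p : N → ℝ} (hp : ∀ e, 0 ≤ p e ∧ p e ≤ 1) {f : Finset N → ℝ}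
    (hf : IsMonotoneSubmodular f) (T : ProbeTree N) : 0 ≤ T.value p f :=
  setExp_nonneg (h := fun A => f (T.selected A)) hp fun _ => hf.nonneg _

/-! ### One step of the continuous greedy method -/

lemma one_sub_sum_le_prod {κ : Type*} (S : Finset κ) (x : κ → ℝ) (hx : ∀ e, 0 ≤ x e ∧ x e ≤ 1) :
    1 - ∑ e ∈ S, x e ≤ ∏ e ∈ S, (1 - x e) := by
  induction S using Finset.induction_on with
  | empty => simp
  | insert a S ha ih =>
    rw [Finset.sum_insert ha, Finset.prod_insert ha]
    have h1 : ∏ e ∈ S, (1 - x e) ≤ 1 :=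
      Finset.prod_le_one (fun e _ => by linarith [(hx e).2]) fun e _ => by linarith [(hx e).1]
    nlinarith [hx a]

/-- By the union bound, some other element appears with probability at most `s` times the number of
elements. -/
lemma prodProb_singleton_ge {d : N → ℝ} (hd : ∀ e, 0 ≤ d e ∧ d e ≤ 1) {s : ℝ} (hs : 0 ≤ s)
    (hs1 : s ≤ 1) (e : N) :
    s * (1 - s * Fintype.card N) * d e ≤ prodProb (fun a => s * d a) {e} := by
  have hsd : ∀ a, 0 ≤ s * d a ∧ s * d a ≤ 1 := fun a =>
    ⟨mul_nonneg hs (hd a).1, mul_le_one₀ hs1 (hd a).1 (hd a).2⟩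
  rw [prodProb_eq_mul, Finset.prod_singleton]
  have h1 := one_sub_sum_le_prod ({e}ᶜ : Finset N) (fun a => s * d a) hsd
  have h2 : ∑ a ∈ ({e}ᶜ : Finset N), s * d a ≤ s * Fintype.card N := by
    calc _ ≤ ∑ a : N, s := (Finset.sum_le_sum fun a _ => by nlinarith [hd a]).trans
          (Finset.sum_le_sum_of_subset_of_nonneg (Finset.subset_univ _) fun _ _ _ => hs)
      _ = _ := by simp [mul_comm]
  have h3 : 0 ≤ s * d e := (hsd e).1
  nlinarith

/-- The marginals `u + s • d` dominate those of `R(u)` united with an independent `D = R(s • d)`. It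
suffices to count the gain when `D` is a singleton; this loses only the factor `1 - s * card N`, as
larger `D` gain a non-negative amount. -/
lemma setExp_step {f : Finset N → ℝ} (hf : IsMonotoneSubmodular f) {u d : N → ℝ} {s : ℝ}
    (hs : 0 ≤ s) (hs1 : s ≤ 1) (hd : ∀ e, 0 ≤ d e ∧ d e ≤ 1) (hu : ∀ e, 0 ≤ u e ∧ u e ≤ 1)
    (hus : ∀ e, u e + s * d e ≤ 1) :
    setExp u f + s * (1 - s * Fintype.card N) * ∑ e, d e * expGain f u e ≤
      setExp (fun e => u e + s * d e) f := by
  have hsd : ∀ a, 0 ≤ s * d a ∧ s * d a ≤ 1 := fun a =>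
    ⟨mul_nonneg hs (hd a).1, mul_le_one₀ hs1 (hd a).1 (hd a).2⟩
  have h1 : setExp (fun e => 1 - (1 - u e) * (1 - s * d e)) f ≤
      setExp (fun e => u e + s * d e) f := by
    refine setExp_mono_marginal (fun e => ?_) (fun e => ⟨add_nonneg (hu e).1 (hsd e).1, hus e⟩)
      (fun e => ?_) hf.mono
    · constructor
      · nlinarith [hu e, hsd e]
      · nlinarith [hu e, hsd e]
    · nlinarith [mul_nonneg (hu e).1 (hsd e).1]
  refine le_trans ?_ h1
  rw [← setExp_union u (fun e => s * d e)]
  have h2 : ∀ R, f R + ∑ e, s * (1 - s * Fintype.card N) * d e * (f (insert e R) - f R) ≤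
      setExp (fun e => s * d e) fun D => f (R ∪ D) := by
    intro R
    have hm : ∀ e, 0 ≤ f (insert e R) - f R := fun e =>
      sub_nonneg.2 (hf.mono _ _ (Finset.subset_insert _ _))
    have h3 : f R + ∑ e, prodProb (fun e => s * d e) {e} * (f (insert e R) - f R) ≤
        setExp (fun e => s * d e) fun D => f (R ∪ D) := by
      rw [← sub_nonneg, ← sub_sub, ← setExp_const (fun e => s * d e) (f R), ← setExp_sub,
        setExp_const, sub_nonneg]
      have hinj : Function.Injective fun e : N => ({e} : Finset N) := Finset.singleton_injective
      calc ∑ e, prodProb (fun e => s * d e) {e} * (f (insert e R) - f R)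
          = ∑ D ∈ Finset.univ.map ⟨fun e : N => ({e} : Finset N), hinj⟩,
            prodProb (fun e => s * d e) D * (f (R ∪ D) - f R) := by
            rw [Finset.sum_map]
            refine Finset.sum_congr rfl fun e _ => ?_
            simp only [Function.Embedding.coeFn_mk, Finset.union_comm R,
              ← Finset.insert_eq]
        _ ≤ _ := Finset.sum_le_sum_of_subset_of_nonneg (Finset.subset_univ _) fun D _ _ =>
            mul_nonneg (prodProb_nonneg hsd D)
              (sub_nonneg.2 (hf.mono _ _ Finset.subset_union_left))
    refine le_trans ?_ h3
    gcongr with e _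
    · exact hm e
    · exact prodProb_singleton_ge hd hs hs1 e
  have h4 := setExp_mono hu h2
  simp only [setExp_add, setExp_sum, setExp_const_mul] at h4
  refine le_trans (le_of_eq ?_) h4
  congr 1
  rw [Finset.mul_sum]
  refine Finset.sum_congr rfl fun e _ => ?_
  rw [expGain]
  ring

/-- The correlation gap of the multilinear extension along a ray. -/
lemma ProbeTree.value_mul_le_setExp {p : N → ℝ} (hp : ∀ e, 0 ≤ p e ∧ p e ≤ 1)
    {f : Finset N → ℝ} (hf : IsMonotoneSubmodular f) (T : ProbeTree N) {b : ℝ} (hb : 0 ≤ b)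
    (hb1 : b ≤ 1) (hT : ∀ e, 0 ≤ T.probeProb p e ∧ T.probeProb p e ≤ 1) :
    (1 - Real.exp (-b)) * T.value p f ≤ setExp (fun e => b * T.probeProb p e * p e) f := by
  set z : N → ℝ := fun e => p e * T.probeProb p e with hz
  have hz01 : ∀ e, 0 ≤ z e ∧ z e ≤ 1 := fun e =>
    ⟨mul_nonneg (hp e).1 (hT e).1, mul_le_one₀ (hp e).2 (hT e).1 (hT e).2⟩
  set V := T.value p f with hV
  have hV0 : 0 ≤ V := T.value_nonneg hp hf
  -- Walk from `0` to `b • z` in `m` equal steps; each multiplies the gap to `V` by at most `1 - q`.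
  -- The factor `1 - b / m * card N` in the exponent is the discretization loss, which vanishes as
  -- `m` grows.
  have main : ∀ m : ℕ, Fintype.card N + 1 ≤ m → V - setExp (fun e => b * z e) f ≤
      Real.exp (-b * (1 - b / m * Fintype.card N)) * V := by
    intro m hm
    have hm0 : (0 : ℝ) < m := by exact_mod_cast (by omega : 0 < m)
    set s := b / m with hs
    have hs0 : 0 ≤ s := div_nonneg hb hm0.le
    have hsm : s * m = b := by rw [hs]; field_simp
    have hm1 : (1 : ℝ) ≤ m := by exact_mod_cast (by omega : 1 ≤ m)
    have hs1 : s ≤ 1 := by nlinarith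
    have hcard : (Fintype.card N : ℝ) ≤ m := by exact_mod_cast (by omega : Fintype.card N ≤ m)
    have hsn : s * Fintype.card N ≤ 1 := by nlinarith
    set q := s * (1 - s * Fintype.card N) with hq
    have hq0 : 0 ≤ q := mul_nonneg hs0 (by linarith)
    have hq1 : 0 ≤ 1 - q := by
      have : 0 ≤ s * Fintype.card N := mul_nonneg hs0 (Nat.cast_nonneg _)
      nlinarith
    have hrec : ∀ t : ℕ, t ≤ m → V - setExp (fun e => t * s * z e) f ≤ (1 - q) ^ t * V := by
      intro t
      induction t with
      | zero =>
        intro _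
        have : 0 ≤ setExp (fun e => ((0 : ℕ) : ℝ) * s * z e) f :=
          setExp_nonneg (fun e => by simp) hf.nonneg
        simp only [pow_zero, one_mul]; linarith
      | succ t ih =>
        intro ht
        have ih := ih (by omega)
        have ht' : ((t : ℝ) + 1) * s ≤ 1 := by
          have : ((t : ℝ) + 1) ≤ m := by exact_mod_cast ht
          nlinarith
        have hts : (0 : ℝ) ≤ t * s := mul_nonneg (Nat.cast_nonneg _) hs0
        have hu : ∀ e, 0 ≤ t * s * z e ∧ t * s * z e ≤ 1 := fun e =>
          ⟨mul_nonneg hts (hz01 e).1, mul_le_one₀ (by linarith) (hz01 e).1 (hz01 e).2⟩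
        have h1 := setExp_step hf hs0 hs1 hz01 hu (fun e => by nlinarith [hz01 e])
        have h2 := T.value_le hp hu hf
        have h3 : (fun e => t * s * z e + s * z e) = fun e => ((t + 1 : ℕ) : ℝ) * s * z e := by
          funext e; push_cast; ring
        rw [h3] at h1
        rw [pow_succ]
        nlinarith [mul_le_mul_of_nonneg_left h2 hq0, mul_le_mul_of_nonneg_left ih hq1]
    have h1 := hrec m le_rfl
    have h2 : (fun e => (m : ℝ) * s * z e) = fun e => b * z e := by
      funext e; rw [← hsm]; ring
    rw [h2] at h1
    refine h1.trans (mul_le_mul_of_nonneg_right ?_ hV0)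
    calc (1 - q) ^ m ≤ Real.exp (-q) ^ m :=
          pow_le_pow_left₀ hq1 (by linarith [Real.add_one_le_exp (-q)]) m
      _ = Real.exp (-b * (1 - s * Fintype.card N)) := by
          rw [← Real.exp_nat_mul]; congr 1; rw [hq, ← hsm]; ring
  have lim : Tendsto (fun m : ℕ => Real.exp (-b * (1 - b / m * Fintype.card N)) * V) atTop
      (𝓝 (Real.exp (-b) * V)) := by
    have h1 : Tendsto (fun m : ℕ => b / (m : ℝ)) atTop (𝓝 0) :=
      tendsto_const_div_atTop_nhds_zero_nat b
    have h2 : Tendsto (fun m : ℕ => -b * (1 - b / m * Fintype.card N)) atTop (𝓝 (-b)) := by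
      simpa using ((h1.mul_const (Fintype.card N : ℝ)).const_sub 1).const_mul (-b)
    exact ((Real.continuous_exp.tendsto _).comp h2).mul_const V
  have := ge_of_tendsto lim (eventually_atTop.2 ⟨_, main⟩)
  have h5 : (fun e => b * T.probeProb p e * p e) = fun e => b * z e := by
    funext e; simp only [hz]; ring
  rw [h5]
  linarith

end

/-! ### Expectations with respect to probability mass functions -/

section
variable {α β : Type}

/-- Expectation of a function with values in `[0,∞]`. -/
def lexp (μ : PMF α) (φ : α → ENNReal) : ENNReal := ∑' a, μ a * φ a

lemma lexp_mono {μ : PMF α} {φ ψ : α → ENNReal} (h : ∀ a ∈ μ.support, φ a ≤ ψ a) :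
    lexp μ φ ≤ lexp μ ψ := by
  refine ENNReal.tsum_le_tsum fun a => ?_
  by_cases ha : a ∈ μ.support
  · gcongr
    exact h a ha
  · rw [(PMF.apply_eq_zero_iff μ a).2 ha, zero_mul, zero_mul]

lemma lexp_congr {μ : PMF α} {φ ψ : α → ENNReal} (h : ∀ a ∈ μ.support, φ a = ψ a) :
    lexp μ φ = lexp μ ψ :=
  le_antisymm (lexp_mono fun a ha => (h a ha).le) (lexp_mono fun a ha => (h a ha).ge)

lemma lexp_pure (a : α) (φ : α → ENNReal) : lexp (PMF.pure a) φ = φ a := by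
  rw [lexp, tsum_eq_single a]
  · simp
  · intro b hb; simp [PMF.pure_apply, hb]

lemma lexp_bind (μ : PMF α) (κ : α → PMF β) (φ : β → ENNReal) :
    lexp (μ.bind κ) φ = lexp μ fun a => lexp (κ a) φ := by
  simp only [lexp, PMF.bind_apply, ← ENNReal.tsum_mul_right, ← ENNReal.tsum_mul_left]
  rw [ENNReal.tsum_comm]
  exact tsum_congr fun a => tsum_congr fun b => mul_assoc _ _ _

lemma lexp_map (μ : PMF α) (g : α → β) (φ : β → ENNReal) :
    lexp (μ.map g) φ = lexp μ fun a => φ (g a) := by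
  rw [PMF.map, lexp_bind]
  simp only [Function.comp_apply, lexp_pure]

lemma lexp_const (μ : PMF α) (c : ENNReal) : lexp μ (fun _ => c) = c := by
  rw [lexp, ENNReal.tsum_mul_right, μ.tsum_coe, one_mul]

lemma lexp_add (μ : PMF α) (φ ψ : α → ENNReal) :
    lexp μ (fun a => φ a + ψ a) = lexp μ φ + lexp μ ψ := by
  simp only [lexp, mul_add, ENNReal.tsum_add]

lemma lexp_const_mul (μ : PMF α) (c : ENNReal) (φ : α → ENNReal) :
    lexp μ (fun a => c * φ a) = c * lexp μ φ := by
  simp only [lexp, ← ENNReal.tsum_mul_left]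
  exact tsum_congr fun a => by ring

lemma lexp_sum {κ : Type*} (μ : PMF α) (s : Finset κ) (φ : κ → α → ENNReal) :
    lexp μ (fun a => ∑ i ∈ s, φ i a) = ∑ i ∈ s, lexp μ (φ i) := by
  simp only [lexp, Finset.mul_sum]
  exact Summable.tsum_finsetSum fun _ _ => ENNReal.summable

lemma lexp_ofReal_fintype [Fintype α] (μ : PMF α) {h : α → ℝ} (hh : ∀ a, 0 ≤ h a) :
    lexp μ (fun a => ENNReal.ofReal (h a)) = ENNReal.ofReal (∑ a, (μ a).toReal * h a) := by
  rw [lexp, tsum_fintype, ENNReal.ofReal_sum_of_nonneg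
    fun a _ => mul_nonneg ENNReal.toReal_nonneg (hh a)]
  refine Finset.sum_congr rfl fun a _ => ?_
  rw [ENNReal.ofReal_mul ENNReal.toReal_nonneg, ENNReal.ofReal_toReal (μ.apply_ne_top a)]

lemma tsum_toReal_mul (μ : PMF α) {h : α → ℝ} (hh : ∀ a, 0 ≤ h a) :
    ∑' a, (μ a).toReal * h a = (lexp μ fun a => ENNReal.ofReal (h a)).toReal := by
  rw [lexp, ENNReal.tsum_toReal_eq
    fun a => ENNReal.mul_ne_top (μ.apply_ne_top a) ENNReal.ofReal_ne_top]
  refine tsum_congr fun a => ?_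
  rw [ENNReal.toReal_mul, ENNReal.toReal_ofReal (hh a)]

end

/-! ### Sampling product distributions, and the value of a probing algorithm. -/

section
variable {N : Type} [Fintype N]

/-- The coin bias that is used for the real number `r`. -/
def clamp (r : ℝ) : ℝ := max 0 (min 1 r)

lemma clamp_mem (r : ℝ) : 0 ≤ clamp r ∧ clamp r ≤ 1 :=
  ⟨le_max_left _ _, max_le zero_le_one (min_le_left _ _)⟩

lemma clamp_eq {r : ℝ} (h : 0 ≤ r ∧ r ≤ 1) : clamp r = r := by
  rw [clamp, min_eq_right h.2, max_eq_right h.1]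

/-- The law of the random set `R(x)`. -/
def prodPMF (x : N → ℝ) : PMF (Finset N) :=
  PMF.ofFintype (fun R => ENNReal.ofReal (prodProb (fun e => clamp (x e)) R)) (by
    rw [← ENNReal.ofReal_sum_of_nonneg fun R _ => prodProb_nonneg (fun e => clamp_mem _) R,
      sum_prodProb, ENNReal.ofReal_one])

lemma lexp_prodPMF {x : N → ℝ} (hx : ∀ e, 0 ≤ x e ∧ x e ≤ 1) {h : Finset N → ℝ}
    (hh : ∀ R, 0 ≤ h R) :
    lexp (prodPMF x) (fun R => ENNReal.ofReal (h R)) = ENNReal.ofReal (setExp x h) := by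
  rw [lexp_ofReal_fintype _ hh, setExp]
  congr 1
  refine Finset.sum_congr rfl fun R _ => ?_
  rw [prodPMF, PMF.ofFintype_apply, ENNReal.toReal_ofReal (prodProb_nonneg (fun e => clamp_mem _) R)]
  congr 2
  funext e
  exact clamp_eq (hx e)

lemma ProbingAlgorithm.ofReal_value {p : N → ℝ} (hp : ∀ e, 0 ≤ p e ∧ p e ≤ 1)
    {f : Finset N → ℝ} (hf : IsMonotoneSubmodular f) (alg : ProbingAlgorithm N)
    (adv : AlmightyAdversary alg) :
    ENNReal.ofReal (alg.value p f adv) = ∑ A, ENNReal.ofReal (prodProb p A) *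
      lexp alg.law fun s => ENNReal.ofReal (f (alg.finalHistory s A (adv s A)).selected) := by
  have hfin : ∀ A, (lexp alg.law fun s =>
      ENNReal.ofReal (f (alg.finalHistory s A (adv s A)).selected)) ≠ ⊤ := by
    intro A
    refine ne_top_of_le_ne_top (b := ENNReal.ofReal (f Finset.univ)) ENNReal.ofReal_ne_top ?_
    rw [← lexp_const alg.law (ENNReal.ofReal (f Finset.univ))]
    exact lexp_mono fun s _ => ENNReal.ofReal_le_ofReal (hf.mono _ _ (Finset.subset_univ _))
  rw [ProbingAlgorithm.value, ENNReal.ofReal_sum_of_nonneg]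
  · refine Finset.sum_congr rfl fun A _ => ?_
    rw [ENNReal.ofReal_mul (prodProb_nonneg hp A), tsum_toReal_mul _ fun s => hf.nonneg _,
      ENNReal.ofReal_toReal (hfin A)]
  · intro A _
    rw [tsum_toReal_mul _ fun s => hf.nonneg _]
    exact mul_nonneg (prodProb_nonneg hp A) ENNReal.toReal_nonneg

lemma ProbingAlgorithm.value_nonneg {p : N → ℝ} (hp : ∀ e, 0 ≤ p e ∧ p e ≤ 1)
    {f : Finset N → ℝ} (hf : IsMonotoneSubmodular f) (alg : ProbingAlgorithm N)
    (adv : AlmightyAdversary alg) : 0 ≤ alg.value p f adv :=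
  Finset.sum_nonneg fun A _ => mul_nonneg (prodProb_nonneg hp A)
    (tsum_nonneg fun _ => mul_nonneg ENNReal.toReal_nonneg (hf.nonneg _))

/-- An algorithm that selects at least the survivors, for a random vector `y` and independent
`R(y)` and families, retains the fraction `cin * cout` of the expected value of `R(y ∘ p)`. -/
theorem ProbingAlgorithm.value_ge {p : N → ℝ} (hp : ∀ e, 0 ≤ p e ∧ p e ≤ 1)
    {f : Finset N → ℝ} (hf : IsMonotoneSubmodular f) (alg : ProbingAlgorithm N)
    (adv : AlmightyAdversary alg) (law : PMF (N → ℝ))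
    (μin μout : (N → ℝ) → PMF (Finset (Finset N)))
    (hy : ∀ y ∈ law.support, ∀ e, 0 ≤ y e ∧ y e ≤ 1) {cin cout : ℝ}
    (hcin : 0 ≤ cin) (hcin1 : cin ≤ 1) (hcout : 0 ≤ cout) (hcout1 : cout ≤ 1)
    (hin : ∀ y ∈ law.support, ∀ e,
      cin ≤ setExp (fun e => y e * p e) (selectFrac (μin y) e))
    (hout : ∀ y ∈ law.support, ∀ e, cout ≤ setExp y (selectFrac (μout y) e))
    (hsel : ∀ A, (lexp law fun y => lexp (prodPMF y) fun R => lexp (μin y) fun Gin =>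
        lexp (μout y) fun Gout => ENNReal.ofReal (f (survivors Gin Gout R A))) ≤
      lexp alg.law fun s => ENNReal.ofReal (f (alg.finalHistory s A (adv s A)).selected)) :
    ENNReal.ofReal (cin * cout) * lexp law (fun y => ENNReal.ofReal (setExp (fun e => y e * p e) f)) ≤
      ENNReal.ofReal (alg.value p f adv) := by
  rw [alg.ofReal_value hp hf]
  -- This removes the adversary: from here on only the survivors occur, which do not depend on the
  -- order.
  refine le_trans ?_ (Finset.sum_le_sum fun A _ => mul_le_mul' le_rfl (hsel A))
  simp_rw [← lexp_const_mul (μ := law)]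
  rw [← lexp_sum]
  refine lexp_mono fun y hys => ?_
  have hy := hy y hys
  rw [← ENNReal.ofReal_mul (mul_nonneg hcin hcout)]
  refine (ENNReal.ofReal_le_ofReal (setExp_survivors_ge hy hp hcin hcin1 hcout hcout1 (hin y hys)
    (hout y hys) hf)).trans (le_of_eq ?_)
  have hnn : ∀ R A, 0 ≤ ∑ Gin, ∑ Gout,
      (μin y Gin).toReal * (μout y Gout).toReal * f (survivors Gin Gout R A) := fun R A =>
    Finset.sum_nonneg fun _ _ => Finset.sum_nonneg fun _ _ =>
      mul_nonneg (mul_nonneg ENNReal.toReal_nonneg ENNReal.toReal_nonneg) (hf.nonneg _)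
  rw [setExp_comm, setExp, ENNReal.ofReal_sum_of_nonneg fun A _ =>
    mul_nonneg (prodProb_nonneg hp A) (setExp_nonneg hy fun R => hnn R A)]
  refine Finset.sum_congr rfl fun A _ => ?_
  rw [ENNReal.ofReal_mul (prodProb_nonneg hp A), ← lexp_prodPMF hy fun R => hnn R A]
  congr 1
  refine lexp_congr fun R _ => ?_
  rw [lexp_congr (fun Gin _ => lexp_ofReal_fintype _ fun Gout => hf.nonneg _),
    lexp_ofReal_fintype _ fun Gin => Finset.sum_nonneg fun Gout _ =>
      mul_nonneg ENNReal.toReal_nonneg (hf.nonneg _)]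
  simp only [Finset.mul_sum, mul_assoc]

/-! ### Existence of the approximation -/

lemma continuous_setExp (h : Finset N → ℝ) : Continuous fun x : N → ℝ => setExp x h := by
  unfold setExp prodProb
  refine continuous_finsetSum _ fun R _ => Continuous.mul ?_ continuous_const
  refine continuous_finsetProd _ fun e _ => ?_
  split_ifs <;> fun_prop

/-- Probe greedily the elements of a random set with marginals `y`. -/
def roundingAlgorithm (y : N → ℝ) (μin μout : PMF (Finset (Finset N))) : ProbingAlgorithm N where
  Seed := Finset N × Finset (Finset N) × Finset (Finset N)
  law := (prodPMF y).bind fun R => μin.bind fun Gin => μout.map fun Gout => (R, Gin, Gout)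
  probe s h e := decide (e ∈ s.1 ∧ insert e (History.probed h) ∈ s.2.2 ∧
    insert e (History.selected h) ∈ s.2.1)

lemma roundingAlgorithm_greedyAt (y : N → ℝ) (μin μout : PMF (Finset (Finset N)))
    (s : Finset N × Finset (Finset N) × Finset (Finset N)) :
    (roundingAlgorithm y μin μout).GreedyAt s s.1 s.2.1 s.2.2 :=
  fun _ _ => decide_eq_true_iff

lemma mem_support_roundingAlgorithm {y : N → ℝ} {μin μout : PMF (Finset (Finset N))}
    {s : Finset N × Finset (Finset N) × Finset (Finset N)}
    (hs : s ∈ (roundingAlgorithm y μin μout).law.support) :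
    s.2.1 ∈ μin.support ∧ s.2.2 ∈ μout.support := by
  change s ∈ PMF.support (PMF.bind _ _) at hs
  simp only [PMF.mem_support_bind_iff, PMF.mem_support_map_iff] at hs
  obtain ⟨R, -, Gin, hGin, Gout, hGout, rfl⟩ := hs
  exact ⟨hGin, hGout⟩

lemma lexp_roundingAlgorithm (y : N → ℝ) (μin μout : PMF (Finset (Finset N)))
    (φ : Finset N × Finset (Finset N) × Finset (Finset N) → ENNReal) :
    lexp (roundingAlgorithm y μin μout).law φ = lexp (prodPMF y) fun R => lexp μin fun Gin =>
      lexp μout fun Gout => φ (R, Gin, Gout) := by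
  change lexp (PMF.bind _ _) φ = _
  simp only [lexp_bind, lexp_map]

lemma IsRelaxation.isCompact {F : Set (Finset N)} {P : Set (N → ℝ)} (h : IsRelaxation F P) :
    IsCompact P := by
  obtain ⟨V, rfl⟩ := h.polytope
  exact V.finite_toSet.isCompact_convexHull ℝ

theorem exists_isApproximation {b cin cout : ℝ} (hb : 0 ≤ b) (hb1 : b ≤ 1) (hcin : 0 ≤ cin)
    (hcin1 : cin ≤ 1) (hcout : 0 ≤ cout) (hcout1 : cout ≤ 1) {Finn Fout : Set (Finset N)}
    {Pin Pout : Set (N → ℝ)} (πin : GreedyOCRS Finn Pin) (πout : GreedyOCRS Fout Pout)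
    (hFin : IsDownClosedFamily Finn) (hFout : IsDownClosedFamily Fout)
    (hPin : IsRelaxation Finn Pin) (hPout : IsRelaxation Fout Pout)
    (hin : πin.IsSelectable b cin) (hout : πout.IsSelectable b cout) {p : N → ℝ}
    {f : Finset N → ℝ} (hp : ∀ e, 0 ≤ p e ∧ p e ≤ 1) (hf : IsMonotoneSubmodular f) :
    ∃ alg : ProbingAlgorithm N,
      IsApproximation Finn Fout p f ((1 - Real.exp (-b)) * cin * cout) alg := by
  set K : Set (N → ℝ) := b • Pout ∩ (fun y e => y e * p e) ⁻¹' (b • Pin) with hK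
  have hcont : Continuous fun (y : N → ℝ) e => y e * p e := by fun_prop
  have hKc : IsCompact K := (hPout.isCompact.smul b).inter_right
    ((hPin.isCompact.smul b).isClosed.preimage hcont)
  have hK0 : (0 : N → ℝ) ∈ K :=
    ⟨⟨0, hPout.zero_mem hFout, smul_zero b⟩, ⟨0, hPin.zero_mem hFin, by funext e; simp⟩⟩
  -- Existence alone needs no algorithm: a continuous function attains its maximum on the compact
  -- set `K`. Hence part (a) holds without the error term.
  obtain ⟨y, hyK, hymax⟩ := hKc.exists_isMaxOn ⟨0, hK0⟩
    (((continuous_setExp f).comp hcont).continuousOn)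
  have hyPout : y ∈ Pout := hPout.smul_subset hFout hb hb1 hyK.1
  have hyPin : (fun e => y e * p e) ∈ Pin := hPin.smul_subset hFin hb hb1 hyK.2
  have hy01 := hPout.subset_cube y hyPout
  have hfinal : ∀ s ∈ (roundingAlgorithm y (πin.fam fun e => y e * p e) (πout.fam y)).law.support,
      ∀ A l, _ := fun s hs A l => (roundingAlgorithm_greedyAt y _ _ s).finalHistory
    (πin.empty_mem _ hyPin _ (mem_support_roundingAlgorithm hs).1)
    (πout.empty_mem _ hyPout _ (mem_support_roundingAlgorithm hs).2) A l
  refine ⟨roundingAlgorithm y (πin.fam fun e => y e * p e) (πout.fam y), fun s hs A l => ?_, fun adv T hT => ?_⟩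
  · obtain ⟨h1, h2, -⟩ := hfinal s hs A l
    exact ⟨πout.subset_feasible _ hyPout _ (mem_support_roundingAlgorithm hs).2 _ h1,
      πin.subset_feasible _ hyPin _ (mem_support_roundingAlgorithm hs).1 _ h2⟩
  · have hv := ProbingAlgorithm.value_ge hp hf _ adv (PMF.pure y) (fun y => πin.fam fun e => y e * p e) πout.fam
      (by simpa using hy01) hcin hcin1 hcout hcout1
      (by
        intro y' hy' e
        rw [PMF.mem_support_pure_iff] at hy'
        subst hy'
        exact (hin _ hyK.2 e).trans_eq (πin.selectProb_eq _ e))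
      (by
        intro y' hy' e
        rw [PMF.mem_support_pure_iff] at hy'
        subst hy'
        exact (hout _ hyK.1 e).trans_eq (πout.selectProb_eq _ e))
      (by
        intro A
        rw [lexp_pure]
        rw [← lexp_roundingAlgorithm y _ _ fun s => ENNReal.ofReal (f (survivors s.2.1 s.2.2 s.1 A))]
        exact lexp_mono fun s hs =>
          ENNReal.ofReal_le_ofReal (hf.mono _ _ (hfinal s hs A _).2.2))
    rw [lexp_pure, ← ENNReal.ofReal_mul (mul_nonneg hcin hcout),
      ENNReal.ofReal_le_ofReal_iff (ProbingAlgorithm.value_nonneg hp hf _ adv)] at hv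
    obtain ⟨h1, h2⟩ := hT.probeProb_mem hp
    have h1' := hPout.feasiblePolytope_subset h1
    -- The scaled probing probabilities of any legal strategy compete in the maximization, so the
    -- correlation gap bound carries over to `y`.
    have hbT : (fun e => b * T.probeProb p e) ∈ K :=
      ⟨⟨_, h1', rfl⟩, ⟨_, hPin.feasiblePolytope_subset h2, by
        funext e; simp only [Pi.smul_apply, smul_eq_mul]; ring⟩⟩
    have h3 := T.value_mul_le_setExp hp hf hb hb1 (hPout.subset_cube _ h1')
    have h4 : setExp (fun e => b * T.probeProb p e * p e) f ≤ setExp (fun e => y e * p e) f :=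
      hymax hbT
    calc (1 - Real.exp (-b)) * cin * cout * T.value p f
        = cin * cout * ((1 - Real.exp (-b)) * T.value p f) := by ring
      _ ≤ cin * cout * setExp (fun e => y e * p e) f :=
          mul_le_mul_of_nonneg_left (h3.trans h4) (mul_nonneg hcin hcout)
      _ ≤ _ := hv

end

/-! ### Semantics of programs -/

section
variable {κ κ' : Type}

/-- Rename the oracles of a program. -/
def Cmd.mapOracle (g : κ → κ') : Cmd κ → Cmd κ'
  | .skip => .skip
  | .setIdx v i => .setIdx v i
  | .setReal a i r => .setReal a i r
  | .coin a i r => .coin a i r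
  | .seq c d => .seq (c.mapOracle g) (d.mapOracle g)
  | .ifLt r s c d => .ifLt r s (c.mapOracle g) (d.mapOracle g)
  | .loop i c => .loop i (c.mapOracle g)
  | .query k src dst => .query (g k) src dst
  | .call c args dst => .call (c.mapOracle g) args dst

/-- Lets the programs of the schemes, which know a single oracle, run as subroutines of programs
with four oracles. -/
lemma Cmd.exec_mapOracle {M : Type → Type} [Monad M] (flip : ℝ → M Bool)
    (O : κ' → List ℝ → List ℝ) (g : κ → κ') (c : Cmd κ) (s : Store) :
    (c.mapOracle g).exec flip O s = c.exec flip (fun k => O (g k)) s := by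
  induction c generalizing s with
  | skip => rfl
  | setIdx => rfl
  | setReal => rfl
  | coin => rfl
  | seq c d hc hd => simp only [Cmd.mapOracle, Cmd.exec, hc, hd]
  | ifLt r t c d hc hd => simp only [Cmd.mapOracle, Cmd.exec, hc, hd]
  | loop i c hc => simp only [Cmd.mapOracle, Cmd.exec, hc]
  | query => rfl
  | call c args dst hc => simp only [Cmd.mapOracle, Cmd.exec, hc]

/-- The program tosses no coins. -/
def Cmd.NoCoin : Cmd κ → Prop
  | .coin _ _ _ => False
  | .seq c d => c.NoCoin ∧ d.NoCoin
  | .ifLt _ _ c d => c.NoCoin ∧ d.NoCoin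
  | .loop _ c => c.NoCoin
  | .call c _ _ => c.NoCoin
  | _ => True

/-- Deterministic execution. -/
def Cmd.det (O : κ → List ℝ → List ℝ) (c : Cmd κ) (s : Store) : Store × ℕ :=
  c.exec (M := Id) (fun _ => false) O s

lemma iterate_pure {M : Type → Type} [Monad M] [LawfulMonad M] (g : Store → Store × ℕ) (k : ℕ)
    (s : Store) : iterate (M := M) (fun s => pure (g s)) k s = pure (iterate (M := Id) g k s) := by
  induction k generalizing s with
  | zero => rfl
  | succ k ih =>
    simp only [iterate, LawfulMonad.pure_bind, ih]
    rfl

/-- Without coins the monad plays no role, so a deterministic analysis can be reused inside the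
randomized preparation. -/
lemma Cmd.exec_eq_pure {M : Type → Type} [Monad M] [LawfulMonad M] (flip : ℝ → M Bool)
    (O : κ → List ℝ → List ℝ) {c : Cmd κ} (hc : c.NoCoin) (s : Store) :
    c.exec flip O s = pure (c.det O s) := by
  induction c generalizing s with
  | skip => rfl
  | setIdx => rfl
  | setReal => rfl
  | coin => exact absurd hc id
  | seq c d ihc ihd =>
    simp only [Cmd.exec, ihc hc.1, ihd hc.2, LawfulMonad.pure_bind]
    rfl
  | ifLt r t c d ihc ihd =>
    simp only [Cmd.exec, ihc hc.1, ihd hc.2, Cmd.det]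
    split_ifs <;> simp only [LawfulMonad.pure_bind] <;> rfl
  | loop i c ihc =>
    simp only [Cmd.exec, ihc hc, iterate_pure, LawfulMonad.pure_bind]
    rfl
  | query => rfl
  | call c args dst ihc =>
    simp only [Cmd.exec, ihc hc, LawfulMonad.pure_bind]
    rfl

/-! ### Deterministic executions -/

/-- From the memory `s` the program reaches a memory with the property `Q` in at most `t` steps. -/
def Runs (O : κ → List ℝ → List ℝ) (c : Cmd κ) (s : Store) (Q : Store → Prop) (t : ℕ) : Prop :=
  Q (c.det O s).1 ∧ (c.det O s).2 ≤ t

/-- On the inputs `L` the program outputs `out` in at most `t` steps. -/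
def Computes (O : κ → List ℝ → List ℝ) (c : Cmd κ) (L : List (List ℝ)) (out : List ℝ) (t : ℕ) :
    Prop :=
  Runs O c (Store.ofLists L) (fun s => s.block 0 = out) t

variable {O : κ → List ℝ → List ℝ} {c d : Cmd κ} {s : Store} {Q Q' : Store → Prop} {t t' : ℕ}

lemma Runs.mono (h : Runs O c s Q t) (hQ : ∀ s', Q s' → Q' s') (ht : t ≤ t') :
    Runs O c s Q' t' :=
  ⟨hQ _ h.1, h.2.trans ht⟩

lemma Runs.seq {Q₁ : Store → Prop} {t₁ t₂ : ℕ} (h : Runs O c s Q₁ t₁)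
    (h' : ∀ s', Q₁ s' → Runs O d s' Q t₂) : Runs O (.seq c d) s Q (t₁ + t₂) :=
  ⟨(h' _ h.1).1, add_le_add h.2 (h' _ h.1).2⟩

lemma Runs.skip (hQ : Q s) : Runs O .skip s Q 1 := ⟨hQ, le_rfl⟩

lemma Runs.setIdx {v : ℕ} {i : IExp}
    (hQ : Q ⟨Function.update s.idx v (i.eval s), s.arr⟩) : Runs O (.setIdx v i) s Q (i.size + 1) :=
  ⟨hQ, le_rfl⟩

lemma Runs.setReal {a : ℕ} {i : IExp} {r : RExp} (hQ : Q (s.setEntry a (i.eval s) (r.eval s))) :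
    Runs O (.setReal a i r) s Q (i.size + r.size + 1) :=
  ⟨hQ, le_rfl⟩

lemma Runs.query {k : κ} {src dst : ℕ} (hQ : Q (s.setBlock dst (O k (s.block src)))) :
    Runs O (.query k src dst) s Q ((s.block src).length + (O k (s.block src)).length + 1) :=
  ⟨hQ, le_rfl⟩

lemma Runs.ifLt {r q : RExp} (h1 : r.eval s < q.eval s → Runs O c s Q t)
    (h2 : ¬ r.eval s < q.eval s → Runs O d s Q t) :
    Runs O (.ifLt r q c d) s Q (r.size + q.size + t + 1) := by
  by_cases h : r.eval s < q.eval s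
  · have e : (Cmd.ifLt r q c d).det O s =
        ((c.det O s).1, r.size + q.size + (c.det O s).2 + 1) := by
      change ((ite _ _ _ : Store × ℕ).1, _ + (ite _ _ _ : Store × ℕ).2 + 1) = _
      rw [if_pos h]; rfl
    refine ⟨by rw [e]; exact (h1 h).1, ?_⟩
    rw [e]
    have := (h1 h).2
    dsimp only
    omega
  · have e : (Cmd.ifLt r q c d).det O s =
        ((d.det O s).1, r.size + q.size + (d.det O s).2 + 1) := by
      change ((ite _ _ _ : Store × ℕ).1, _ + (ite _ _ _ : Store × ℕ).2 + 1) = _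
      rw [if_neg h]; rfl
    refine ⟨by rw [e]; exact (h2 h).1, ?_⟩
    rw [e]
    have := (h2 h).2
    dsimp only
    omega

/-- Here `j` counts the rounds still to be made; the invariant is indexed by the rounds already
made. -/
lemma runs_iterate (I : ℕ → Store → Prop) (m : ℕ)
    (hstep : ∀ k < m, ∀ s', I k s' → Runs O c s' (I (k + 1)) t) (j : ℕ) (hj : j ≤ m) (s : Store)
    (h : I (m - j) s) :
    I m (iterate (M := Id) (c.det O) j s).1 ∧
      (iterate (M := Id) (c.det O) j s).2 ≤ j * (t + 1) := by
  induction j generalizing s with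
  | zero => exact ⟨h, Nat.zero_le _⟩
  | succ j ih =>
    have h1 := hstep (m - (j + 1)) (by omega) s h
    rw [show m - (j + 1) + 1 = m - j by omega] at h1
    obtain ⟨h2, h3⟩ := ih (by omega) _ h1.1
    refine ⟨h2, ?_⟩
    change (c.det O s).2 + (iterate (M := Id) (c.det O) j (c.det O s).1).2 + 1 ≤ _
    have := h1.2
    rw [Nat.succ_mul]
    omega

lemma Runs.loop {i : IExp} (I : ℕ → Store → Prop) (h0 : I 0 s)
    (hstep : ∀ k < i.eval s, ∀ s', I k s' → Runs O c s' (I (k + 1)) t) :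
    Runs O (.loop i c) s (I (i.eval s)) (i.size + i.eval s * (t + 1) + 1) := by
  obtain ⟨h1, h2⟩ := runs_iterate I (i.eval s) hstep (i.eval s) le_rfl s (by simpa using h0)
  refine ⟨h1, ?_⟩
  change i.size + (iterate (M := Id) (c.det O) (i.eval s) s).2 + 1 ≤ _
  omega

lemma Runs.loop' {i : IExp} {m : ℕ} (hm : i.eval s = m) (I : ℕ → Store → Prop) (h0 : I 0 s)
    (hstep : ∀ k < m, ∀ s', I k s' → Runs O c s' (I (k + 1)) t) :
    Runs O (.loop i c) s (I m) (i.size + m * (t + 1) + 1) := by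
  subst hm
  exact Runs.loop I h0 hstep

lemma Runs.setReal_seq {a : ℕ} {i : IExp} {r : RExp}
    (h : Runs O d (s.setEntry a (i.eval s) (r.eval s)) Q t) :
    Runs O (.seq (.setReal a i r) d) s Q (i.size + r.size + 1 + t) :=
  (Runs.setReal (Q := (· = _)) rfl).seq fun s' hs' => by subst hs'; exact h

lemma Runs.setIdx_seq {v : ℕ} {i : IExp}
    (h : Runs O d ⟨Function.update s.idx v (i.eval s), s.arr⟩ Q t) :
    Runs O (.seq (.setIdx v i) d) s Q (i.size + 1 + t) :=
  (Runs.setIdx (Q := (· = _)) rfl).seq fun s' hs' => by subst hs'; exact h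

lemma Runs.query_seq {k : κ} {src dst : ℕ}
    (h : Runs O d (s.setBlock dst (O k (s.block src))) Q t) :
    Runs O (.seq (.query k src dst) d) s Q
      ((s.block src).length + (O k (s.block src)).length + 1 + t) :=
  (Runs.query (Q := (· = _)) rfl).seq fun s' hs' => by subst hs'; exact h

lemma Runs.call {args : List ℕ} {dst : ℕ} {out : List ℝ}
    (h : Computes O c (args.map s.block) out t) (hQ : Q (s.setBlock dst out)) :
    Runs O (.call c args dst) s Q
      (((args.map s.block).map List.length).sum + args.length + t + out.length + 1) := by
  obtain ⟨h1, h2⟩ := h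
  constructor
  · change Q (s.setBlock dst ((c.det O (Store.ofLists (args.map s.block))).1.block 0))
    rwa [h1]
  · change _ + _ + (c.det O (Store.ofLists (args.map s.block))).2 +
      ((c.det O (Store.ofLists (args.map s.block))).1.block 0).length + 1 ≤ _
    rw [h1]
    omega

lemma Runs.call_seq {args : List ℕ} {dst : ℕ} {out : List ℝ}
    (h : Computes O c (args.map s.block) out t') (h' : Runs O d (s.setBlock dst out) Q t) :
    Runs O (.seq (.call c args dst) d) s Q
      (((args.map s.block).map List.length).sum + args.length + t' + out.length + 1 + t) :=
  (Runs.call (Q := (· = _)) h rfl).seq fun s' hs' => by subst hs'; exact h'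

/-- Nested loops. -/
def Cmd.loopPow (i : IExp) (c : Cmd κ) : ℕ → Cmd κ
  | 0 => c
  | k + 1 => .loop i (c.loopPow i k)

/-- Running time of nested loops. -/
def loopPowTime (z m t : ℕ) : ℕ → ℕ
  | 0 => t
  | k + 1 => z + m * (loopPowTime z m t k + 1) + 1

/-- Index expressions cannot multiply, so `m ^ k` rounds are obtained by nesting `k` loops of `m`
rounds. The invariant counts the executions of the innermost body. -/
lemma Runs.loopPow {i : IExp} {m : ℕ} (I : ℕ → Store → Prop) (hi : ∀ j s, I j s → i.eval s = m)
    (hstep : ∀ j s, I j s → Runs O c s (I (j + 1)) t) (k : ℕ) (j : ℕ) (s : Store) (h : I j s) :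
    Runs O (c.loopPow i k) s (I (j + m ^ k)) (loopPowTime i.size m t k) := by
  induction k generalizing j s with
  | zero => simpa [Cmd.loopPow, loopPowTime] using hstep j s h
  | succ k ih =>
    have := Runs.loop (O := O) (c := c.loopPow i k) (i := i) (s := s)
      (t := loopPowTime i.size m t k)
      (fun l s => I (j + l * m ^ k) s) (by simpa using h) (fun l _ s' hs' => by
        have := ih _ _ hs'
        rwa [add_assoc, ← Nat.succ_mul] at this)
    rw [hi j s h] at this
    rw [pow_succ, mul_comm]
    exact this

/-! ### Randomized executions -/

/-- From the memory `s` the program reaches a memory with law `μ`, in at most `t` steps. -/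
structure RunsP (O : κ → List ℝ → List ℝ) (c : Cmd κ) (s : Store) (μ : PMF Store) (t : ℕ) :
    Prop where
  law : (c.exec (M := PMF) biasedCoin O s).map Prod.fst = μ
  time : ∀ r ∈ (c.exec (M := PMF) biasedCoin O s).support, r.2 ≤ t

/-- On the inputs `L` the program outputs a list with law `μ`, in at most `t` steps. -/
structure ComputesP (O : κ → List ℝ → List ℝ) (c : Cmd κ) (L : List (List ℝ)) (μ : PMF (List ℝ))
    (t : ℕ) : Prop where
  law : (c.exec (M := PMF) biasedCoin O (Store.ofLists L)).map (fun r => r.1.block 0) = μ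
  time : ∀ r ∈ (c.exec (M := PMF) biasedCoin O (Store.ofLists L)).support, r.2 ≤ t

lemma RunsP.congr {μ ν : PMF Store} (h : RunsP O c s μ t) (hμ : μ = ν) (ht : t ≤ t') :
    RunsP O c s ν t' :=
  ⟨h.law.trans hμ, fun r hr => (h.time r hr).trans ht⟩

lemma RunsP.computesP {L : List (List ℝ)} {μ : PMF Store}
    (h : RunsP O c (Store.ofLists L) μ t) : ComputesP O c L (μ.map fun s => s.block 0) t :=
  ⟨by rw [← h.law, PMF.map_comp]; rfl, h.time⟩

lemma RunsP.of_runs (hc : c.NoCoin) {s' : Store} (h : Runs O c s (· = s') t) :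
    RunsP O c s (PMF.pure s') t := by
  have e := Cmd.exec_eq_pure (M := PMF) biasedCoin O hc s
  constructor
  · rw [e]
    change PMF.map _ (PMF.pure _) = _
    rw [PMF.pure_map, h.1]
  · intro r hr
    rw [e] at hr
    change r ∈ (PMF.pure _).support at hr
    rw [PMF.mem_support_pure_iff] at hr
    rw [hr]
    exact h.2

lemma ComputesP.of_computes (hc : c.NoCoin) {L : List (List ℝ)} {out : List ℝ}
    (h : Computes O c L out t) : ComputesP O c L (PMF.pure out) t := by
  have := (RunsP.of_runs hc (O := O) (s := Store.ofLists L) (t := t) ⟨rfl, h.2⟩).computesP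
  rwa [PMF.pure_map, h.1] at this

lemma PMF.bind_congr_support {α β : Type} {μ : PMF α} {f g : α → PMF β}
    (h : ∀ a ∈ μ.support, f a = g a) : μ.bind f = μ.bind g := by
  ext b
  simp only [PMF.bind_apply]
  refine tsum_congr fun a => ?_
  by_cases ha : a ∈ μ.support
  · rw [h a ha]
  · rw [(PMF.apply_eq_zero_iff μ a).2 ha, zero_mul, zero_mul]

lemma RunsP.seq {μ : PMF Store} {ν : Store → PMF Store} {t₁ t₂ : ℕ} (h : RunsP O c s μ t₁)
    (h' : ∀ s' ∈ μ.support, RunsP O d s' (ν s') t₂) :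
    RunsP O (.seq c d) s (μ.bind ν) (t₁ + t₂) := by
  have e : (Cmd.seq c d).exec (M := PMF) biasedCoin O s =
      (c.exec (M := PMF) biasedCoin O s).bind fun r =>
        (d.exec (M := PMF) biasedCoin O r.1).map fun r' => (r'.1, r.2 + r'.2) := rfl
  have hs : ∀ r ∈ (c.exec (M := PMF) biasedCoin O s).support, r.1 ∈ μ.support := by
    intro r hr
    rw [← h.law, PMF.mem_support_map_iff]
    exact ⟨r, hr, rfl⟩
  constructor
  · rw [e, PMF.map_bind, ← h.law, PMF.bind_map]
    refine PMF.bind_congr_support fun r hr => ?_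
    rw [PMF.map_comp]
    exact (h' r.1 (hs r hr)).law
  · intro r hr
    rw [e, PMF.mem_support_bind_iff] at hr
    obtain ⟨r₁, hr₁, hr⟩ := hr
    rw [PMF.mem_support_map_iff] at hr
    obtain ⟨r₂, hr₂, rfl⟩ := hr
    exact add_le_add (h.time _ hr₁) ((h' r₁.1 (hs r₁ hr₁)).time _ hr₂)

lemma RunsP.call {args : List ℕ} {dst m : ℕ} {μ : PMF (List ℝ)}
    (h : ComputesP O c (args.map s.block) μ t) (hm : ∀ l ∈ μ.support, l.length ≤ m) :
    RunsP O (.call c args dst) s (μ.map (s.setBlock dst))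
      (((args.map s.block).map List.length).sum + args.length + t + m + 1) := by
  have e : (Cmd.call c args dst).exec (M := PMF) biasedCoin O s =
      (c.exec (M := PMF) biasedCoin O (Store.ofLists (args.map s.block))).map fun q =>
        (s.setBlock dst (q.1.block 0), ((args.map s.block).map List.length).sum + args.length +
          q.2 + (q.1.block 0).length + 1) := rfl
  constructor
  · rw [e, PMF.map_comp, ← h.law, PMF.map_comp]
    rfl
  · intro r hr
    rw [e, PMF.mem_support_map_iff] at hr
    obtain ⟨q, hq, rfl⟩ := hr
    have h1 := h.time q hq
    have h2 := hm (q.1.block 0) (by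
      rw [← h.law, PMF.mem_support_map_iff]
      exact ⟨q, hq, rfl⟩)
    dsimp only
    omega

/-- The law of the state of a Markov chain after a number of steps. -/
def iterLaw {α : Type} (K : α → PMF α) : ℕ → α → PMF α
  | 0, a => PMF.pure a
  | k + 1, a => (K a).bind (iterLaw K k)

lemma iterLaw_add {α : Type} (K : α → PMF α) (j k : ℕ) (a : α) :
    iterLaw K (j + k) a = (iterLaw K j a).bind (iterLaw K k) := by
  induction j generalizing a with
  | zero => simp [iterLaw]
  | succ j ih =>
    rw [Nat.succ_add, iterLaw, iterLaw, PMF.bind_bind]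
    congr 1
    funext a
    exact ih a

lemma iterLaw_mul {α : Type} (K : α → PMF α) (j k : ℕ) (a : α) :
    iterLaw (iterLaw K j) k a = iterLaw K (k * j) a := by
  induction k generalizing a with
  | zero => simp [iterLaw]
  | succ k ih =>
    rw [iterLaw, Nat.succ_mul, Nat.add_comm, iterLaw_add]
    congr 1
    funext a
    exact ih a

/-- The body only has to be understood as a Markov kernel on an abstract state `α`; `enc` fixes the
rest of the memory, so memories outside its range never occur. -/
lemma RunsP.loop {α : Type} {i : IExp} {enc : α → Store} {K : α → PMF α}
    (hstep : ∀ a, RunsP O c (enc a) ((K a).map enc) t) (a : α) :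
    RunsP O (.loop i c) (enc a) ((iterLaw K (i.eval (enc a)) a).map enc)
      (i.size + i.eval (enc a) * (t + 1) + 1) := by
  have key : ∀ (m : ℕ) (a : α),
      (iterate (M := PMF) (c.exec biasedCoin O) m (enc a)).map Prod.fst =
        (iterLaw K m a).map enc ∧
      ∀ r ∈ (iterate (M := PMF) (c.exec biasedCoin O) m (enc a)).support, r.2 ≤ m * (t + 1) := by
    intro m
    induction m with
    | zero =>
      intro a
      constructor
      · change PMF.map _ (PMF.pure _) = PMF.map _ (PMF.pure _)
        rw [PMF.pure_map, PMF.pure_map]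
      · intro r hr
        change r ∈ (PMF.pure _).support at hr
        rw [PMF.mem_support_pure_iff] at hr
        simp [hr]
    | succ m ih =>
      intro a
      have e : iterate (M := PMF) (c.exec biasedCoin O) (m + 1) (enc a) =
          (c.exec (M := PMF) biasedCoin O (enc a)).bind fun r =>
            (iterate (M := PMF) (c.exec biasedCoin O) m r.1).map
              fun r' => (r'.1, r.2 + r'.2 + 1) := rfl
      have hs : ∀ r ∈ (c.exec (M := PMF) biasedCoin O (enc a)).support, ∃ a', r.1 = enc a' := by
        intro r hr
        have : r.1 ∈ ((K a).map enc).support := by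
          rw [← (hstep a).law, PMF.mem_support_map_iff]
          exact ⟨r, hr, rfl⟩
        rw [PMF.mem_support_map_iff] at this
        obtain ⟨a', -, h⟩ := this
        exact ⟨a', h.symm⟩
      constructor
      · have h1 : ∀ r ∈ (c.exec (M := PMF) biasedCoin O (enc a)).support,
            PMF.map Prod.fst ((iterate (M := PMF) (c.exec biasedCoin O) m r.1).map
              fun r' => (r'.1, r.2 + r'.2 + 1)) =
            PMF.map Prod.fst (iterate (M := PMF) (c.exec biasedCoin O) m r.1) := by
          intro r _
          rw [PMF.map_comp]
          rfl
        rw [e, PMF.map_bind, PMF.bind_congr_support h1, iterLaw, PMF.map_bind]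
        have h2 : ((c.exec (M := PMF) biasedCoin O (enc a)).bind fun r =>
            PMF.map Prod.fst (iterate (M := PMF) (c.exec biasedCoin O) m r.1)) =
            ((c.exec (M := PMF) biasedCoin O (enc a)).map Prod.fst).bind fun s =>
            PMF.map Prod.fst (iterate (M := PMF) (c.exec biasedCoin O) m s) := by
          rw [PMF.bind_map]; rfl
        rw [h2, (hstep a).law, PMF.bind_map]
        congr 1
        funext a'
        exact (ih a').1
      · intro r hr
        rw [e, PMF.mem_support_bind_iff] at hr
        obtain ⟨r₁, hr₁, hr⟩ := hr
        rw [PMF.mem_support_map_iff] at hr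
        obtain ⟨r₂, hr₂, rfl⟩ := hr
        obtain ⟨a', ha'⟩ := hs r₁ hr₁
        rw [ha'] at hr₂
        have h3 := (ih a').2 _ hr₂
        have h4 := (hstep a).time _ hr₁
        rw [Nat.succ_mul]
        dsimp only
        omega
  have e : (Cmd.loop i c).exec (M := PMF) biasedCoin O (enc a) =
      (iterate (M := PMF) (c.exec biasedCoin O) (i.eval (enc a)) (enc a)).map
        fun q => (q.1, i.size + q.2 + 1) := rfl
  constructor
  · rw [e, PMF.map_comp, ← (key _ a).1]
    rfl
  · intro r hr
    rw [e, PMF.mem_support_map_iff] at hr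
    obtain ⟨q, hq, rfl⟩ := hr
    have := (key _ a).2 q hq
    dsimp only
    omega

lemma RunsP.loopPow {α : Type} {i : IExp} {m : ℕ} {enc : α → Store} {K : α → PMF α}
    (hi : ∀ a, i.eval (enc a) = m) (hstep : ∀ a, RunsP O c (enc a) ((K a).map enc) t) (k : ℕ)
    (a : α) :
    RunsP O (c.loopPow i k) (enc a) ((iterLaw K (m ^ k) a).map enc)
      (loopPowTime i.size m t k) := by
  induction k generalizing a with
  | zero => simpa [iterLaw, Cmd.loopPow, loopPowTime] using hstep a
  | succ k ih =>
    have := RunsP.loop (i := i) ih a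
    rw [hi, iterLaw_mul] at this
    rw [pow_succ, mul_comm]
    exact this

/-! ### Access to the memory -/

lemma Store.block_length (s : Store) (v : ℕ) : (s.block v).length = s.idx v := by
  simp [Store.block]

lemma Store.block_getD (s : Store) (v k : ℕ) (h : k < s.idx v) : (s.block v).getD k 0 = s.arr v k := by
  simp [Store.block, h]

lemma Store.block_eq {s : Store} {v : ℕ} {l : List ℝ} (h : s.idx v = l.length)
    (h' : ∀ k < l.length, s.arr v k = l.getD k 0) : s.block v = l := by
  refine List.ext_getElem (by rw [Store.block_length, h]) fun k h1 h2 => ?_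
  simp only [Store.block, List.getElem_map, List.getElem_range]
  rw [h' k h2, List.getD_eq_getElem _ _ h2]

@[simp] lemma Store.ofLists_idx (L : List (List ℝ)) (v : ℕ) :
    (Store.ofLists L).idx v = (L.getD v []).length := rfl

@[simp] lemma Store.ofLists_arr (L : List (List ℝ)) (v k : ℕ) :
    (Store.ofLists L).arr v k = (L.getD v []).getD k 0 := rfl

@[simp] lemma Store.ofLists_block (L : List (List ℝ)) (v : ℕ) :
    (Store.ofLists L).block v = L.getD v [] :=
  Store.block_eq rfl fun _ _ => rfl

@[simp] lemma Store.setBlock_idx (s : Store) (d v : ℕ) (l : List ℝ) :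
    (s.setBlock d l).idx v = if v = d then l.length else s.idx v := by
  simp [Store.setBlock, Function.update_apply]

@[simp] lemma Store.setBlock_arr (s : Store) (d v k : ℕ) (l : List ℝ) :
    (s.setBlock d l).arr v k = if v = d then l.getD k 0 else s.arr v k := by
  simp only [Store.setBlock, Function.update_apply]
  split_ifs <;> rfl

@[simp] lemma Store.setBlock_block (s : Store) (d v : ℕ) (l : List ℝ) :
    (s.setBlock d l).block v = if v = d then l else s.block v := by
  split_ifs with h
  · subst h
    exact Store.block_eq (by simp) fun k _ => by simp
  · simp [Store.block, h]

@[simp] lemma Store.setBlock_setBlock (s : Store) (d : ℕ) (l l' : List ℝ) :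
    (s.setBlock d l).setBlock d l' = s.setBlock d l' := by
  simp [Store.setBlock]

@[simp] lemma Store.setEntry_idx (s : Store) (a k : ℕ) (z : ℝ) :
    (s.setEntry a k z).idx = s.idx := rfl

@[simp] lemma Store.setEntry_arr (s : Store) (a k : ℕ) (z : ℝ) (v j : ℕ) :
    (s.setEntry a k z).arr v j = if v = a ∧ j = k then z else s.arr v j := by
  by_cases h : v = a
  · subst h; simp [Store.setEntry, Function.update_apply]
  · simp [Store.setEntry, h]

end

/-! ### List subroutines -/

section
variable {κ : Type} {O : κ → List ℝ → List ℝ}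

/-- Increment an index register. -/
def Cmd.incr (v : ℕ) : Cmd κ := .setIdx v (.add (.var v) (.lit 1))

lemma Runs.incr {v : ℕ} {s : Store} {Q : Store → Prop}
    (hQ : Q ⟨Function.update s.idx v (s.idx v + 1), s.arr⟩) :
    Runs O (.incr v) s Q 4 :=
  Runs.setIdx hQ

/-- The memory agrees with the inputs `L`, except possibly for the array `0` and the register
`9`. -/
structure Fresh (L : List (List ℝ)) (s : Store) : Prop where
  idx : ∀ v, v ≠ 9 → s.idx v = (L.getD v []).length
  arr : ∀ a j, a ≠ 0 → s.arr a j = (L.getD a []).getD j 0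

/-- Overwrite the variable `0` entry by entry by the values of `r`, which refers to the current
position by the register `9`. -/
def Cmd.mapEntries (r : RExp) : Cmd κ :=
  .loop (.var 0) (.seq (.setReal 0 (.var 9) r) (.incr 9))

lemma Runs.incr_seq {v : ℕ} {s : Store} {Q : Store → Prop} {d : Cmd κ} {t : ℕ}
    (h : Runs O d ⟨Function.update s.idx v (s.idx v + 1), s.arr⟩ Q t) :
    Runs O (.seq (.incr v) d) s Q (4 + t) :=
  Runs.setIdx_seq h

lemma computes_mapEntries {r : RExp} {n : ℕ} {L : List (List ℝ)} (hl : (L.getD 0 []).length = n)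
    (hL : L.length ≤ 9) (φ : Fin n → ℝ)
    (hr : ∀ (k : Fin n) (s : Store), s.idx 9 = k → Fresh L s → r.eval s = φ k) :
    Computes O (Cmd.mapEntries r) L (List.ofFn φ) (n * (r.size + 7) + 2) := by
  -- With at most nine inputs, register `9` does not belong to an input and starts at `0`, so it can
  -- serve as the position counter without initialization.
  have h9 : (L.getD 9 []).length = 0 := by simp [hL]
  have := Runs.loop' (O := O) (s := Store.ofLists L) (i := .var 0) (m := n) hl
    (c := .seq (.setReal 0 (.var 9) r) (.incr 9)) (t := r.size + 6)
    (fun k s => s.idx 9 = k ∧ Fresh L s ∧ ∀ j : Fin n, (j : ℕ) < k → s.arr 0 j = φ j)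
    ⟨h9, ⟨fun _ _ => rfl, fun _ _ _ => rfl⟩, by simp⟩ (by
      rintro k hk s ⟨h1, h2, h3⟩
      have hrk := hr ⟨k, hk⟩ s h1 h2
      refine (Runs.setReal_seq (Runs.incr ⟨by simp [h1], ⟨fun v hv => ?_, fun a j ha => ?_⟩,
        fun j hj => ?_⟩)).mono (fun _ => id) (by simp [IExp.size]; omega)
      · simp [hv, h2.idx v hv]
      · simp [ha, h2.arr a j ha]
      · simp only [Store.setEntry_arr, IExp.eval, h1, true_and]
        split_ifs with h
        · rw [hrk]; congr 1; exact Fin.ext h.symm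
        · exact h3 j (by omega))
  refine this.mono (fun s hs => ?_) (by simp [IExp.size]; ring_nf; omega)
  refine Store.block_eq (by rw [hs.2.1.idx 0 (by norm_num), hl]; simp) fun k hk => ?_
  rw [List.length_ofFn] at hk
  rw [hs.2.2 ⟨k, hk⟩ hk]
  simp [hk]

/-- Sum of the values of `r`, which refers to the current position by the register `9`. The array
`0` provides only the number of summands. -/
def Cmd.sumEntries (r : RExp) : Cmd κ :=
  .seq (.setReal 0 (.lit 0) (.ofIdx (.lit 0)))
    (.seq (.loop (.var 0) (.seq (.setReal 0 (.lit 0) (.add (.get 0 (.lit 0)) r)) (.incr 9)))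
      (.setIdx 0 (.lit 1)))

lemma computes_sumEntries {r : RExp} {n : ℕ} {L : List (List ℝ)} (hl : (L.getD 0 []).length = n)
    (hL : L.length ≤ 9) (φ : Fin n → ℝ)
    (hr : ∀ (k : Fin n) (s : Store), s.idx 9 = k → Fresh L s → r.eval s = φ k) :
    Computes O (Cmd.sumEntries r) L [∑ e, φ e] (n * (r.size + 10) + 8) := by
  have h9 : (L.getD 9 []).length = 0 := by simp [hL]
  set ψ : ℕ → ℝ := fun j => if h : j < n then φ ⟨j, h⟩ else 0 with hψ
  refine (Runs.setReal_seq ((Runs.loop' (m := n) ?_ (t := r.size + 9)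
    (fun k s => s.idx 9 = k ∧ Fresh L s ∧ s.arr 0 0 = ∑ j ∈ Finset.range k, ψ j)
    ?_ ?_).seq
      (Q := fun s => s.block 0 = [∑ e, φ e]) fun s hs => Runs.setIdx ?_)).mono (fun _ => id)
        (by simp [IExp.size, RExp.size]; ring_nf; omega)
  · exact hl
  · exact ⟨h9, ⟨fun _ _ => rfl, fun a j ha => by simp [ha]⟩, by simp [IExp.eval, RExp.eval]⟩
  · rintro k hk s ⟨h1, h2, h3⟩
    have hrk := hr ⟨k, hk⟩ s h1 h2
    refine (Runs.setReal_seq (Runs.incr ⟨by simp [h1], ⟨fun v hv => ?_, fun a j ha => ?_⟩,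
        ?_⟩)).mono (fun _ => id) (by simp [IExp.size, RExp.size]; omega)
    · simp [hv, h2.idx v hv]
    · simp [ha, h2.arr a j ha]
    · simp [IExp.eval, RExp.eval, h3, hrk, Finset.sum_range_succ, hψ, hk]
  · refine Store.block_eq (by simp [IExp.eval]) fun k hk => ?_
    have : k = 0 := by simpa using hk
    subst this
    simp [hs.2.2, Finset.sum_range, hψ]

/-- Concatenation. -/
def Cmd.append : Cmd κ :=
  .loop (.var 1) (.seq (.setReal 0 (.var 0) (.get 1 (.var 9))) (.seq (.incr 0) (.incr 9)))

lemma computes_append (x y : List ℝ) :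
    Computes O Cmd.append [x, y] (x ++ y) (y.length * 13 + 2) := by
  refine (Runs.loop' (m := y.length) rfl (t := 12)
    (fun k s => s.idx 9 = k ∧ s.idx 0 = x.length + k ∧ s.idx 1 = y.length ∧
      (∀ j, s.arr 1 j = y.getD j 0) ∧ ∀ j < x.length + k, s.arr 0 j = (x ++ y).getD j 0)
    ⟨rfl, rfl, rfl, fun _ => rfl, fun j hj => ?_⟩ ?_).mono (fun s hs => ?_)
      (by simp [IExp.size]; omega)
  · rw [List.getD_append _ _ _ _ hj]; rfl
  · rintro k hk s ⟨h1, h2, h3, h4, h5⟩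
    refine (Runs.setReal_seq (Runs.incr_seq (Runs.incr ⟨by simp [h1], by simp [h2, add_assoc],
      by simp [h3], fun j => by simp [h4], fun j hj => ?_⟩))).mono (fun _ => id)
        (by simp [IExp.size, RExp.size])
    simp only [Store.setEntry_arr, IExp.eval, RExp.eval, h1, h2, h4, true_and]
    split_ifs with h
    · subst h
      rw [List.getD_append_right _ _ _ _ (by omega)]
      congr 1
      omega
    · exact h5 j (by omega)
  · obtain ⟨h1, h2, h3, h4, h5⟩ := hs
    exact Store.block_eq (by simp [h2]) fun k hk => h5 k (by simpa using hk)

/-- Encoding of two lists by one list. -/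
def pairList (x y : List ℝ) : List ℝ := (x.length : ℝ) :: (x ++ y)

def Cmd.pair : Cmd κ :=
  .seq (.setReal 3 (.lit 0) (.ofIdx (.var 0))) (.seq (.setIdx 3 (.lit 1))
    (.seq (.call .append [3, 0] 4) (.call .append [4, 1] 0)))

lemma computes_pair (x y : List ℝ) :
    Computes O Cmd.pair [x, y] (pairList x y) (x.length * 17 + y.length * 16 + 25) := by
  have h3 : ∀ s : Store, s.idx 3 = 1 → s.arr 3 0 = x.length → s.block 3 = [(x.length : ℝ)] :=
    fun s h h' => Store.block_eq (by simp [h]) fun k hk => by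
      have : k = 0 := by simpa using hk
      subst this; simpa using h'
  refine (Runs.setReal_seq (Runs.setIdx_seq (Runs.call_seq (out := (x.length : ℝ) :: x)
    (t' := x.length * 13 + 2) ?_ (Runs.call (out := pairList x y) (t := y.length * 13 + 2)
      ?_ ?_)))).mono (fun _ => id) ?_
  · convert computes_append (O := O) [(x.length : ℝ)] x using 1
    swap
    · rfl
    simp only [List.map_cons, List.map_nil]
    rw [h3 _ (by simp [IExp.eval]) (by simp [IExp.eval, RExp.eval])]
    congr 2
    exact Store.block_eq (by simp) fun k _ => by simp
  · convert computes_append (O := O) ((x.length : ℝ) :: x) y using 1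
    swap
    · rfl
    simp only [List.map_cons, List.map_nil, Store.setBlock_block]
    congr 2
    exact Store.block_eq (by simp) fun k _ => by simp
  · simp
  · simp [IExp.size, RExp.size, pairList, Store.block_length, IExp.eval]
    omega

/-- The first component of a pair. -/
def Cmd.unpairFst : Cmd κ :=
  .seq (.loop (.var 0) (.ifLt (.ofIdx (.var 9)) (.get 0 (.lit 0))
    (.seq (.setReal 1 (.var 9) (.get 0 (.add (.var 9) (.lit 1)))) (.incr 9)) .skip))
  (.seq (.setIdx 1 (.var 9)) (.call .append [7, 1] 0))

/-- The length of `x` is stored as a real and cannot bound a loop. So the loop runs over the whole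
list and stops counting when the counter reaches this real. Variable `7` is never an input;
appending to the empty list it holds serves as a copy. -/
lemma computes_unpairFst (x y : List ℝ) :
    Computes O Cmd.unpairFst [pairList x y] x (x.length * 40 + y.length * 20 + 40) := by
  refine ((Runs.loop' (m := x.length + y.length + 1) ?_ (t := 15)
    (fun k s => s.idx 9 = min k x.length ∧ s.idx 7 = 0 ∧
      (∀ j, s.arr 0 j = (pairList x y).getD j 0) ∧ ∀ j < min k x.length, s.arr 1 j = x.getD j 0)
    ?_ ?_).seq (Q := fun s => s.block 0 = x) (t₂ := x.length * 15 + 7) ?_).mono (fun _ => id)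
      (by simp [IExp.size]; omega)
  · simp [IExp.eval, pairList]
  · exact ⟨by simp, by simp, fun _ => rfl, by simp⟩
  · rintro k hk s ⟨h1, h7, h2, h3⟩
    refine (Runs.ifLt (t := 10) (fun h => ?_) fun h => ?_).mono (fun _ => id)
      (by simp [IExp.size, RExp.size])
    · have hkx : min k x.length < x.length := by
        simp only [RExp.eval, IExp.eval, h1, h2, pairList, List.getD_cons_zero, Nat.cast_lt] at h
        exact h
      refine (Runs.setReal_seq (Runs.incr ⟨?_, by simp [h7], fun j => by simp [h2],
        fun j hj => ?_⟩)).mono (fun _ => id) (by simp [IExp.size, RExp.size])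
      · simp [h1]; omega
      · simp only [Store.setEntry_arr, IExp.eval, RExp.eval, h1, h2, true_and]
        split_ifs with h'
        · rw [h', pairList, List.getD_cons_succ, List.getD_append _ _ _ _ hkx]
        · exact h3 j (by omega)
    · have hkx : ¬ min k x.length < x.length := by
        simp only [RExp.eval, IExp.eval, h1, h2, pairList, List.getD_cons_zero, Nat.cast_lt] at h
        exact h
      exact (Runs.skip ⟨by omega, h7, h2, fun j hj => h3 j (by omega)⟩).mono (fun _ => id)
        (by norm_num)
  · rintro s ⟨h1, h7, h2, h3⟩
    have h1' : s.idx 9 = x.length := by omega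
    refine (Runs.setIdx_seq (Runs.call (out := x) (t := x.length * 13 + 2) ?_ ?_)).mono
      (fun _ => id) ?_
    · convert computes_append (O := O) [] x using 1
      swap
      · rfl
      simp only [List.map_cons, List.map_nil]
      congr 1
      · exact Store.block_eq (by simp [h7]) (by simp)
      · congr 1
        exact Store.block_eq (by simp [h1', IExp.eval]) fun k hk => h3 k (by omega)
    · simp
    · simp [IExp.size, IExp.eval, Store.block_length, h1', h7]; omega

/-- The second component of a pair. -/
def Cmd.unpairSnd : Cmd κ :=
  .seq (.loop (.var 0) (.ifLt (.ofIdx (.var 9)) (.get 0 (.lit 0)) (.incr 9) .skip))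
  (.seq (.setIdx 1 (.sub (.var 0) (.add (.var 9) (.lit 1))))
    (.seq (.loop (.var 1) (.seq (.setReal 1 (.var 8)
      (.get 0 (.add (.add (.var 9) (.lit 1)) (.var 8)))) (.incr 8)))
      (.call .append [7, 1] 0)))

/-- The first loop only recovers the length of `x` in register `9`. The second one copies what lies
beyond the header and `x`, with `8` as counter. -/
lemma computes_unpairSnd (x y : List ℝ) :
    Computes O Cmd.unpairSnd [pairList x y] y (x.length * 40 + y.length * 60 + 40) := by
  refine ((Runs.loop' (m := x.length + y.length + 1) ?_ (t := 10)
    (fun k s => s.idx 9 = min k x.length ∧ s.idx 7 = 0 ∧ s.idx 8 = 0 ∧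
      s.idx 0 = x.length + y.length + 1 ∧ ∀ j, s.arr 0 j = (pairList x y).getD j 0)
    ?_ ?_).seq (Q := fun s => s.block 0 = y) (t₂ := y.length * 29 + 13) ?_).mono (fun _ => id)
      (by simp [IExp.size]; omega)
  · simp [IExp.eval, pairList]
  · exact ⟨by simp, by simp, by simp, by simp [pairList], fun _ => rfl⟩
  · rintro k hk s ⟨h1, h7, h8, h0, h2⟩
    refine (Runs.ifLt (t := 4) (fun h => ?_) fun h => ?_).mono (fun _ => id)
      (by simp [IExp.size, RExp.size])
    · have hkx : min k x.length < x.length := by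
        simp only [RExp.eval, IExp.eval, h1, h2, pairList, List.getD_cons_zero, Nat.cast_lt] at h
        exact h
      refine Runs.incr ⟨?_, by simp [h7], by simp [h8], by simp [h0], fun j => by simp [h2]⟩
      simp [h1]; omega
    · have hkx : ¬ min k x.length < x.length := by
        simp only [RExp.eval, IExp.eval, h1, h2, pairList, List.getD_cons_zero, Nat.cast_lt] at h
        exact h
      exact (Runs.skip ⟨by omega, h7, h8, h0, h2⟩).mono (fun _ => id) (by norm_num)
  · rintro s ⟨h1, h7, h8, h0, h2⟩
    refine (Runs.setIdx_seq ((Runs.loop' (m := y.length) ?_ (t := 13)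
      (fun k s => s.idx 9 = x.length ∧ s.idx 7 = 0 ∧ s.idx 8 = k ∧ s.idx 1 = y.length ∧
        (∀ j, s.arr 0 j = (pairList x y).getD j 0) ∧ ∀ j < k, s.arr 1 j = y.getD j 0)
        ?_ ?_).seq (t₂ := y.length * 15 + 5) ?_)).mono (fun _ => id) ?_
    · simp [IExp.eval, h1, h0]; omega
    · refine ⟨by simp [h1]; omega, by simp [h7], by simp [h8], ?_, h2, by simp⟩
      simp [IExp.eval, h1, h0]; omega
    · rintro k hk s ⟨h9, h7, h8, h1, h0, h2⟩
      refine (Runs.setReal_seq (Runs.incr ⟨by simp [h9], by simp [h7], by simp [h8], by simp [h1],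
        fun j => by simp [h0], fun j hj => ?_⟩)).mono (fun _ => id) (by simp [IExp.size, RExp.size])
      simp only [Store.setEntry_arr, IExp.eval, RExp.eval, h9, h8, h0, true_and]
      split_ifs with h'
      · rw [h', pairList, add_right_comm, List.getD_cons_succ,
          List.getD_append_right _ _ _ _ (by omega)]
        congr 1; omega
      · exact h2 j (by omega)
    · rintro s ⟨h9, h7, h8, h1, h0, h2⟩
      refine (Runs.call (out := y) (t := y.length * 13 + 2) ?_ ?_).mono (fun _ => id) ?_
      · convert computes_append (O := O) [] y using 1
        swap
        · rfl
        simp only [List.map_cons, List.map_nil]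
        congr 1
        · exact Store.block_eq (by simp [h7]) (by simp)
        · congr 1
          exact Store.block_eq h1 fun k hk => h2 k hk
      · simp
      · simp [Store.block_length, h7, h1]; omega
    · simp [IExp.size]; omega

end

/-! ### Randomized sets and oracle queries -/

section
variable {κ : Type} {O : κ → List ℝ → List ℝ} {n : ℕ}

lemma ofFn_getD (v : Fin n → ℝ) (k : Fin n) : (List.ofFn v).getD k 0 = v k := by
  simp

lemma listSet_setList (S : Finset (Fin n)) : listSet (setList S) = S := by
  ext e
  simp [listSet, setList, charVec]

lemma setList_length (S : Finset (Fin n)) : (setList S).length = n := by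
  simp [setList]

lemma setList_getD (S : Finset (Fin n)) (k : Fin n) :
    (setList S).getD k 0 = if k ∈ S then 1 else 0 := by
  rw [setList, ofFn_getD]; simp [charVec]

lemma RunsP.coin {a : ℕ} {i : IExp} {r : RExp} {s : Store} :
    RunsP O (.coin a i r) s
      ((biasedCoin (r.eval s)).map fun z => s.setEntry a (i.eval s) (if z then 1 else 0))
      (i.size + r.size + 1) := by
  have e : (Cmd.coin a i r : Cmd κ).exec (M := PMF) biasedCoin O s =
      (biasedCoin (r.eval s)).map fun z => (s.setEntry a (i.eval s) (if z then 1 else 0),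
        i.size + r.size + 1) := rfl
  constructor
  · rw [e, PMF.map_comp]; rfl
  · intro q hq
    rw [e, PMF.mem_support_map_iff] at hq
    obtain ⟨z, -, rfl⟩ := hq
    rfl

lemma lexp_biasedCoin (r : ℝ) (φ : Bool → ENNReal) :
    lexp (biasedCoin r) φ = ENNReal.ofReal (clamp r) * φ true +
      ENNReal.ofReal (1 - clamp r) * φ false := by
  rw [lexp, tsum_fintype, Fintype.sum_bool]
  rfl

/-- Tested on indicators. Real test functions suffice, which allows comparing with `setExp`. -/
lemma pmf_ext_lexp {α : Type} {μ ν : PMF α}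
    (h : ∀ g : α → ℝ, (∀ a, 0 ≤ g a) → lexp μ (fun b => ENNReal.ofReal (g b)) =
      lexp ν fun b => ENNReal.ofReal (g b)) : μ = ν := by
  have key : ∀ (ρ : PMF α) a, lexp ρ (fun b => ENNReal.ofReal (if b = a then 1 else 0)) = ρ a := by
    intro ρ a
    rw [lexp, tsum_eq_single a]
    · simp
    · intro b hb; simp [hb]
  ext a
  rw [← key, ← key, h _ fun b => by split_ifs <;> norm_num]

lemma lexp_prodPMF_clamp {N : Type} [Fintype N] (x : N → ℝ) {h : Finset N → ℝ}
    (hh : ∀ R, 0 ≤ h R) : lexp (prodPMF x) (fun R => ENNReal.ofReal (h R)) =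
      ENNReal.ofReal (setExp (fun e => clamp (x e)) h) := by
  rw [← lexp_prodPMF (fun e => clamp_mem _) hh]
  congr 1
  rw [prodPMF, prodPMF]
  congr 1
  funext R
  congr 2
  funext e
  exact (clamp_eq (clamp_mem _)).symm

/-- Replace each entry by the outcome of a coin with this bias. -/
def Cmd.coins : Cmd κ :=
  .loop (.var 0) (.seq (.coin 0 (.var 9) (.get 1 (.var 9))) (.incr 9))

/-- The loop is a Markov chain on pairs of a position and an array. One copy of the biases is
overwritten while the other is read. -/
lemma computesP_coins (x : Fin n → ℝ) :
    ComputesP O Cmd.coins [List.ofFn x, List.ofFn x] ((prodPMF x).map setList) (n * 9 + 2) := by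
  set s₀ := Store.ofLists [List.ofFn x, List.ofFn x] with hs₀
  set enc : ℕ × (ℕ → ℝ) → Store := fun a =>
    ⟨Function.update s₀.idx 9 a.1, Function.update s₀.arr 0 a.2⟩ with henc
  set K : ℕ × (ℕ → ℝ) → PMF (ℕ × (ℕ → ℝ)) := fun a =>
    (biasedCoin ((List.ofFn x).getD a.1 0)).map fun z =>
      (a.1 + 1, Function.update a.2 a.1 (if z then 1 else 0)) with hK
  have hstep : ∀ a, RunsP O (.seq (.coin 0 (.var 9) (.get 1 (.var 9))) (.incr 9)) (enc a)
      ((K a).map enc) 8 := by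
    intro a
    refine (RunsP.coin.seq fun s _ => RunsP.of_runs (t := 4) ?_ (Runs.incr rfl)).congr ?_ ?_
    · trivial
    · rw [PMF.bind_map, hK]
      dsimp only
      rw [PMF.map_comp, PMF.map]
      congr 1
      funext z
      simp only [Function.comp_apply, henc]
      congr 2
      · simp [Store.setEntry]
      · simp [Store.setEntry, IExp.eval]
    · simp [IExp.size, RExp.size]
  have hrun := (RunsP.loop (i := .var 0) hstep (0, s₀.arr 0))
  have h0 : enc (0, s₀.arr 0) = s₀ := by
    simp only [henc]
    congr
    · exact Function.update_eq_self 9 s₀.idx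
    · exact Function.update_eq_self 0 s₀.arr
  have hn : IExp.eval s₀ (.var 0) = n := by simp [IExp.eval, hs₀]
  rw [h0, hn] at hrun
  -- Induction on the number `m` of coins left: the first `k` entries are already fixed to `g`, the
  -- others still follow the product distribution. One coin is one use of `setExp_split`.
  have key : ∀ (h : (Fin n → ℝ) → ℝ), (∀ v, 0 ≤ h v) → ∀ (m k : ℕ) (g : ℕ → ℝ), k + m = n →
      lexp (iterLaw K m (k, g)) (fun a => ENNReal.ofReal (h fun j => a.2 j)) =
        ENNReal.ofReal (setExp (fun e => clamp (x e)) fun X =>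
          h fun j => if (j : ℕ) < k then g j else charVec X j) := by
    intro h hh m
    induction m with
    | zero =>
      intro k g hk
      rw [iterLaw, lexp_pure]
      have : ∀ j : Fin n, (j : ℕ) < k := fun j => by omega
      simp only [this, if_true, setExp_const]
    | succ m ih =>
      intro k g hk
      have hkn : k < n := by omega
      rw [iterLaw, lexp_bind, hK]
      simp only [lexp_map]
      rw [lexp_biasedCoin, ih _ _ (by omega), ih _ _ (by omega),
        ← ENNReal.ofReal_mul (clamp_mem _).1,
        ← ENNReal.ofReal_mul (by linarith [(clamp_mem ((List.ofFn x).getD k 0)).2]),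
        ← ENNReal.ofReal_add
          (mul_nonneg (clamp_mem _).1 (setExp_nonneg (fun e => clamp_mem _) fun _ => hh _))
          (mul_nonneg (by linarith [(clamp_mem ((List.ofFn x).getD k 0)).2])
            (setExp_nonneg (fun e => clamp_mem _) fun _ => hh _)),
        ofFn_getD x ⟨k, hkn⟩]
      conv_rhs => rw [setExp_split (fun e => clamp (x e)) ⟨k, hkn⟩]
      congr 3 <;> congr 1 <;> funext X <;> congr 1 <;> funext j <;>
        rcases lt_trichotomy (j : ℕ) k with hj | hj | hj
      · simp [hj, hj.ne, Nat.lt_succ_of_lt hj]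
      · have : j = ⟨k, hkn⟩ := Fin.ext hj
        subst this
        simp [charVec]
      · have h1 : ¬ (j : ℕ) < k + 1 := by omega
        have h2 : ¬ (j : ℕ) < k := by omega
        have h3 : j ≠ ⟨k, hkn⟩ := fun h => by simp [h] at hj
        simp [h1, h2, charVec, h3]
      · simp [hj, hj.ne, Nat.lt_succ_of_lt hj]
      · have : j = ⟨k, hkn⟩ := Fin.ext hj
        subst this
        simp [charVec]
      · have h1 : ¬ (j : ℕ) < k + 1 := by omega
        have h2 : ¬ (j : ℕ) < k := by omega
        have h3 : j ≠ ⟨k, hkn⟩ := fun h => by simp [h] at hj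
        simp [h1, h2, charVec, h3]
  have hblock : ∀ a, (enc a).block 0 = List.ofFn fun j : Fin n => a.2 j := by
    intro a
    refine Store.block_eq ?_ fun k hk => ?_
    · simp [henc, hs₀]
    · rw [List.length_ofFn] at hk
      rw [ofFn_getD _ ⟨k, hk⟩]
      simp [henc]
  have hlaw : (iterLaw K n (0, s₀.arr 0)).map (fun a (j : Fin n) => a.2 j) =
      (prodPMF x).map fun S => charVec S := by
    refine pmf_ext_lexp fun g hg => ?_
    rw [lexp_map, lexp_map, key g hg n 0 _ (zero_add n), lexp_prodPMF_clamp x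
        (h := fun S => g (charVec S)) fun w => hg _]
    simp only [Nat.not_lt_zero, if_false]
  have hfin := (hrun.congr rfl (t' := n * 9 + 2) (by simp [IExp.size]; omega)).computesP
  refine ⟨hfin.law.trans ?_, hfin.time⟩
  rw [PMF.map_comp]
  have : (fun s : Store => s.block 0) ∘ enc =
      (fun v : Fin n → ℝ => List.ofFn v) ∘ fun a j => a.2 j := by
    funext a; exact hblock a
  rw [this, ← PMF.map_comp, hlaw, PMF.map_comp]
  rfl

/-- The entries of a charVec list after writing `1` at a position. -/
lemma setList_insert_getD (S : Finset (Fin n)) (k : Fin n) (j : ℕ) (hj : j < n) :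
    (setList (insert k S)).getD j 0 = if j = k then 1 else (setList S).getD j 0 := by
  rw [setList_getD _ ⟨j, hj⟩, setList_getD _ ⟨j, hj⟩]
  by_cases h : j = k
  · subst h; simp
  · have : (⟨j, hj⟩ : Fin n) ≠ k := fun h' => h (by rw [← h'])
    simp [h, this]

end

section
variable {O : OracleName → List ℝ → List ℝ} {n : ℕ}

/-- For the given list of marginals `acc` and set `R`, add the marginal values with respect to `R`. -/
def Cmd.addMarginals : Cmd OracleName :=
  .seq (.query .objective 1 2) (.loop (.var 0)
    (.seq (.setReal 4 (.lit 0) (.get 1 (.var 9)))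
    (.seq (.setReal 1 (.var 9) (.ofIdx (.lit 1)))
    (.seq (.query .objective 1 3)
    (.seq (.setReal 0 (.var 9)
      (.add (.get 0 (.var 9)) (.sub (.get 3 (.lit 0)) (.get 2 (.lit 0)))))
    (.seq (.setReal 1 (.var 9) (.get 4 (.lit 0))) (.incr 9)))))))

/-- The characteristic vector is changed in place for each query. Variable `4` keeps the old entry,
which may already be `1`, so that it can be restored. -/
lemma computes_addMarginals {f : Finset (Fin n) → ℝ}
    (hO : ∀ l, O .objective l = [f (listSet l)]) (v : Fin n → ℝ) (R : Finset (Fin n)) :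
    Computes O Cmd.addMarginals [List.ofFn v, setList R]
      (List.ofFn fun e => v e + (f (insert e R) - f R)) (n * (n + 31) + n + 4) := by
  refine (Runs.query_seq (Runs.loop' (m := n) ?_ (t := n + 30) (fun k s => s.idx 9 = k ∧
    s.idx 0 = n ∧ s.idx 1 = n ∧ s.arr 2 0 = f R ∧ (∀ j, s.arr 1 j = (setList R).getD j 0) ∧
      ∀ j : Fin n, s.arr 0 j = v j + if (j : ℕ) < k then f (insert j R) - f R else 0)
    ?_ ?_)).mono (fun s hs => ?_) ?_
  · simp [IExp.eval]
  · refine ⟨by simp, by simp, by simp [setList_length], ?_, fun j => by simp, by simp⟩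
    simp [hO, listSet_setList]
  · rintro k hk s ⟨h9, h0, h1, h2, h3, h4⟩
    have hins : (setList (insert ⟨k, hk⟩ R)) = (List.range n).map fun j =>
        if j = k then 1 else (setList R).getD j 0 := by
      refine List.ext_getElem (by simp [setList_length]) fun j hj _ => ?_
      rw [setList_length] at hj
      rw [← List.getD_eq_getElem _ 0, setList_insert_getD _ _ _ hj]
      simp
    refine (Runs.setReal_seq (Runs.setReal_seq (Runs.query_seq (Runs.setReal_seq (Runs.setReal_seq
      (Runs.incr ⟨?_, ?_, ?_, ?_, ?_, ?_⟩)))))).mono (fun _ => id) ?_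
    · simp [IExp.size, RExp.size, Store.block_length, h1, hO]
      omega
    · simp [h9]
    · simp [h0]
    · simp [h1]
    · simp [h2]
    · intro j
      by_cases hj : j = k <;> simp [IExp.eval, RExp.eval, h9, h3, hj]
    · intro j
      have hq : ∀ s' : Store, s'.idx 1 = n →
          (∀ i, s'.arr 1 i = if i = k then 1 else (setList R).getD i 0) →
          O .objective (s'.block 1) = [f (insert ⟨k, hk⟩ R)] := by
        intro s' hs1 hs2
        have : s'.block 1 = setList (insert ⟨k, hk⟩ R) := by
          rw [hins, Store.block, hs1]
          exact List.map_congr_left fun i _ => hs2 i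
        rw [hO, this, listSet_setList]
      have hq' := hq ((s.setEntry 4 0 (s.arr 1 k)).setEntry 1 k 1) (by simpa using h1)
        (fun i => by simp [h3])
      by_cases hj : (j : ℕ) = k
      · have hjk : j = ⟨k, hk⟩ := Fin.ext hj
        subst hjk
        have h4k := h4 ⟨k, hk⟩
        simp only [lt_irrefl, if_false, add_zero] at h4k
        simp [IExp.eval, RExp.eval, h9, hq', h2, h4k]
      · have h5 : ((j : ℕ) < k + 1) ↔ ((j : ℕ) < k) := by omega
        simp [IExp.eval, RExp.eval, h9, h4, hj, h5]
  · obtain ⟨h9, h0, h1, h2, h3, h4⟩ := hs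
    refine Store.block_eq (by simp [h0]) fun k hk => ?_
    rw [List.length_ofFn] at hk
    rw [h4 ⟨k, hk⟩, ofFn_getD _ ⟨k, hk⟩]
    simp [hk]
  · simp [IExp.size, setList_length, hO]
    linarith

/-- Mark the elements whose unit vectors belong to both polytopes. -/
def Cmd.flags : Cmd OracleName :=
  .loop (.var 0)
    (.seq (.setReal 1 (.var 9) (.ofIdx (.lit 1)))
    (.seq (.query .sepIn 1 2)
    (.seq (.query .sepOut 1 3)
    (.seq (.setReal 1 (.var 9) (.ofIdx (.lit 0)))
    (.seq (.ifLt (.ofIdx (.add (.var 2) (.var 3))) (.ofIdx (.lit 1))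
      (.setReal 0 (.var 9) (.ofIdx (.lit 1))) (.setReal 0 (.var 9) (.ofIdx (.lit 0))))
      (.incr 9))))))

/-- An empty answer means acceptance, so both oracles accept exactly when the two lengths sum to
less than `1`. -/
lemma computes_flags (hin : ∀ l, (O .sepIn l).length ≤ n) (hout : ∀ l, (O .sepOut l).length ≤ n)
    (v : Fin n → ℝ) :
    Computes O Cmd.flags [List.ofFn v, List.ofFn fun _ : Fin n => 0]
      (List.ofFn fun e : Fin n => if (O .sepIn (setList {e})).length + (O .sepOut (setList {e})).length < 1
        then 1 else 0) (n * (4 * n + 40) + 4) := by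
  refine (Runs.loop' (m := n) ?_ (t := 4 * n + 35) (fun k s => s.idx 9 = k ∧
    s.idx 0 = n ∧ s.idx 1 = n ∧ (∀ j, s.arr 1 j = 0) ∧
      ∀ j : Fin n, (j : ℕ) < k → s.arr 0 j = if (O .sepIn (setList {j})).length +
        (O .sepOut (setList {j})).length < 1 then 1 else 0)
    ?_ ?_).mono (fun s hs => ?_) ?_
  · simp [IExp.eval]
  · refine ⟨by simp, by simp, by simp, fun j => ?_, by simp⟩
    by_cases hj : j < n <;> simp [hj]
  · rintro k hk s ⟨h9, h0, h1, h3, h4⟩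
    have hq : ∀ s' : Store, s'.idx 1 = n → (∀ i, s'.arr 1 i = if i = k then 1 else 0) →
        s'.block 1 = setList {⟨k, hk⟩} := by
      intro s' hs1 hs2
      refine Store.block_eq (by rw [hs1, setList_length]) fun i hi => ?_
      rw [setList_length] at hi
      rw [hs2, setList_getD _ ⟨i, hi⟩]
      simp
    have hq' := hq (s.setEntry 1 k 1) (by simpa using h1) (fun i => by simp [h3])
    refine (Runs.setReal_seq (Runs.query_seq (Runs.query_seq (Runs.setReal_seq
      ((Runs.ifLt (t := 4) (Q := fun s' => s'.idx 9 = k ∧ s'.idx 0 = n ∧ s'.idx 1 = n ∧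
        (∀ j, s'.arr 1 j = 0) ∧ ∀ j : Fin n, (j : ℕ) < k + 1 → s'.arr 0 j =
          if (O .sepIn (setList {j})).length + (O .sepOut (setList {j})).length < 1 then 1 else 0)
        (fun h => ?_) (fun h => ?_)).seq fun s' hs' => Runs.incr ?_))))).mono (fun _ => id) ?_
    · refine (Runs.setReal ⟨?_, ?_, ?_, ?_, ?_⟩).mono (fun _ => id) (by simp [IExp.size, RExp.size])
      · simp [h9]
      · simp [h0]
      · simp [h1]
      · intro j; by_cases hj : j = k <;> simp [IExp.eval, RExp.eval, h9, h3, hj]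
      · intro j hj
        by_cases hjk : (j : ℕ) = k
        · have hjk' : j = ⟨k, hk⟩ := Fin.ext hjk
          subst hjk'
          have hlt : (O .sepIn (setList {⟨k, hk⟩})).length +
              (O .sepOut (setList {⟨k, hk⟩})).length < 1 := by
            simp [RExp.eval, IExp.eval, h9, hq'] at h
            exact_mod_cast h
          rw [if_pos hlt]
          simp [RExp.eval, IExp.eval, h9]
        · simp [IExp.eval, RExp.eval, h9, hjk, h4 j (by omega)]
    · refine (Runs.setReal ⟨?_, ?_, ?_, ?_, ?_⟩).mono (fun _ => id) (by simp [IExp.size, RExp.size])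
      · simp [h9]
      · simp [h0]
      · simp [h1]
      · intro j; by_cases hj : j = k <;> simp [IExp.eval, RExp.eval, h9, h3, hj]
      · intro j hj
        by_cases hjk : (j : ℕ) = k
        · have hjk' : j = ⟨k, hk⟩ := Fin.ext hjk
          subst hjk'
          have hlt : ¬ (O .sepIn (setList {⟨k, hk⟩})).length +
              (O .sepOut (setList {⟨k, hk⟩})).length < 1 := by
            simp [RExp.eval, IExp.eval, h9, hq'] at h
            rw [not_lt]
            exact_mod_cast h
          rw [if_neg hlt]
          simp [RExp.eval, IExp.eval, h9]
        · simp [IExp.eval, RExp.eval, h9, hjk, h4 j (by omega)]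
    · obtain ⟨g9, g0, g1, g3, g4⟩ := hs'
      exact ⟨by simp [g9], by simp [g0], by simp [g1], by simpa using g3, by simpa using g4⟩
    · have := hin ((s.setEntry 1 k 1).block 1)
      have := hout (setList {⟨k, hk⟩})
      have := hin (setList {⟨k, hk⟩})
      simp [IExp.size, RExp.size, hq', IExp.eval, h9, RExp.eval, setList_length]
      omega
  · obtain ⟨h9, h0, h1, h3, h4⟩ := hs
    refine Store.block_eq (by simp [h0]) fun k hk => ?_
    rw [List.length_ofFn] at hk
    rw [h4 ⟨k, hk⟩ hk, ofFn_getD _ ⟨k, hk⟩]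
  · simp [IExp.size]
    ring_nf
    omega

/-- The characteristic vector of the elements that occur with a status above a threshold in a list
of elements with status. -/
def Cmd.history : Cmd OracleName :=
  .loop (.var 0)
    (.seq (.setReal 0 (.var 9) (.ofIdx (.lit 0)))
    (.seq (.setIdx 8 (.lit 0))
    (.seq (.loop (.var 1)
      (.seq (.ifLt (.mul (.sub (.get 1 (.var 8)) (.ofIdx (.var 9)))
          (.sub (.get 1 (.var 8)) (.ofIdx (.var 9)))) (.ofIdx (.lit 1))
        (.ifLt (.get 3 (.lit 0)) (.get 2 (.var 8)) (.setReal 0 (.var 9) (.ofIdx (.lit 1))) .skip)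
        .skip) (.incr 8)))
      (.incr 9))))

/-- Equality of indices expressed by the only comparison of the machine. -/
lemma sub_mul_self_lt_one_iff (a b : ℕ) : ((a : ℝ) - b) * ((a : ℝ) - b) < 1 ↔ a = b := by
  constructor
  · intro h
    by_contra hne
    rcases Nat.lt_or_gt_of_ne hne with h' | h'
    · have : (a : ℝ) + 1 ≤ b := by exact_mod_cast h'
      nlinarith
    · have : (b : ℝ) + 1 ≤ a := by exact_mod_cast h'
      nlinarith
  · rintro rfl
    simp

lemma computes_history (v : Fin n → ℝ) (l : List (ℕ × ℝ)) (thr : ℝ) :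
    Computes O Cmd.history [List.ofFn v, l.map fun q => (q.1 : ℝ), l.map Prod.snd, [thr]]
      (List.ofFn fun e : Fin n => if ∃ q ∈ l, q.1 = e ∧ thr < q.2 then 1 else 0)
      (n * (l.length * 40 + 40) + 4) := by
  -- Entry `i` of the list is a witness for the element `k`. The inner loop maintains whether a
  -- witness occurs before position `i`.
  set P : ℕ → ℕ → Prop := fun i k => (l.getD i (0, 0)).1 = k ∧ thr < (l.getD i (0, 0)).2 with hP
  have hex : ∀ k, (∃ i < l.length, P i k) ↔ ∃ q ∈ l, q.1 = k ∧ thr < q.2 := by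
    intro k
    constructor
    · rintro ⟨i, hi, h⟩
      simp only [hP, List.getD_eq_getElem _ _ hi] at h
      exact ⟨l[i], List.getElem_mem hi, h⟩
    · rintro ⟨q, hq, h⟩
      obtain ⟨i, hi, rfl⟩ := List.getElem_of_mem hq
      refine ⟨i, hi, ?_⟩
      simpa only [hP, List.getD_eq_getElem _ _ hi] using h
  have hg1 : ∀ i, (l.map fun q => (q.1 : ℝ)).getD i 0 = ((l.getD i (0, 0)).1 : ℝ) := by
    intro i
    rw [← List.getD_map (f := fun q : ℕ × ℝ => (q.1 : ℝ))]
    simp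
  have hg2 : ∀ i, (l.map Prod.snd).getD i 0 = (l.getD i (0, 0)).2 := by
    intro i
    rw [← List.getD_map (f := fun q : ℕ × ℝ => q.2)]
  let Inv : Store → Prop := fun s => s.idx 0 = n ∧ s.idx 1 = l.length ∧
    (∀ i, s.arr 1 i = ((l.getD i (0, 0)).1 : ℝ)) ∧ (∀ i, s.arr 2 i = (l.getD i (0, 0)).2) ∧
    s.arr 3 0 = thr
  refine (Runs.loop' (m := n) ?_ (t := l.length * 30 + 20) (fun k s => s.idx 9 = k ∧ Inv s ∧
      ∀ j < k, s.arr 0 j = if ∃ q ∈ l, q.1 = j ∧ thr < q.2 then 1 else 0)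
    ?_ ?_).mono (fun s hs => ?_) ?_
  · simp [IExp.eval]
  · refine ⟨by simp, ⟨by simp, by simp, fun i => ?_, fun i => ?_, by simp⟩, by simp⟩
    · rw [← hg1]; rfl
    · rw [← hg2]; rfl
  · rintro k hk s ⟨h9, ⟨h0, h1, h2, h3, h4⟩, h5⟩
    refine (Runs.setReal_seq (Runs.setIdx_seq ((Runs.loop' (m := l.length) ?_ (t := 27)
      (fun i s => s.idx 8 = i ∧ s.idx 9 = k ∧ Inv s ∧
        (s.arr 0 k = if ∃ i' < i, P i' k then 1 else 0) ∧
        ∀ j < k, s.arr 0 j = if ∃ q ∈ l, q.1 = j ∧ thr < q.2 then 1 else 0) ?_ ?_).seq (t₂ := 4)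
      ?_))).mono (fun _ => id) ?_
    · simp [IExp.eval, h1]
    · refine ⟨by simp [IExp.eval], by simp [h9], ⟨by simp [h0], by simp [h1], by simpa using h2,
        by simpa using h3, by simpa using h4⟩, by simp [IExp.eval, RExp.eval, h9], fun j hj => ?_⟩
      simp [IExp.eval, h9, hj.ne, h5 j hj]
    · rintro i hi s ⟨g8, g9, ⟨g0, g1, g2, g3, g4⟩, g5, g6⟩
      have hsucc : (∃ i' < i + 1, P i' k) ↔ (P i k ∨ ∃ i' < i, P i' k) := by
        constructor
        · rintro ⟨i', hi', h⟩
          rcases Nat.lt_succ_iff_lt_or_eq.1 hi' with h' | rfl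
          · exact Or.inr ⟨i', h', h⟩
          · exact Or.inl h
        · rintro (h | ⟨i', hi', h⟩)
          · exact ⟨i, Nat.lt_succ_self i, h⟩
          · exact ⟨i', Nat.lt_succ_of_lt hi', h⟩
      have hno : ¬ P i k → s.arr 0 k = if ∃ i' < i + 1, P i' k then 1 else 0 := by
        intro h
        rw [g5]
        simp only [hsucc, h, false_or]
      refine ((Runs.ifLt (t := 9) (Q := fun s => s.idx 8 = i ∧ s.idx 9 = k ∧ Inv s ∧
        (s.arr 0 k = if ∃ i' < i + 1, P i' k then 1 else 0) ∧
        ∀ j < k, s.arr 0 j = if ∃ q ∈ l, q.1 = j ∧ thr < q.2 then 1 else 0)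
        (fun h => (Runs.ifLt (t := 4) (fun h' => ?_) (fun h' => ?_)).mono (fun _ => id) ?_)
        (fun h => ?_)).seq
          (t₂ := 4) fun s' hs' => Runs.incr ?_).mono (fun _ => id) (by simp [IExp.size, RExp.size])
      · have hk' : (l.getD i (0, 0)).1 = k := by
          simp only [RExp.eval, IExp.eval, g8, g9, g2, Nat.cast_one] at h
          exact (sub_mul_self_lt_one_iff _ _).1 h
        have hthr : thr < (l.getD i (0, 0)).2 := by
          simpa only [RExp.eval, IExp.eval, g8, g3, g4] using h'
        refine (Runs.setReal ⟨by simp [g8], by simp [g9], ⟨by simp [g0], by simp [g1],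
          by simpa using g2, by simpa using g3, by simpa using g4⟩, ?_, fun j hj => ?_⟩).mono
            (fun _ => id) (by simp [IExp.size, RExp.size])
        · have : P i k := ⟨hk', hthr⟩
          simp only [hsucc, this, true_or, if_true]
          simp [IExp.eval, RExp.eval, g9]
        · simp [IExp.eval, g9, hj.ne, g6 j hj]
      · refine (Runs.skip ⟨g8, g9, ⟨g0, g1, g2, g3, g4⟩, hno fun h'' => h' ?_, g6⟩).mono
          (fun _ => id) (by norm_num)
        simpa only [RExp.eval, IExp.eval, g8, g3, g4] using h''.2
      · simp [IExp.size, RExp.size]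
      · refine (Runs.skip ⟨g8, g9, ⟨g0, g1, g2, g3, g4⟩, hno fun h'' => h ?_, g6⟩).mono
          (fun _ => id) (by norm_num)
        simp only [RExp.eval, IExp.eval, g8, g9, g2, Nat.cast_one]
        exact (sub_mul_self_lt_one_iff _ _).2 h''.1
      · obtain ⟨g8, g9, ⟨g0, g1, g2, g3, g4⟩, g5, g6⟩ := hs'
        exact ⟨by simp [g8], by simp [g9], ⟨by simp [g0], by simp [g1], g2, g3, g4⟩, g5, g6⟩
    · rintro s ⟨g8, g9, ⟨g0, g1, g2, g3, g4⟩, g5, g6⟩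
      refine Runs.incr ⟨by simp [g9], ⟨by simp [g0], by simp [g1], g2, g3, g4⟩, fun j hj => ?_⟩
      rcases Nat.lt_succ_iff_lt_or_eq.1 hj with hj | rfl
      · exact g6 j hj
      · simp only [hex] at g5
        exact g5
    · simp [IExp.size, RExp.size]; omega
  · obtain ⟨h9, ⟨h0, -⟩, h5⟩ := hs
    refine Store.block_eq (by simp [h0]) fun k hk => ?_
    rw [List.length_ofFn] at hk
    rw [h5 k hk, ofFn_getD _ ⟨k, hk⟩]
  · simp [IExp.size]
    nlinarith

end

/-! ### Linear optimization by a perceptron-like method -/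

section
variable {n : ℕ}

lemma listVec_ofFn (v : Fin n → ℝ) : listVec (List.ofFn v) = v := by
  funext e; simp [listVec]

/-- The direction in which the perceptron corrects the point `v`. -/
def cutDir (O : OracleName → List ℝ → List ℝ) (w p flag v : Fin n → ℝ) : Fin n → ℝ := fun e =>
  if 0 < (O .sepOut (List.ofFn v)).length then listVec (O .sepOut (List.ofFn v)) e * flag e
  else if 0 < (O .sepIn (List.ofFn fun e => p e * v e)).length then
    listVec (O .sepIn (List.ofFn fun e => p e * v e)) e * (p e * flag e)
  else 0 - w e

/-- The point is accepted by both separation oracles. -/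
def Accepted (O : OracleName → List ℝ → List ℝ) (p v : Fin n → ℝ) : Prop :=
  ¬ 0 < (O .sepOut (List.ofFn v)).length ∧
    ¬ 0 < (O .sepIn (List.ofFn fun e => p e * v e)).length

/-- One step: update the best accepted point and correct the current point. -/
def perceptronStep (O : OracleName → List ℝ → List ℝ) (w p flag : Fin n → ℝ)
    (x : (Fin n → ℝ) × (Fin n → ℝ)) : (Fin n → ℝ) × (Fin n → ℝ) :=
  (fun e => x.1 e - (∑ a, |cutDir O w p flag x.1 a|) /
      ((2 * ((n : ℝ) * n)) * ∑ a, cutDir O w p flag x.1 a * cutDir O w p flag x.1 a) *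
        cutDir O w p flag x.1 e,
    if Accepted O p x.1 ∧ ∑ e, w e * x.2 e < ∑ e, w e * x.1 e then x.1 else x.2)

def perceptronState (O : OracleName → List ℝ → List ℝ) (w p flag : Fin n → ℝ) (k : ℕ) :
    (Fin n → ℝ) × (Fin n → ℝ) :=
  (perceptronStep O w p flag)^[k] (fun _ => 0, fun _ => 0)

/-- The point found by the perceptron. -/
def perceptronBest (O : OracleName → List ℝ → List ℝ) (w p flag : Fin n → ℝ) : Fin n → ℝ :=
  (perceptronState O w p flag (n ^ 6)).2

/-- A convex combination of unit vectors in which the origin, the case `none`, takes the missing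
weight. -/
lemma mem_of_simplex {P : Set (Fin n → ℝ)} (hP : Convex ℝ P) (h0 : (0 : Fin n → ℝ) ∈ P)
    {c : Fin n → ℝ} (hc : ∀ e, 0 ≤ c e) (hsum : ∑ e, c e ≤ 1)
    (hmem : ∀ e, c e ≠ 0 → charVec {e} ∈ P) : c ∈ P := by
  have : c = ∑ o : Option (Fin n), (o.elim (1 - ∑ e, c e) c) •
      (o.elim 0 fun e => if c e ≠ 0 then charVec {e} else 0 : Fin n → ℝ) := by
    rw [Fintype.sum_option]
    funext a
    simp only [Option.elim, smul_zero, zero_add, Finset.sum_apply, Pi.smul_apply, smul_eq_mul]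
    rw [Finset.sum_eq_single a]
    · by_cases h : c a = 0
      · simp [h]
      · simp [h, charVec]
    · intro b _ hb
      by_cases h : c b = 0
      · simp [h]
      · simp [h, charVec, hb.symm]
    · simp
  rw [this]
  refine hP.sum_mem (fun o _ => ?_) ?_ fun o _ => ?_
  · cases o with
    | none => simpa using hsum
    | some e => exact hc e
  · simp [Fintype.sum_option]
  · cases o with
    | none => exact h0
    | some e =>
      simp only [Option.elim]
      split_ifs with h
      · exact hmem e h
      · exact h0

lemma exists_sign (a : ℝ) : ∃ σ : ℝ, -1 ≤ σ ∧ σ ≤ 1 ∧ a * σ = |a| := by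
  rcases le_total 0 a with h | h
  · exact ⟨1, by norm_num, le_rfl, by rw [abs_of_nonneg h, mul_one]⟩
  · exact ⟨-1, le_rfl, by norm_num, by rw [abs_of_nonpos h]; ring⟩

/-- Correcting `v` along a direction `a` brings it closer to the center of a box that `a` separates
from `v`. -/
lemma sum_sq_correct_le {v z a : Fin n → ℝ} {r : ℝ} (hr : 0 < r)
    (h : ∑ e, a e * z e + r * ∑ e, |a e| ≤ ∑ e, a e * v e) (ha : 0 < ∑ e, a e * a e) :
    ∑ e, (v e - (r * (∑ a', |a a'|) / ∑ a', a a' * a a') * a e - z e) ^ 2 ≤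
      ∑ e, (v e - z e) ^ 2 - r ^ 2 := by
  set A₁ := ∑ e, |a e| with hA₁
  set A₂ := ∑ e, a e * a e with hA₂
  set s := r * A₁ / A₂ with hs
  have hA₁0 : 0 ≤ A₁ := Finset.sum_nonneg fun _ _ => abs_nonneg _
  -- The 2-norm is at most the 1-norm. Therefore the step length, adapted to the margin `r * A₁`,
  -- reduces the squared distance by at least `r ^ 2`, whatever the scale of `a`.
  have hA : A₂ ≤ A₁ * A₁ := by
    rw [hA₂, hA₁, Finset.sum_mul]
    refine Finset.sum_le_sum fun e _ => ?_
    rw [← abs_mul_abs_self]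
    exact mul_le_mul_of_nonneg_left
      (Finset.single_le_sum (f := fun e => |a e|) (fun _ _ => abs_nonneg _) (Finset.mem_univ e))
      (abs_nonneg _)
  have hsA : s * A₂ = r * A₁ := by rw [hs]; field_simp
  have hs0 : 0 ≤ s := div_nonneg (mul_nonneg hr.le hA₁0) ha.le
  have hexp : ∑ e, (v e - s * a e - z e) ^ 2 = ∑ e, (v e - z e) ^ 2 -
      2 * s * (∑ e, a e * v e - ∑ e, a e * z e) + s * (s * A₂) := by
    rw [hA₂, Finset.mul_sum, Finset.mul_sum, ← Finset.sum_sub_distrib, Finset.mul_sum,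
      ← Finset.sum_sub_distrib, ← Finset.sum_add_distrib]
    exact Finset.sum_congr rfl fun e _ => by ring
  rw [hexp, hsA]
  have h1 : 2 * s * (r * A₁) ≤ 2 * s * (∑ e, a e * v e - ∑ e, a e * z e) :=
    mul_le_mul_of_nonneg_left (by linarith) (by linarith)
  have h2 : r ^ 2 ≤ s * (r * A₁) := by
    have : s * (r * A₁) = r ^ 2 * (A₁ * A₁ / A₂) := by rw [hs]; ring
    rw [this]
    have : 1 ≤ A₁ * A₁ / A₂ := by rwa [le_div_iff₀ ha, one_mul]
    nlinarith [sq_nonneg r]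
  linarith

section
variable {O : OracleName → List ℝ → List ℝ} {Pin Pout : Set (Fin n → ℝ)}
  {sepIn sepOut : (Fin n → ℝ) → Option (Fin n → ℝ)} {p flag : Fin n → ℝ}

lemma sepAnswer_length (sep : (Fin n → ℝ) → Option (Fin n → ℝ)) (l : List ℝ) :
    (sepAnswer sep l).length ≤ n := by
  unfold sepAnswer
  split <;> simp

/-- Without elements a separating direction would also be an empty list, hence `0 < n`. -/
lemma sepAnswer_pos_iff (hn : 0 < n) {P : Set (Fin n → ℝ)}
    {sep : (Fin n → ℝ) → Option (Fin n → ℝ)} (h : IsSeparationOracle P sep) (v : Fin n → ℝ) :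
    0 < (sepAnswer sep (List.ofFn v)).length ↔ v ∉ P := by
  unfold sepAnswer
  rw [listVec_ofFn]
  rcases h v with ⟨h1, h2⟩ | ⟨a, h1, h2, -⟩
  · simp [h1, h2]
  · simp [h1, h2, hn]

lemma sepAnswer_separates {P : Set (Fin n → ℝ)}
    {sep : (Fin n → ℝ) → Option (Fin n → ℝ)} (h : IsSeparationOracle P sep) {v : Fin n → ℝ}
    (hv : v ∉ P) {z : Fin n → ℝ} (hz : z ∈ P) :
    ∑ e, listVec (sepAnswer sep (List.ofFn v)) e * z e <
      ∑ e, listVec (sepAnswer sep (List.ofFn v)) e * v e := by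
  unfold sepAnswer
  rw [listVec_ofFn]
  rcases h v with ⟨h1, -⟩ | ⟨a, h1, -, h3⟩
  · exact absurd h1 hv
  · simp only [h1, listVec_ofFn]
    exact h3 z hz

variable (hn : 0 < n) (hOin : O .sepIn = sepAnswer sepIn) (hOout : O .sepOut = sepAnswer sepOut)
  (hsepIn : IsSeparationOracle Pin sepIn) (hsepOut : IsSeparationOracle Pout sepOut)
include hn hOin hOout hsepIn hsepOut

lemma accepted_iff (v : Fin n → ℝ) :
    Accepted O p v ↔ v ∈ Pout ∧ (fun e => p e * v e) ∈ Pin := by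
  rw [Accepted, hOin, hOout, sepAnswer_pos_iff hn hsepIn, sepAnswer_pos_iff hn hsepOut, not_not,
    not_not]

lemma perceptronState_mem (h0in : (0 : Fin n → ℝ) ∈ Pin) (h0out : (0 : Fin n → ℝ) ∈ Pout)
    {w : Fin n → ℝ} (hflag : ∀ e, flag e = 0 ∨ flag e = 1)
    (hw : ∀ e, flag e = 0 → w e = 0) (k : ℕ) :
    ((perceptronState O w p flag k).2 ∈ Pout ∧
      (fun e => p e * (perceptronState O w p flag k).2 e) ∈ Pin) ∧
    (∀ e, flag e = 0 → (perceptronState O w p flag k).1 e = 0) ∧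
    ∀ e, flag e = 0 → (perceptronState O w p flag k).2 e = 0 := by
  induction k with
  | zero =>
    refine ⟨⟨h0out, ?_⟩, fun _ _ => rfl, fun _ _ => rfl⟩
    convert h0in using 1
    funext e
    simp [perceptronState]
  | succ k ih =>
    have e1 : perceptronState O w p flag (k + 1) =
        perceptronStep O w p flag (perceptronState O w p flag k) :=
      Function.iterate_succ_apply' _ _ _
    rw [e1]
    obtain ⟨h1, h2, h3⟩ := ih
    have hdir : ∀ v e, flag e = 0 → cutDir O w p flag v e = 0 := by
      intro v e he
      simp [cutDir, he, hw e he]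
    refine ⟨?_, fun e he => ?_, ?_⟩
    · simp only [perceptronStep]
      split_ifs with h
      · exact (accepted_iff hn hOin hOout hsepIn hsepOut _).1 h.1
      · exact h1
    · simp [perceptronStep, hdir _ e he, h2 e he]
    · simp only [perceptronStep]
      split_ifs
      · exact h2
      · exact h3

omit hn in
-- Each of the three directions prefers `v` strictly to `q`: a cut of `Pout`, a cut of `Pin` pulled
-- back along multiplication by `p`, or the negative objective. Masking by `flag` changes nothing
-- because `v` and `q` vanish where it does.
lemma cutDir_separates (hn : 0 < n) {w : Fin n → ℝ} {v q : Fin n → ℝ}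
    (hv : ∀ e, flag e = 0 → v e = 0) (hq : ∀ e, flag e = 0 → q e = 0)
    (hflag : ∀ e, flag e = 0 ∨ flag e = 1) (hqout : q ∈ Pout) (hqin : (fun e => p e * q e) ∈ Pin)
    (hwq : Accepted O p v → ∑ e, w e * v e < ∑ e, w e * q e) :
    ∑ e, cutDir O w p flag v e * q e < ∑ e, cutDir O w p flag v e * v e := by
  have hfl : ∀ x : Fin n → ℝ, (∀ e, flag e = 0 → x e = 0) → ∀ e, flag e * x e = x e := by
    intro x hx e
    rcases hflag e with h | h
    · rw [h, hx e h, zero_mul]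
    · rw [h, one_mul]
  unfold cutDir
  simp only [hOin, hOout]
  by_cases h1 : 0 < (sepAnswer sepOut (List.ofFn v)).length
  · have := sepAnswer_separates hsepOut ((sepAnswer_pos_iff hn hsepOut v).1 h1) hqout
    simp only [h1, if_true]
    simpa only [mul_assoc, hfl _ hv, hfl _ hq] using this
  · by_cases h2 : 0 < (sepAnswer sepIn (List.ofFn fun e => p e * v e)).length
    · have := sepAnswer_separates hsepIn ((sepAnswer_pos_iff hn hsepIn _).1 h2) hqin
      simp only [h1, h2, if_true, if_false]
      simpa only [mul_assoc, hfl _ hv, hfl _ hq] using this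
    · have hacc : Accepted O p v := by
        rw [Accepted, hOin, hOout]
        exact ⟨h1, h2⟩
      have := hwq hacc
      simp only [h1, h2, if_false, zero_sub, neg_mul, Finset.sum_neg_distrib]
      linarith

/-- The perceptron solves the linear optimization problem up to a factor of `1 - 1 / n`. -/
theorem perceptronBest_ge (hn5 : 5 ≤ n) (hPin : Convex ℝ Pin) (hPout : Convex ℝ Pout)
    (h0in : (0 : Fin n → ℝ) ∈ Pin) (h0out : (0 : Fin n → ℝ) ∈ Pout)
    (hcube : ∀ x ∈ Pout, ∀ e, 0 ≤ x e ∧ x e ≤ 1) (hp : ∀ e, 0 ≤ p e ∧ p e ≤ 1)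
    (hflag : ∀ e, flag e = 0 ∨ flag e = 1)
    (hunit : ∀ e, flag e ≠ 0 → charVec {e} ∈ Pin ∧ charVec {e} ∈ Pout)
    {w : Fin n → ℝ} (hw0 : ∀ e, 0 ≤ w e) (hw : ∀ e, flag e = 0 → w e = 0) {z : Fin n → ℝ}
    (hzout : z ∈ Pout) (hzin : (fun e => p e * z e) ∈ Pin) (hz : ∀ e, flag e = 0 → z e = 0) :
    (1 - 1 / (n : ℝ)) * ∑ e, w e * z e ≤ ∑ e, w e * perceptronBest O w p flag e := by
  have hn5' : (5 : ℝ) ≤ n := by exact_mod_cast hn5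
  have hn0 : (0 : ℝ) < n := by linarith
  set θ := (1 - 1 / (n : ℝ)) * ∑ e, w e * z e with hθ
  set r : ℝ := 1 / (2 * ((n : ℝ) * n)) with hr
  have hr0 : 0 < r := by positivity
  have hinv0 : 0 ≤ 1 / (n : ℝ) := by positivity
  have hinv1 : 1 / (n : ℝ) ≤ 1 := by rw [div_le_one hn0]; linarith
  have hrn : r = 1 / n * (1 / (2 * n)) := by rw [hr]; field_simp
  -- Points of a box of half-width `r` in the marked coordinates. It is obtained by shrinking `z` by
  -- the factor `1 - 1 / n` and spending the room gained on the marked unit vectors.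
  set box : (Fin n → ℝ) → Fin n → ℝ := fun σ e =>
    (1 - 1 / (n : ℝ)) * z e + r * (flag e * (1 + σ e)) with hbox
  have hflag0 : ∀ e, 0 ≤ flag e ∧ flag e ≤ 1 := fun e => by
    rcases hflag e with h | h <;> rw [h] <;> norm_num
  have hboxsupp : ∀ σ e, flag e = 0 → box σ e = 0 := by
    intro σ e he
    simp [hbox, he, hz e he]
  have hmem : ∀ σ : Fin n → ℝ, (∀ e, -1 ≤ σ e ∧ σ e ≤ 1) → box σ ∈ Pout ∧
      (fun e => p e * box σ e) ∈ Pin ∧ θ ≤ ∑ e, w e * box σ e := by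
    intro σ hσ
    -- Each entry lies between `0` and `1 / n`, so `c` lies in the simplex of the origin and the
    -- marked unit vectors, and `box σ` is a convex combination of `z` and `c`. This forces `r = 1 /
    -- (2 * n ^ 2)`.
    set c : Fin n → ℝ := fun e => 1 / (2 * n) * (flag e * (1 + σ e)) with hc
    have hc0 : ∀ e, 0 ≤ c e := fun e =>
      mul_nonneg (by positivity) (mul_nonneg (hflag0 e).1 (by linarith [(hσ e).1]))
    have hc1 : ∀ e, c e ≤ 1 / n := by
      intro e
      have h1 : flag e * (1 + σ e) ≤ 2 := by nlinarith [hflag0 e, hσ e]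
      calc c e ≤ 1 / (2 * n) * 2 := mul_le_mul_of_nonneg_left h1 (by positivity)
        _ = 1 / n := by field_simp
    have hcsum : ∑ e, c e ≤ 1 := by
      calc ∑ e, c e ≤ ∑ _e : Fin n, 1 / (n : ℝ) := Finset.sum_le_sum fun e _ => hc1 e
        _ = 1 := by simp; field_simp
    have hcflag : ∀ e, c e ≠ 0 → flag e ≠ 0 := fun e h h' => h (by simp [hc, h'])
    have hcout : c ∈ Pout :=
      mem_of_simplex hPout h0out hc0 hcsum fun e h => (hunit e (hcflag e h)).2
    have hcin : (fun e => p e * c e) ∈ Pin := by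
      refine mem_of_simplex hPin h0in (fun e => mul_nonneg (hp e).1 (hc0 e)) ?_ fun e h =>
        (hunit e (hcflag e (right_ne_zero_of_mul h))).1
      exact (Finset.sum_le_sum fun e _ => by nlinarith [hp e, hc0 e]).trans hcsum
    have hboxc : box σ = (1 - 1 / (n : ℝ)) • z + (1 / (n : ℝ)) • c := by
      funext e
      simp only [hbox, hc, hrn, Pi.add_apply, Pi.smul_apply, smul_eq_mul]
      ring
    refine ⟨?_, ?_, ?_⟩
    · rw [hboxc]
      exact hPout hzout hcout (by linarith) hinv0 (by ring)
    · have := hPin hzin hcin (by linarith) hinv0 (sub_add_cancel 1 (1 / (n : ℝ)))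
      convert this using 1
      funext e
      rw [hboxc]
      simp only [Pi.add_apply, Pi.smul_apply, smul_eq_mul]
      ring
    · rw [hθ, Finset.mul_sum]
      refine Finset.sum_le_sum fun e _ => ?_
      rw [hboxc]
      simp only [Pi.add_apply, Pi.smul_apply, smul_eq_mul]
      nlinarith [mul_nonneg (hw0 e) (mul_nonneg hinv0 (hc0 e))]
  by_contra! hcon
  set z₀ := box 0 with hz₀
  have hz₀mem := hmem 0 fun e => by norm_num
  -- As long as the best value is below `θ`, every point of the box is strictly separated from the
  -- current point, and each round brings the latter closer to the center `z₀`.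
  have key : ∀ k, ∑ e, w e * (perceptronState O w p flag k).2 e < θ →
      ∑ e, ((perceptronState O w p flag k).1 e - z₀ e) ^ 2 ≤ n - k * r ^ 2 := by
    intro k
    induction k with
    | zero =>
      intro _
      simp only [perceptronState, Function.iterate_zero, id, Nat.cast_zero, zero_mul, sub_zero,
        zero_sub, neg_sq]
      calc ∑ e, z₀ e ^ 2 ≤ ∑ _e : Fin n, (1 : ℝ) := Finset.sum_le_sum fun e _ => by
            have := hcube z₀ hz₀mem.1 e
            nlinarith
        _ = n := by simp
    | succ k ih =>
      have e1 : perceptronState O w p flag (k + 1) =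
          perceptronStep O w p flag (perceptronState O w p flag k) :=
        Function.iterate_succ_apply' _ _ _
      obtain ⟨-, hv, -⟩ := perceptronState_mem hn hOin hOout hsepIn hsepOut (p := p) h0in h0out
        hflag hw k
      rw [e1]
      generalize perceptronState O w p flag k = x at *
      intro hlt
      have hbest : ∑ e, w e * x.2 e ≤ ∑ e, w e * (perceptronStep O w p flag x).2 e := by
        simp only [perceptronStep]
        split_ifs with h
        · exact h.2.le
        · exact le_rfl
      -- An accepted current point with value at least `θ` would have raised the best value to `θ`
      -- in this very round.
      have hcur : Accepted O p x.1 → ∑ e, w e * x.1 e < θ := by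
        intro hacc
        refine lt_of_le_of_lt ?_ hlt
        simp only [perceptronStep]
        split_ifs with h
        · exact le_rfl
        · simpa [hacc] using h
      have ih := ih (hbest.trans_lt hlt)
      set a := cutDir O w p flag x.1 with ha
      have hsep : ∀ σ : Fin n → ℝ, (∀ e, -1 ≤ σ e ∧ σ e ≤ 1) →
          ∑ e, a e * box σ e < ∑ e, a e * x.1 e := by
        intro σ hσ
        obtain ⟨h1, h2, h3⟩ := hmem σ hσ
        exact cutDir_separates hOin hOout hsepIn hsepOut hn hv (hboxsupp σ) hflag h1 h2
          fun hacc => (hcur hacc).trans_le h3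
      -- The corner of the box that is extreme in direction `a`: separating it from the current
      -- point gives the margin `r` times the 1-norm of `a` around the center.
      choose σ hσ1 hσ2 hσ3 using fun e => exists_sign (a e)
      have h1 := hsep σ fun e => ⟨hσ1 e, hσ2 e⟩
      have haflag : ∀ e, a e * flag e = a e := by
        intro e
        rcases hflag e with h | h
        · have : a e = 0 := by simp [ha, cutDir, h, hw e h]
          rw [this, zero_mul]
        · rw [h, mul_one]
      have h2 : ∑ e, a e * z₀ e + r * ∑ e, |a e| = ∑ e, a e * box σ e := by
        rw [Finset.mul_sum, ← Finset.sum_add_distrib]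
        refine Finset.sum_congr rfl fun e _ => ?_
        have h4 : a e * (flag e * σ e) = |a e| := by rw [← mul_assoc, haflag, hσ3]
        simp only [hz₀, hbox, Pi.zero_apply]
        rw [← h4]
        ring
      have hpos : 0 < ∑ e, a e * a e := by
        rcases (Finset.sum_nonneg fun e (_ : e ∈ Finset.univ) => mul_self_nonneg (a e)).eq_or_lt
          with h | h
        · exfalso
          have h0 : ∀ e, a e = 0 := fun e => mul_self_eq_zero.1
            ((Finset.sum_eq_zero_iff_of_nonneg fun e _ => mul_self_nonneg (a e)).1 h.symm e
              (Finset.mem_univ e))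
          have := hsep 0 fun e => by norm_num
          simp [h0] at this
        · exact h
      have h3 := sum_sq_correct_le (v := x.1) (z := z₀) hr0 (by rw [h2]; exact h1.le) hpos
      have h5 : ∀ e, (perceptronStep O w p flag x).1 e =
          x.1 e - (r * (∑ a', |a a'|) / ∑ a', a a' * a a') * a e := by
        intro e
        simp only [perceptronStep, ← ha, hr]
        congr 2
        field_simp
      simp only [h5]
      refine h3.trans ?_
      push_cast
      linarith
  have h1 := key (n ^ 6) hcon
  have h2 : (0 : ℝ) ≤ ∑ e, ((perceptronState O w p flag (n ^ 6)).1 e - z₀ e) ^ 2 :=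
    Finset.sum_nonneg fun e _ => sq_nonneg _
  -- The total decrease exceeds the initial bound `n` on the squared distance once `n > 4`, hence
  -- the assumption `5 ≤ n`.
  have h3 : ((n ^ 6 : ℕ) : ℝ) * r ^ 2 = n ^ 2 / 4 := by
    rw [hr]; push_cast; field_simp; norm_num
  rw [h3] at h1
  nlinarith

end

end

/-! ### The program of the perceptron -/

section
variable {κ : Type} {O : κ → List ℝ → List ℝ} {n : ℕ}

/-- The absolute values of the entries of the second list. -/
def Cmd.absEntries : Cmd κ :=
  .loop (.var 0) (.seq (.ifLt (.get 1 (.var 9)) (.ofIdx (.lit 0))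
    (.setReal 0 (.var 9) (.sub (.ofIdx (.lit 0)) (.get 1 (.var 9))))
    (.setReal 0 (.var 9) (.get 1 (.var 9)))) (.incr 9))

lemma computes_absEntries (a : Fin n → ℝ) :
    Computes O Cmd.absEntries [List.ofFn a, List.ofFn a] (List.ofFn fun e => |a e|)
      (n * 20 + 2) := by
  have := Runs.loop' (O := O) (s := Store.ofLists [List.ofFn a, List.ofFn a]) (i := .var 0) (m := n)
    (by simp [IExp.eval])
    (c := .seq (.ifLt (.get 1 (.var 9)) (.ofIdx (.lit 0))
    (.setReal 0 (.var 9) (.sub (.ofIdx (.lit 0)) (.get 1 (.var 9))))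
    (.setReal 0 (.var 9) (.get 1 (.var 9)))) (.incr 9)) (t := 19)
    (fun k s => s.idx 9 = k ∧ s.idx 0 = n ∧ (∀ j : Fin n, s.arr 1 j = a j) ∧
      ∀ j : Fin n, (j : ℕ) < k → s.arr 0 j = |a j|)
    ⟨rfl, by simp, by simp, by simp⟩ (by
      rintro k hk s ⟨h1, h2, h3, h4⟩
      have hstep : ∀ z, z = |a ⟨k, hk⟩| → ∀ j : Fin n, (j : ℕ) < k + 1 →
          (s.setEntry 0 (s.idx 9) z).arr 0 j = |a j| := by
        intro z hz j hj
        simp only [Store.setEntry_arr, h1, true_and]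
        split_ifs with h
        · rw [hz]; congr 2; exact Fin.ext h.symm
        · exact h4 j (by omega)
      have h3k := h3 ⟨k, hk⟩
      simp only at h3k
      refine ((Runs.ifLt (t := 7) (Q := fun s => s.idx 9 = k ∧ s.idx 0 = n ∧
        (∀ j : Fin n, s.arr 1 j = a j) ∧ ∀ j : Fin n, (j : ℕ) < k + 1 → s.arr 0 j = |a j|)
        (fun h => ?_) fun h => ?_).seq (t₂ := 4) fun s' hs' => Runs.incr ?_).mono (fun _ => id)
          (by simp [IExp.size, RExp.size])
      · simp only [RExp.eval, IExp.eval, h1, h3k, Nat.cast_zero] at h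
        refine (Runs.setReal ⟨by simp [h1], by simp [h2], by simpa using h3, hstep _ ?_⟩).mono
          (fun _ => id) (by simp [IExp.size, RExp.size])
        simp [RExp.eval, IExp.eval, h1, h3k, abs_of_neg h]
      · simp only [RExp.eval, IExp.eval, h1, h3k, Nat.cast_zero] at h
        refine (Runs.setReal ⟨by simp [h1], by simp [h2], by simpa using h3, hstep _ ?_⟩).mono
          (fun _ => id) (by simp [IExp.size, RExp.size])
        simp [RExp.eval, IExp.eval, h1, h3k, abs_of_nonneg (not_lt.1 h)]
      · obtain ⟨g1, g2, g3, g4⟩ := hs'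
        exact ⟨by simp [g1], by simp [g2], g3, g4⟩)
  refine this.mono (fun s hs => ?_) (by simp [IExp.size]; omega)
  refine Store.block_eq (by rw [hs.2.1]; simp) fun k hk => ?_
  rw [List.length_ofFn] at hk
  rw [hs.2.2.2 ⟨k, hk⟩ hk]
  simp [hk]

end

section
variable {O : OracleName → List ℝ → List ℝ} {n : ℕ}

/-- Keep the point in the variable `3` as the best one if it has a larger objective. -/
def Cmd.keepBest : Cmd OracleName :=
  .seq (.call (.sumEntries (.mul (.get 1 (.var 9)) (.get 2 (.var 9)))) [3, 0, 4] 9)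
  (.seq (.call (.sumEntries (.mul (.get 1 (.var 9)) (.get 2 (.var 9)))) [3, 0, 3] 10)
  (.ifLt (.get 9 (.lit 0)) (.get 10 (.lit 0)) (.call (.mapEntries (.get 1 (.var 9))) [3, 3] 4)
    .skip))

/-- Compute the direction of the correction and update the best point. -/
def Cmd.cut : Cmd OracleName :=
  .seq (.call (.mapEntries (.mul (.get 1 (.var 9)) (.get 2 (.var 9)))) [3, 1, 3] 5)
  (.seq (.query .sepOut 3 6)
  (.seq (.query .sepIn 5 7)
  (.ifLt (.ofIdx (.lit 0)) (.ofIdx (.var 6))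
    (.call (.mapEntries (.mul (.get 1 (.var 9)) (.get 2 (.var 9)))) [3, 6, 2] 8)
    (.ifLt (.ofIdx (.lit 0)) (.ofIdx (.var 7))
      (.call (.mapEntries (.mul (.get 1 (.var 9)) (.mul (.get 2 (.var 9)) (.get 3 (.var 9)))))
        [3, 7, 1, 2] 8)
      (.seq (.call (.mapEntries (.sub (.ofIdx (.lit 0)) (.get 1 (.var 9)))) [3, 0] 8)
        .keepBest)))))

/-- Correct the point. -/
def Cmd.correct : Cmd OracleName :=
  .seq (.call .absEntries [8, 8] 11)
  (.seq (.call (.sumEntries (.get 1 (.var 9))) [3, 11] 12)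
  (.seq (.call (.sumEntries (.mul (.get 1 (.var 9)) (.get 1 (.var 9)))) [3, 8] 13)
  (.call (.mapEntries (.sub (.get 1 (.var 9)) (.mul (.div (.get 3 (.lit 0))
    (.mul (.mul (.ofIdx (.lit 2)) (.mul (.ofIdx (.var 0)) (.ofIdx (.var 0)))) (.get 4 (.lit 0))))
      (.get 2 (.var 9))))) [3, 3, 8, 12, 13] 3)))

/-- Approximate linear optimization, given the objective, the activity probabilities and the marks
of the elements that may be used. -/
def Cmd.perceptron : Cmd OracleName :=
  .seq (.call (.mapEntries (.ofIdx (.lit 0))) [0] 3)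
  (.seq (.call (.mapEntries (.ofIdx (.lit 0))) [0] 4)
  (.seq (.loopPow (.var 0) (.seq .cut .correct) 6)
    (.call (.mapEntries (.get 1 (.var 9))) [4, 4] 0)))

/-- The content of the memory during the perceptron algorithm. -/
structure PerceptronMem (w p flag v best : Fin n → ℝ) (s : Store) : Prop where
  b0 : s.block 0 = List.ofFn w
  b1 : s.block 1 = List.ofFn p
  b2 : s.block 2 = List.ofFn flag
  b3 : s.block 3 = List.ofFn v
  b4 : s.block 4 = List.ofFn best

variable {w p flag v best : Fin n → ℝ} {s : Store}

lemma runs_keepBest (h : PerceptronMem w p flag v best s) :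
    Runs O .keepBest s (fun s' => s'.block 8 = s.block 8 ∧ PerceptronMem w p flag v
      (if ∑ e, w e * best e < ∑ e, w e * v e then v else best) s') (n * 60 + 60) := by
  obtain ⟨b0, b1, b2, b3, b4⟩ := h
  refine (Runs.call_seq (out := [∑ e, w e * best e]) (t' := n * 15 + 8) ?_
    (Runs.call_seq (out := [∑ e, w e * v e]) (t' := n * 15 + 8) ?_
    (Runs.ifLt (t := n * 20 + 10) (fun h => ?_) (fun h => ?_)))).mono (fun _ => id) ?_
  · simp only [List.map_cons, List.map_nil, b0, b3, b4]
    refine computes_sumEntries (by simp) (by simp) _ fun k s h9 hF => ?_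
    simp [RExp.eval, IExp.eval, h9, hF.arr]
  · simp only [List.map_cons, List.map_nil, Store.setBlock_block, b0, b3]
    refine computes_sumEntries (by simp) (by simp) _ fun k s h9 hF => ?_
    simp [RExp.eval, IExp.eval, h9, hF.arr]
  · simp [RExp.eval, IExp.eval] at h
    rw [if_pos h]
    refine (Runs.call (out := List.ofFn v) (t := n * 9 + 2) ?_ ?_).mono (fun _ => id) ?_
    · simp only [List.map_cons, List.map_nil, Store.setBlock_block, b3]
      refine computes_mapEntries (by simp) (by simp) _ fun k s h9 hF => ?_
      simp [RExp.eval, IExp.eval, h9, hF.arr]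
    · exact ⟨by simp, by simp [b0], by simp [b1], by simp [b2], by simp [b3], by simp⟩
    · simp [b3]; omega
  · simp [RExp.eval, IExp.eval] at h
    rw [if_neg (not_lt.2 h)]
    exact (Runs.skip ⟨by simp, by simp [b0], by simp [b1], by simp [b2], by simp [b3],
      by simp [b4]⟩).mono (fun _ => id) (by omega)
  · simp [b0, b3, b4, RExp.size, IExp.size]; omega

lemma runs_cut (hin : ∀ l, (O .sepIn l).length ≤ n) (hout : ∀ l, (O .sepOut l).length ≤ n)
    (h : PerceptronMem w p flag v best s) :
    Runs O .cut s (fun s' => s'.block 8 = List.ofFn (cutDir O w p flag v) ∧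
      PerceptronMem w p flag v (perceptronStep O w p flag (v, best)).2 s') (n * 120 + 150) := by
  obtain ⟨b0, b1, b2, b3, b4⟩ := h
  have i3 : s.idx 3 = n := by rw [← s.block_length, b3]; simp
  have hq1 := hout (List.ofFn v)
  have hq2 := hin (List.ofFn fun e => p e * v e)
  refine (Runs.call_seq (out := List.ofFn fun e => p e * v e) (t' := n * 12 + 2) ?_
    (Runs.query_seq (Runs.query_seq
    (Runs.ifLt (t := n * 90 + 90) (fun h => ?_) (fun h => ?_))))).mono (fun _ => id) ?_
  · simp only [List.map_cons, List.map_nil, b1, b3]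
    refine computes_mapEntries (by simp) (by simp) _ fun k s h9 hF => ?_
    simp [RExp.eval, IExp.eval, h9, hF.arr]
  · have hc : cutDir O w p flag v = fun e => listVec (O .sepOut (List.ofFn v)) e * flag e := by
      simp [RExp.eval, IExp.eval, b3] at h
      funext e
      simp [cutDir, h]
    have hb : (perceptronStep O w p flag (v, best)).2 = best := by
      simp [RExp.eval, IExp.eval, b3] at h
      simp [perceptronStep, Accepted, h]
    rw [hc, hb]
    refine (Runs.call (out := List.ofFn fun e => listVec (O .sepOut (List.ofFn v)) e * flag e)
      (t := n * 12 + 2) ?_ ⟨by simp, by simp [b0], by simp [b1], by simp [b2], by simp [b3], by simp [b4]⟩).mono (fun _ => id) ?_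
    · simp only [List.map_cons, List.map_nil]
      refine computes_mapEntries (by simp [b3]) (by simp) _ fun k s h9 hF => ?_
      simp [RExp.eval, IExp.eval, h9, hF.arr, b2, b3, listVec]
    · simp [b3, b2]; omega
  · refine (Runs.ifLt (t := n * 90 + 80) (fun h' => ?_) (fun h' => ?_)).mono (fun _ => id)
      (by simp [RExp.size, IExp.size]; omega)
    · simp [RExp.eval, IExp.eval, b3] at h
      simp [RExp.eval, IExp.eval, b3] at h'
      have hc : cutDir O w p flag v = fun e =>
          listVec (O .sepIn (List.ofFn fun e => p e * v e)) e * (p e * flag e) := by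
        funext e
        simp [cutDir, h, h']
      have hb : (perceptronStep O w p flag (v, best)).2 = best := by
        simp [perceptronStep, Accepted, h, h']
      rw [hc, hb]
      refine (Runs.call (out := List.ofFn fun e =>
          listVec (O .sepIn (List.ofFn fun e => p e * v e)) e * (p e * flag e))
        (t := n * 15 + 2) ?_ ⟨by simp, by simp [b0], by simp [b1], by simp [b2], by simp [b3], by simp [b4]⟩).mono (fun _ => id) ?_
      · simp only [List.map_cons, List.map_nil]
        refine computes_mapEntries (by simp [b3]) (by simp) _ fun k s h9 hF => ?_
        simp [RExp.eval, IExp.eval, h9, hF.arr, b1, b2, b3, listVec]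
      · simp [b3, b2, b1]; omega
    · simp [RExp.eval, IExp.eval, b3] at h
      simp [RExp.eval, IExp.eval, b3] at h'
      have hc : cutDir O w p flag v = fun e => 0 - w e := by
        funext e
        simp [cutDir, h, h']
      have hb : (perceptronStep O w p flag (v, best)).2 =
          if ∑ e, w e * best e < ∑ e, w e * v e then v else best := by
        simp [perceptronStep, Accepted, h, h']
      rw [hc, hb]
      refine (Runs.call_seq (out := List.ofFn fun e => 0 - w e) (t' := n * 12 + 2) ?_
        ((runs_keepBest (w := w) (p := p) (flag := flag) (v := v) (best := best)
          ⟨by simp [b0], by simp [b1], by simp [b2], by simp [b3], by simp [b4]⟩).mono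
          (fun s' hs' => ⟨hs'.1.trans (by simp), hs'.2⟩) le_rfl)).mono (fun _ => id) ?_
      · simp only [List.map_cons, List.map_nil]
        refine computes_mapEntries (by simp [b3]) (by simp) _ fun k s h9 hF => ?_
        simp [RExp.eval, IExp.eval, h9, hF.arr, b0, b3]
      · simp [b3, b0]; omega
  · simp [b3, b1, RExp.size, IExp.size]
    omega

lemma runs_correct {a : Fin n → ℝ} (h8 : s.block 8 = List.ofFn a)
    (h : PerceptronMem w p flag v best s) :
    Runs O .correct s (PerceptronMem w p flag (fun e => v e - (∑ a', |a a'|) /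
      ((2 * ((n : ℝ) * n)) * ∑ a', a a' * a a') * a e) best) (n * 120 + 150) := by
  obtain ⟨b0, b1, b2, b3, b4⟩ := h
  refine (Runs.call_seq (out := List.ofFn fun e => |a e|) (t' := n * 20 + 2) ?_
    (Runs.call_seq (out := [∑ e, |a e|]) (t' := n * 12 + 8) ?_
    (Runs.call_seq (out := [∑ e, a e * a e]) (t' := n * 15 + 8) ?_
    (Runs.call (out := _) (t := n * 30 + 2) ?_ ⟨by simp [b0], by simp [b1], by simp [b2],
      Store.setBlock_block .. |>.trans (if_pos rfl), by simp [b4]⟩)))).mono (fun _ => id) ?_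
  · simp only [List.map_cons, List.map_nil, h8]
    exact computes_absEntries a
  · simp only [List.map_cons, List.map_nil]
    refine computes_sumEntries (by simp [b3]) (by simp) _ fun k s h9 hF => ?_
    simp [RExp.eval, IExp.eval, h9, hF.arr, b3]
  · simp only [List.map_cons, List.map_nil]
    refine computes_sumEntries (by simp [b3]) (by simp) _ fun k s h9 hF => ?_
    simp [RExp.eval, IExp.eval, h9, hF.arr, b3, h8]
  · simp only [List.map_cons, List.map_nil]
    refine (computes_mapEntries (by simp [b3]) (by simp) _ fun k s h9 hF => ?_).mono (fun _ => id) (by simp [RExp.size, IExp.size]; omega)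
    simp [RExp.eval, IExp.eval, h9, hF.arr, hF.idx, b3, h8]
  · simp [b3, h8]; omega

/-- Running time of the perceptron. -/
def perceptronTime (n : ℕ) : ℕ := loopPowTime 1 n (n * 240 + 300) 6 + n * 60 + 60

lemma computes_perceptron (hin : ∀ l, (O .sepIn l).length ≤ n)
    (hout : ∀ l, (O .sepOut l).length ≤ n) :
    Computes O .perceptron [List.ofFn w, List.ofFn p, List.ofFn flag]
      (List.ofFn (perceptronBest O w p flag)) (perceptronTime n) := by
  refine (Runs.call_seq (out := List.ofFn fun _ : Fin n => 0) (t' := n * 9 + 2) ?_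
    (Runs.call_seq (out := List.ofFn fun _ : Fin n => 0) (t' := n * 9 + 2) ?_
    -- Six nested loops of `n` rounds carry out the `n ^ 6` rounds required by the analysis.
    ((Runs.loopPow (m := n) (t := n * 240 + 300) (fun j s => PerceptronMem w p flag
      (perceptronState O w p flag j).1 (perceptronState O w p flag j).2 s) ?_ ?_ 6 0 _ ?_).seq
      (t₂ := n * 20 + 10) fun s hs => (Runs.call (out := List.ofFn (perceptronBest O w p flag))
      (t := n * 9 + 2) ?_ ?_).mono (fun _ => id) ?_))).mono (fun _ => id) ?_
  · refine computes_mapEntries (by simp) (by simp) _ fun k s h9 hF => ?_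
    simp [RExp.eval, IExp.eval]
  · refine computes_mapEntries (by simp) (by simp) _ fun k s h9 hF => ?_
    simp [RExp.eval, IExp.eval]
  · intro j s hs
    simp [IExp.eval, ← s.block_length, hs.b0]
  · intro j s hs
    refine ((runs_cut hin hout hs).seq fun s' hs' => (runs_correct hs'.1 hs'.2)).mono
      (fun s'' hs'' => ?_) (by omega)
    have e1 : perceptronState O w p flag (j + 1) =
        perceptronStep O w p flag (perceptronState O w p flag j) :=
      Function.iterate_succ_apply' _ _ _
    rw [e1]
    exact hs''
  · exact ⟨by simp, by simp, by simp, by simp [perceptronState], by simp [perceptronState]⟩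
  · simp only [List.map_cons, List.map_nil, hs.b4]
    refine computes_mapEntries (by simp) (by simp) _ fun k s h9 hF => ?_
    rw [zero_add] at hF
    simp [RExp.eval, IExp.eval, h9, hF.arr, perceptronBest]
  · simp
  · simp [hs.b4]; omega
  · simp [perceptronTime, IExp.size]
    omega

end

/-! ### The preparation -/

section
variable {κ : Type} {O : κ → List ℝ → List ℝ} {c d : Cmd κ} {s : Store} {t t' : ℕ}

/-- Started with the memory `s`, the program outputs a list with law `μ`, in at most `t` steps. -/
structure Outputs (O : κ → List ℝ → List ℝ) (c : Cmd κ) (s : Store) (μ : PMF (List ℝ)) (t : ℕ) :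
    Prop where
  law : (c.exec (M := PMF) biasedCoin O s).map (fun r => r.1.block 0) = μ
  time : ∀ r ∈ (c.exec (M := PMF) biasedCoin O s).support, r.2 ≤ t

lemma Outputs.computesP {L : List (List ℝ)} {μ ν : PMF (List ℝ)}
    (h : Outputs O c (Store.ofLists L) μ t) (hμ : μ = ν) (ht : t ≤ t') : ComputesP O c L ν t' :=
  ⟨h.law.trans hμ, fun r hr => (h.time r hr).trans ht⟩

lemma Outputs.mono {μ : PMF (List ℝ)} (h : Outputs O c s μ t) (ht : t ≤ t') : Outputs O c s μ t' :=
  ⟨h.law, fun r hr => (h.time r hr).trans ht⟩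

/-- Only the output law of the last program is needed, so the rest of the final memory is never
described. -/
lemma Outputs.seq {α : Type} {ρ : PMF α} {enc : α → Store} {ν : α → PMF (List ℝ)}
    (h : RunsP O c s (ρ.map enc) t) (h' : ∀ a ∈ ρ.support, Outputs O d (enc a) (ν a) t') :
    Outputs O (.seq c d) s (ρ.bind ν) (t + t') := by
  set ν' : Store → PMF Store := fun s' => (d.exec (M := PMF) biasedCoin O s').map Prod.fst with hν'
  have := h.seq (d := d) (ν := ν') (t₂ := t') (by
    intro s' hs'
    rw [PMF.mem_support_map_iff] at hs'
    obtain ⟨a, ha, rfl⟩ := hs'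
    exact ⟨rfl, (h' a ha).time⟩)
  refine ⟨?_, this.time⟩
  have e : (fun r : Store × ℕ => r.1.block 0) = (fun s : Store => s.block 0) ∘ Prod.fst := rfl
  rw [e, ← PMF.map_comp, this.law, PMF.map_bind, PMF.bind_map]
  refine PMF.bind_congr_support fun a ha => ?_
  rw [← (h' a ha).law, e, ← PMF.map_comp]
  rfl

lemma Outputs.call {args : List ℕ} {m : ℕ} {μ : PMF (List ℝ)}
    (h : ComputesP O c (args.map s.block) μ t) (hm : ∀ l ∈ μ.support, l.length ≤ m) :
    Outputs O (.call c args 0) s μ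
      (((args.map s.block).map List.length).sum + args.length + t + m + 1) := by
  have := RunsP.call (dst := 0) h hm
  refine ⟨?_, this.time⟩
  have e : (fun r : Store × ℕ => r.1.block 0) = (fun s : Store => s.block 0) ∘ Prod.fst := rfl
  rw [e, ← PMF.map_comp, this.law, PMF.map_comp]
  have : (fun s : Store => s.block 0) ∘ s.setBlock 0 = id := by
    funext l; simp
  rw [this, PMF.map_id]

lemma Outputs.call_seq {args : List ℕ} {dst m : ℕ} {μ : PMF (List ℝ)} {ν : List ℝ → PMF (List ℝ)}
    (h : ComputesP O c (args.map s.block) μ t) (hm : ∀ l ∈ μ.support, l.length ≤ m)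
    (h' : ∀ l ∈ μ.support, Outputs O d (s.setBlock dst l) (ν l) t') :
    Outputs O (.seq (.call c args dst) d) s (μ.bind ν)
      (((args.map s.block).map List.length).sum + args.length + t + m + 1 + t') :=
  Outputs.seq (RunsP.call h hm) h'

lemma Outputs.det_seq {args : List ℕ} {dst : ℕ} {out : List ℝ} {ν : PMF (List ℝ)}
    (hc : c.NoCoin) (h : Computes O c (args.map s.block) out t)
    (h' : Outputs O d (s.setBlock dst out) ν t') :
    Outputs O (.seq (.call c args dst) d) s ν
      (((args.map s.block).map List.length).sum + args.length + t + out.length + 1 + t') := by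
  have := Outputs.call_seq (d := d) (dst := dst) (m := out.length) (ν := fun _ => ν) (t' := t')
    (ComputesP.of_computes hc h) (fun l hl => by rw [PMF.mem_support_pure_iff] at hl; rw [hl])
    (fun l hl => by rw [PMF.mem_support_pure_iff] at hl; rwa [hl])
  rwa [PMF.pure_bind] at this

lemma Outputs.det {args : List ℕ} {out : List ℝ}
    (hc : c.NoCoin) (h : Computes O c (args.map s.block) out t) :
    Outputs O (.call c args 0) s (PMF.pure out)
      (((args.map s.block).map List.length).sum + args.length + t + out.length + 1) :=
  Outputs.call (ComputesP.of_computes hc h)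
    (fun l hl => by rw [PMF.mem_support_pure_iff] at hl; rw [hl])

lemma Cmd.noCoin_mapEntries (r : RExp) : (Cmd.mapEntries r : Cmd κ).NoCoin := ⟨trivial, trivial⟩

lemma Cmd.noCoin_pair : (Cmd.pair : Cmd κ).NoCoin := by
  simp [Cmd.pair, Cmd.NoCoin, Cmd.append, Cmd.incr]

lemma Cmd.NoCoin.loopPow {i : IExp} (hc : c.NoCoin) (k : ℕ) : (c.loopPow i k).NoCoin := by
  induction k with
  | zero => exact hc
  | succ k ih => exact ih

end

section
variable {O : OracleName → List ℝ → List ℝ} {n : ℕ} {f : Finset (Fin n) → ℝ} {t : ℕ}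

/-- Add the marginal values with respect to a random set. -/
def sampleKernel (f : Finset (Fin n) → ℝ) (x v : Fin n → ℝ) : PMF (Fin n → ℝ) :=
  (prodPMF x).map fun R e => v e + (f (insert e R) - f R)

def Cmd.sampleStep : Cmd OracleName :=
  .seq (.call .coins [1, 1] 2) (.call .addMarginals [0, 2] 0)

def sampleStepTime (n : ℕ) : ℕ := n * n + n * 60 + 20

lemma computesP_sampleStep (hO : ∀ l, O .objective l = [f (listSet l)]) (x v : Fin n → ℝ) :
    ComputesP O .sampleStep [List.ofFn v, List.ofFn x] ((sampleKernel f x v).map List.ofFn)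
      (sampleStepTime n) := by
  refine (Outputs.call_seq (t := n * 9 + 2) (m := n) (μ := (prodPMF x).map setList)
    (ν := fun l => PMF.pure (List.ofFn fun e => v e + (f (insert e (listSet l)) - f (listSet l))))
    (t' := n * n + n * 40 + 10)
    ?_ ?_ fun l hl => ?_).computesP ?_ ?_
  · simpa using computesP_coins (O := O) x
  · intro l hl
    rw [PMF.mem_support_map_iff] at hl
    obtain ⟨R, -, rfl⟩ := hl
    rw [setList_length]
  · rw [PMF.mem_support_map_iff] at hl
    obtain ⟨R, -, rfl⟩ := hl
    have h := Outputs.det (O := O) (c := .addMarginals) (args := [0, 2])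
      (s := (Store.ofLists [List.ofFn v, List.ofFn x]).setBlock 2 (setList R))
      (by simp [Cmd.addMarginals, Cmd.NoCoin, Cmd.incr])
      (by simpa using computes_addMarginals hO v R)
    rw [listSet_setList]
    refine ⟨h.law, fun r hr => (h.time r hr).trans ?_⟩
    simp [setList_length]
    ring_nf
    omega
  · rw [sampleKernel, PMF.bind_map, PMF.map_comp, PMF.map]
    congr 1
    funext R
    simp [listSet_setList]
  · simp [sampleStepTime]
    omega

/-- The law of an estimate of `n ^ 4` times the expected marginal values. -/
def estimateLaw (f : Finset (Fin n) → ℝ) (x : Fin n → ℝ) : PMF (Fin n → ℝ) :=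
  iterLaw (sampleKernel f x) (n ^ 4) fun _ => 0

def Cmd.estimate : Cmd OracleName :=
  .seq (.call (.mapEntries (.mul (.get 1 (.var 9)) (.get 2 (.var 9)))) [0, 0, 1] 3)
  (.seq (.call (.mapEntries (.ofIdx (.lit 0))) [0] 4)
  (.seq (.loopPow (.var 0) (.call .sampleStep [4, 3] 4) 4)
    (.call (.mapEntries (.mul (.get 1 (.var 9)) (.mul (.get 2 (.var 9)) (.get 3 (.var 9)))))
      [0, 4, 1, 2] 0)))

def estimateTime (n : ℕ) : ℕ :=
  loopPowTime 1 n (2 * n + 2 + sampleStepTime n + n + 1) 4 + n * 60 + 60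

/-- The accumulated sums are not divided by the number `n ^ 4` of samples, because linear
optimization does not depend on the scale of its objective. -/
lemma computesP_estimate (hO : ∀ l, O .objective l = [f (listSet l)]) (y p flag : Fin n → ℝ) :
    ComputesP O .estimate [List.ofFn y, List.ofFn p, List.ofFn flag]
      ((estimateLaw f fun e => y e * p e).map fun acc => List.ofFn fun e => acc e * (p e * flag e))
      (estimateTime n) := by
  set s₂ : Store := ((Store.ofLists [List.ofFn y, List.ofFn p, List.ofFn flag]).setBlock 3
    (List.ofFn fun e => y e * p e)) with hs₂
  have hloop := RunsP.loopPow (O := O) (i := .var 0) (c := .call .sampleStep [4, 3] 4)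
    (enc := fun v : Fin n → ℝ => s₂.setBlock 4 (List.ofFn v)) (m := n)
    (K := sampleKernel f fun e => y e * p e) (t := 2 * n + 2 + sampleStepTime n + n + 1)
    (by intro a; simp [IExp.eval, hs₂]) (by
      intro v
      refine (RunsP.call (m := n) (t := sampleStepTime n)
        (μ := (sampleKernel f (fun e => y e * p e) v).map List.ofFn) ?_ ?_).congr ?_ ?_
      · simpa [hs₂] using computesP_sampleStep hO (fun e => y e * p e) v
      · intro l hl
        rw [PMF.mem_support_map_iff] at hl
        obtain ⟨R, -, rfl⟩ := hl
        simp
      · rw [PMF.map_comp]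
        congr 1
        funext v
        simp
      · simp [hs₂]; omega) 4 (fun _ => 0)
  refine (Outputs.det_seq (out := List.ofFn fun e => y e * p e) (t := n * 12 + 2) (Cmd.noCoin_mapEntries _) ?_
    (Outputs.det_seq (out := List.ofFn fun _ : Fin n => 0) (t := n * 9 + 2) (Cmd.noCoin_mapEntries _) ?_
    (Outputs.seq hloop (t' := n * 25 + 10)
      (ν := fun acc => PMF.pure (List.ofFn fun e => acc e * (p e * flag e)))
      fun acc _ => ?_))).computesP ?_ ?_
  · simp only [List.map_cons, List.map_nil, Store.ofLists_block]
    refine computes_mapEntries (by simp) (by simp) _ fun k s h9 hF => ?_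
    simp [RExp.eval, IExp.eval, h9, hF.arr]
  · refine computes_mapEntries (by simp) (by simp) _ fun k s h9 hF => ?_
    simp [RExp.eval, IExp.eval]
  · have h := Outputs.det (O := O) (s := s₂.setBlock 4 (List.ofFn acc)) (args := [0, 4, 1, 2])
      (out := List.ofFn fun e => acc e * (p e * flag e)) (t := n * 15 + 2)
      (c := .mapEntries (.mul (.get 1 (.var 9)) (.mul (.get 2 (.var 9)) (.get 3 (.var 9)))))
      (Cmd.noCoin_mapEntries _) (by
        simp only [List.map_cons, List.map_nil]
        refine computes_mapEntries (by simp [hs₂]) (by simp) _ fun k s h9 hF => ?_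
        simp [RExp.eval, IExp.eval, h9, hF.arr, hs₂])
    refine ⟨h.law, fun r hr => (h.time r hr).trans ?_⟩
    simp [hs₂]; omega
  · rfl
  · simp [estimateTime, IExp.size]; omega

/-- A step of the greedy method. -/
def greedyKernel (O : OracleName → List ℝ → List ℝ) (f : Finset (Fin n) → ℝ) (b : ℝ)
    (p flag y : Fin n → ℝ) : PMF (Fin n → ℝ) :=
  (estimateLaw f fun e => y e * p e).map fun acc e =>
    y e + b / (n * n) * perceptronBest O (fun e => acc e * (p e * flag e)) p flag e

def Cmd.greedyStep : Cmd OracleName :=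
  .seq (.call .estimate [0, 1, 2] 4)
  (.seq (.call .perceptron [4, 1, 2] 5)
  (.call (.mapEntries (.add (.get 1 (.var 9)) (.mul (.div (.get 3 (.lit 0))
    (.mul (.ofIdx (.var 0)) (.ofIdx (.var 0)))) (.get 2 (.var 9))))) [0, 0, 5, 3] 0))

def greedyStepTime (n : ℕ) : ℕ := estimateTime n + perceptronTime n + n * 60 + 60

lemma computesP_greedyStep (hO : ∀ l, O .objective l = [f (listSet l)])
    (hin : ∀ l, (O .sepIn l).length ≤ n) (hout : ∀ l, (O .sepOut l).length ≤ n) (b : ℝ)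
    (y p flag : Fin n → ℝ) :
    ComputesP O .greedyStep [List.ofFn y, List.ofFn p, List.ofFn flag, [b]]
      ((greedyKernel O f b p flag y).map List.ofFn) (greedyStepTime n) := by
  refine (Outputs.call_seq (m := n) (t := estimateTime n)
    (μ := (estimateLaw f fun e => y e * p e).map fun acc => List.ofFn fun e => acc e * (p e * flag e))
    (ν := fun l => PMF.pure (List.ofFn fun e => y e + b / (n * n) *
      perceptronBest O (listVec l) p flag e)) (t' := perceptronTime n + n * 50 + 50)
      ?_ ?_ fun l hl => ?_).computesP ?_ ?_
  · simpa using computesP_estimate hO y p flag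
  · intro l hl
    rw [PMF.mem_support_map_iff] at hl
    obtain ⟨R, -, rfl⟩ := hl
    simp
  · rw [PMF.mem_support_map_iff] at hl
    obtain ⟨acc, -, rfl⟩ := hl
    set w : Fin n → ℝ := fun e => acc e * (p e * flag e)
    have h := Outputs.det_seq (O := O) (c := .perceptron)
      (s := (Store.ofLists [List.ofFn y, List.ofFn p, List.ofFn flag, [b]]).setBlock 4 (List.ofFn w))
      (args := [4, 1, 2]) (dst := 5) (out := List.ofFn (perceptronBest O w p flag))
      (t := perceptronTime n)
      (by
        refine ⟨Cmd.noCoin_mapEntries _, Cmd.noCoin_mapEntries _, Cmd.NoCoin.loopPow ?_ 6,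
          Cmd.noCoin_mapEntries _⟩
        simp [Cmd.NoCoin, Cmd.cut, Cmd.correct, Cmd.mapEntries, Cmd.sumEntries, Cmd.absEntries,
          Cmd.keepBest, Cmd.incr])
      (by simpa using computes_perceptron hin hout)
      (Outputs.det (args := [0, 0, 5, 3]) (out := List.ofFn fun e => y e + b / (n * n) *
          perceptronBest O w p flag e) (t := n * 25 + 2)
        (c := .mapEntries (.add (.get 1 (.var 9)) (.mul (.div (.get 3 (.lit 0))
          (.mul (.ofIdx (.var 0)) (.ofIdx (.var 0)))) (.get 2 (.var 9))))) (Cmd.noCoin_mapEntries _) (by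
        simp only [List.map_cons, List.map_nil]
        refine (computes_mapEntries (by simp) (by simp) _ fun k s h9 hF => ?_).mono (fun _ => id)
          (by simp [RExp.size, IExp.size]; omega)
        simp [RExp.eval, IExp.eval, h9, hF.arr, hF.idx]))
    rw [listVec_ofFn]
    refine ⟨h.law, fun r hr => (h.time r hr).trans ?_⟩
    simp; omega
  · rw [greedyKernel, PMF.bind_map, PMF.map_comp, PMF.map]
    congr 1
    funext R
    simp [listVec_ofFn]
  · simp [greedyStepTime]; omega

/-- The marks of the elements whose unit vectors belong to both polytopes. -/
def flagVec (O : OracleName → List ℝ → List ℝ) (n : ℕ) : Fin n → ℝ := fun e =>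
  if (O .sepIn (setList {e})).length + (O .sepOut (setList {e})).length < 1 then 1 else 0

/-- The law of the vector that the greedy method finds. -/
def greedyLaw (O : OracleName → List ℝ → List ℝ) (f : Finset (Fin n) → ℝ) (b : ℝ)
    (p : Fin n → ℝ) : PMF (Fin n → ℝ) :=
  iterLaw (greedyKernel O f b p (flagVec O n)) (n ^ 2) fun _ => 0

/-- Find a fractional solution, round it, and sample the families of the two schemes. -/
def Cmd.prepare (sampleIn sampleOut : Cmd OracleName) : Cmd OracleName :=
  .seq (.call (.mapEntries (.ofIdx (.lit 0))) [1] 2)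
  (.seq (.call .flags [2, 2] 3)
  (.seq (.loopPow (.var 1) (.call .greedyStep [2, 1, 3, 0] 2) 2)
  (.seq (.call .coins [2, 2] 4)
  (.seq (.call (.mapEntries (.mul (.get 1 (.var 9)) (.get 2 (.var 9)))) [1, 2, 1] 5)
  (.seq (.call sampleIn [5] 6)
  (.seq (.call sampleOut [2] 7)
  (.seq (.call .pair [6, 7] 8)
    (.call .pair [4, 8] 0))))))))

def prepareTime (n t : ℕ) : ℕ :=
  loopPowTime 1 n (3 * n + 5 + greedyStepTime n + n + 1) 2 + n * (4 * n + 40) + n * 100 + t * 100 +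
    200

theorem computesP_prepare (hO : ∀ l, O .objective l = [f (listSet l)])
    (hin : ∀ l, (O .sepIn l).length ≤ n) (hout : ∀ l, (O .sepOut l).length ≤ n) {b : ℝ}
    {p : Fin n → ℝ} {sampleIn sampleOut : Cmd OracleName}
    {μin μout : (Fin n → ℝ) → PMF (List ℝ)}
    (hsin : ∀ y ∈ (greedyLaw O f b p).support, ComputesP O sampleIn [List.ofFn fun e => y e * p e]
      (μin y) t ∧ ∀ l ∈ (μin y).support, l.length ≤ t)
    (hsout : ∀ y ∈ (greedyLaw O f b p).support, ComputesP O sampleOut [List.ofFn y]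
      (μout y) t ∧ ∀ l ∈ (μout y).support, l.length ≤ t) :
    ComputesP O (.prepare sampleIn sampleOut) [[b], List.ofFn p]
      ((greedyLaw O f b p).bind fun y => (prodPMF y).bind fun R => (μin y).bind fun rin =>
        (μout y).map fun rout => pairList (setList R) (pairList rin rout)) (prepareTime n t) := by
  set s₃ : Store := (Store.ofLists [[b], List.ofFn p]).setBlock 3 (List.ofFn (flagVec O n)) with hs₃
  have hloop := RunsP.loopPow (O := O) (i := .var 1) (c := .call .greedyStep [2, 1, 3, 0] 2)
    (enc := fun v : Fin n → ℝ => s₃.setBlock 2 (List.ofFn v)) (m := n)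
    (K := greedyKernel O f b p (flagVec O n)) (t := 3 * n + 5 + greedyStepTime n + n + 1)
    (by intro a; simp [IExp.eval, hs₃]) (by
      intro v
      refine (RunsP.call (m := n) (t := greedyStepTime n)
        (μ := (greedyKernel O f b p (flagVec O n) v).map List.ofFn) ?_ ?_).congr ?_ ?_
      · simpa [hs₃] using computesP_greedyStep hO hin hout b v p (flagVec O n)
      · intro l hl
        rw [PMF.mem_support_map_iff] at hl
        obtain ⟨R, -, rfl⟩ := hl
        simp
      · rw [PMF.map_comp]
        congr 1
        funext v
        simp
      · simp [hs₃]; omega) 2 (fun _ => 0)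
  -- Exchanging the two writes puts the memory into the form required by the loop rule, a fixed
  -- memory in which only variable `2` varies.
  have hcomm : ((Store.ofLists [[b], List.ofFn p]).setBlock 2 (List.ofFn fun _ : Fin n => 0)).setBlock
      3 (List.ofFn (flagVec O n)) = s₃.setBlock 2 (List.ofFn fun _ : Fin n => 0) := by
    simp only [hs₃, Store.setBlock]
    congr 1 <;> exact Function.update_comm (by norm_num) _ _ _
  refine (Outputs.det_seq (out := List.ofFn fun _ : Fin n => 0) (t := n * 9 + 2) (Cmd.noCoin_mapEntries _) ?_
    (Outputs.det_seq (out := List.ofFn (flagVec O n)) (t := n * (4 * n + 40) + 4) ?_ ?_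
    (t' := loopPowTime 1 n (3 * n + 5 + greedyStepTime n + n + 1) 2 + (n * 80 + t * 100 + 150))
    (?_ : Outputs O _ _ ((greedyLaw O f b p).bind fun y => (prodPMF y).bind fun R =>
      (μin y).bind fun rin => (μout y).map fun rout =>
        pairList (setList R) (pairList rin rout)) _))).computesP rfl ?_
  · refine computes_mapEntries (by simp) (by simp) _ fun k s h9 hF => ?_
    simp [RExp.eval, IExp.eval]
  · simp [Cmd.flags, Cmd.NoCoin, Cmd.incr]
  · simp only [List.map_cons, List.map_nil, Store.setBlock_block, if_true]
    exact computes_flags hin hout fun _ => 0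
  · rw [hcomm]
    refine Outputs.seq hloop fun y hy => ?_
    change y ∈ (greedyLaw O f b p).support at hy
    have hbind : ((prodPMF y).bind fun R => (μin y).bind fun rin => (μout y).map fun rout =>
        pairList (setList R) (pairList rin rout)) =
        ((prodPMF y).map setList).bind fun lR => (μin y).bind fun rin => (μout y).bind fun rout =>
          PMF.pure (pairList lR (pairList rin rout)) := by
      rw [PMF.bind_map]; rfl
    rw [hbind]
    have h := Outputs.call_seq (O := O) (c := .coins) (args := [2, 2]) (dst := 4) (m := n)
      (s := s₃.setBlock 2 (List.ofFn y)) (μ := (prodPMF y).map setList) (t := n * 9 + 2)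
      (d := .seq (.call (.mapEntries (.mul (.get 1 (.var 9)) (.get 2 (.var 9)))) [1, 2, 1] 5)
        (.seq (.call sampleIn [5] 6)
        (.seq (.call sampleOut [2] 7)
        (.seq (.call .pair [6, 7] 8)
          (.call .pair [4, 8] 0)))))
      (ν := fun lR => (μin y).bind fun rin => (μout y).bind fun rout =>
          PMF.pure (pairList lR (pairList rin rout))) (t' := n * 65 + t * 98 + 130)
      (by simpa using computesP_coins y)
      (by
        intro l hl
        rw [PMF.mem_support_map_iff] at hl
        obtain ⟨R, -, rfl⟩ := hl
        rw [setList_length])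
      (fun lR hlR => by
        have hlen : lR.length = n := by
          rw [PMF.mem_support_map_iff] at hlR
          obtain ⟨R, -, rfl⟩ := hlR
          rw [setList_length]
        refine (Outputs.det_seq (out := List.ofFn fun e => y e * p e) (t := n * 12 + 2) (Cmd.noCoin_mapEntries _) ?_
          (Outputs.call_seq (t := t) (m := t) (t' := n * 45 + t * 95 + 110)
          (ν := fun rin => (μout y).bind fun rout => PMF.pure (pairList lR (pairList rin rout)))
          ?_ (hsin y hy).2 fun rin hrin =>
          (Outputs.call_seq (t := t) (m := t) (t' := n * 40 + t * 90 + 100)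
          (ν := fun rout => PMF.pure (pairList lR (pairList rin rout))) ?_ (hsout y hy).2
          fun rout hrout => ?_).mono ?_)).mono ?_
        · simp only [List.map_cons, List.map_nil]
          refine computes_mapEntries (by simp [hs₃]) (by simp) _ fun k s h9 hF => ?_
          simp [RExp.eval, IExp.eval, h9, hF.arr, hs₃]
        · simpa using (hsin y hy).1
        · simpa using (hsout y hy).1
        · have h1 := (hsin y hy).2 _ hrin
          have h2 := (hsout y hy).2 _ hrout
          have h := Outputs.det_seq (O := O)
            (s := ((((s₃.setBlock 2 (List.ofFn y)).setBlock 4 lR).setBlock 5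
              (List.ofFn fun e => y e * p e)).setBlock 6 rin).setBlock 7 rout)
            (args := [6, 7]) (dst := 8) (c := .pair) Cmd.noCoin_pair
            (by simpa using computes_pair rin rout)
            (Outputs.det (args := [4, 8]) (c := .pair) Cmd.noCoin_pair
              (by simpa using computes_pair lR (pairList rin rout)))
          refine ⟨h.law, fun r hr => (h.time r hr).trans ?_⟩
          simp [pairList, hlen]
          omega
        · simp; omega
        · simp [hs₃]; omega)
    refine ⟨h.law, fun r hr => (h.time r hr).trans ?_⟩
    simp [hs₃]
    omega
  · simp [prepareTime]
    omega

end

/-! ### The online decisions -/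

section
variable {O : OracleName → List ℝ → List ℝ} {n : ℕ} {t : ℕ}

/-- Accept if the first entries of the three inputs are `1`. -/
def Cmd.allOnes : Cmd OracleName :=
  .seq (.ifLt (.ofIdx (.lit 0)) (.add (.add
      (.mul (.sub (.get 0 (.lit 0)) (.ofIdx (.lit 1))) (.sub (.get 0 (.lit 0)) (.ofIdx (.lit 1))))
      (.mul (.sub (.get 1 (.lit 0)) (.ofIdx (.lit 1))) (.sub (.get 1 (.lit 0)) (.ofIdx (.lit 1)))))
      (.mul (.sub (.get 2 (.lit 0)) (.ofIdx (.lit 1))) (.sub (.get 2 (.lit 0)) (.ofIdx (.lit 1)))))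
    (.setReal 0 (.lit 0) (.ofIdx (.lit 0))) (.setReal 0 (.lit 0) (.ofIdx (.lit 1))))
  (.setIdx 0 (.lit 1))

lemma computes_allOnes (x y z : List ℝ) :
    Computes O .allOnes [x, y, z] [if Accepts x ∧ Accepts y ∧ Accepts z then 1 else 0] 60 := by
  -- A strict comparison tests three equalities at once through a sum of squares.
  have key : ∀ u v w : ℝ, 0 < (u - 1) * (u - 1) + (v - 1) * (v - 1) + (w - 1) * (w - 1) ↔
      ¬ (u = 1 ∧ v = 1 ∧ w = 1) := by
    intro u v w
    constructor
    · rintro h ⟨rfl, rfl, rfl⟩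
      simp at h
    · intro h
      by_contra hle
      have h1 := mul_self_nonneg (u - 1)
      have h2 := mul_self_nonneg (v - 1)
      have h3 := mul_self_nonneg (w - 1)
      refine h ⟨?_, ?_, ?_⟩ <;> refine sub_eq_zero.1 (mul_self_eq_zero.1 ?_) <;> linarith
  refine ((Runs.ifLt (t := 4) (Q := fun s => s.arr 0 0 =
    if Accepts x ∧ Accepts y ∧ Accepts z then 1 else 0) (fun h => ?_) fun h => ?_).seq (t₂ := 2)
    fun s hs => Runs.setIdx ?_).mono (fun _ => id) ?_
  · simp only [RExp.eval, IExp.eval, Nat.cast_zero, Nat.cast_one, key, Store.ofLists_arr] at h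
    refine (Runs.setReal ?_).mono (fun _ => id) (by simp [IExp.size, RExp.size])
    have h' : ¬ (Accepts x ∧ Accepts y ∧ Accepts z) := h
    simp [IExp.eval, RExp.eval, h']
  · simp only [RExp.eval, IExp.eval, Nat.cast_zero, Nat.cast_one, key, Store.ofLists_arr,
      not_not] at h
    refine (Runs.setReal ?_).mono (fun _ => id) (by simp [IExp.size, RExp.size])
    have h' : Accepts x ∧ Accepts y ∧ Accepts z := h
    simp [IExp.eval, RExp.eval, h']
  · refine Store.block_eq (by simp [IExp.eval]) fun k hk => ?_
    have : k = 0 := by simpa using hk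
    subst this
    simpa using hs
  · simp [IExp.size, RExp.size]

/-- Decide about the element that arrives, with the subroutines that test independence. -/
def Cmd.choose (testIn testOut : Cmd OracleName) : Cmd OracleName :=
  .seq (.call .unpairFst [0] 4)
  (.seq (.call .unpairSnd [0] 5)
  (.seq (.call .unpairFst [5] 6)
  (.seq (.call .unpairSnd [5] 7)
  (.seq (.call .append [1, 3] 8)
  (.seq (.call (.mapEntries (.ofIdx (.lit 2))) [3] 9)
  (.seq (.call .append [2, 9] 10)
  (.seq (.call (.mapEntries (.ofIdx (.lit 0))) [3] 11)
  (.seq (.call (.mapEntries (.ofIdx (.lit 1))) [3] 12)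
  (.seq (.call .history [4, 8, 10, 11] 13)
  (.seq (.call .history [4, 8, 10, 12] 14)
  (.seq (.call .history [4, 3, 9, 12] 15)
  (.seq (.call (.sumEntries (.mul (.get 1 (.var 9)) (.get 2 (.var 9)))) [4, 4, 15] 16)
  (.seq (.call testIn [14, 6] 17)
  (.seq (.call testOut [13, 7] 18)
    (.call .allOnes [16, 17, 18] 0)))))))))))))))

/-- The code of what happened to an element. -/
def statusCode : Option Bool → ℝ
  | none => 0
  | some false => 1
  | some true => 2

def chooseTime (n t : ℕ) : ℕ := 100 * (n * (t * 40 + 80)) + n * 1000 + t * 1000 + 1000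

/-- The arriving element is appended to the history with the status of an active one. Entries with
status above `0` then form the probed set together with `e`, and those above `1` the selected set
together with `e`. Membership in `R` is an inner product with the unit vector of `e`. -/
theorem computes_choose {testIn testOut : Cmd OracleName} {rin rout : List ℝ}
    {outIn outOut : Finset (Fin n) → List ℝ} (hrin : rin.length ≤ t) (hrout : rout.length ≤ t)
    (hin : ∀ S, Computes O testIn [setList S, rin] (outIn S) t ∧ (outIn S).length ≤ t)
    (hout : ∀ S, Computes O testOut [setList S, rout] (outOut S) t ∧ (outOut S).length ≤ t)
    (R : Finset (Fin n)) (h : History (Fin n)) (hh : h.length ≤ t) (e : Fin n) :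
    Computes O (.choose testIn testOut)
      (decideInput (pairList (setList R) (pairList rin rout)) h e)
      [if e ∈ R ∧ Accepts (outIn (insert e h.selected)) ∧ Accepts (outOut (insert e h.probed))
        then 1 else 0] (chooseTime n t) := by
  have hstatus : decideInput (pairList (setList R) (pairList rin rout)) h e =
      [pairList (setList R) (pairList rin rout), h.map fun q => ((q.1 : ℕ) : ℝ),
        h.map fun q => statusCode q.2, [((e : ℕ) : ℝ)]] := by
    rw [decideInput]
    congr 3
  rw [hstatus]
  set l : List (ℕ × ℝ) := h.map (fun q => ((q.1 : ℕ), statusCode q.2)) ++ [((e : ℕ), 2)] with hl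
  have hl1 : (h.map fun q => ((q.1 : ℕ) : ℝ)) ++ [((e : ℕ) : ℝ)] = l.map fun q => (q.1 : ℝ) := by
    simp [hl]
  have hl2 : (h.map fun q => statusCode q.2) ++ [2] = l.map Prod.snd := by
    simp [hl, Function.comp_def]
  have hlen : l.length = h.length + 1 := by simp [hl]
  have hprobed : (fun a : Fin n => if ∃ q ∈ l, q.1 = a ∧ (0 : ℝ) < q.2 then (1 : ℝ) else 0) =
      charVec (insert e h.probed) := by
    funext a
    rw [charVec]
    congr 1
    rw [Finset.mem_insert, History.mem_probed, eq_iff_iff]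
    constructor
    · rintro ⟨q, hq, h1, h2⟩
      rw [hl, List.mem_append, List.mem_map, List.mem_singleton] at hq
      rcases hq with ⟨⟨a', o⟩, hq, rfl⟩ | rfl
      · have ha : a' = a := Fin.ext h1
        subst ha
        rcases o with _ | o
        · simp [statusCode] at h2
        · exact Or.inr ⟨o, hq⟩
      · exact Or.inl (Fin.ext h1.symm)
    · rintro (rfl | ⟨o, ho⟩)
      · exact ⟨((a : ℕ), 2), by simp [hl], rfl, by norm_num⟩
      · refine ⟨((a : ℕ), statusCode (some o)), ?_, rfl, ?_⟩
        · rw [hl, List.mem_append, List.mem_map]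
          exact Or.inl ⟨_, ho, rfl⟩
        · cases o <;> norm_num [statusCode]
  have hselected : (fun a : Fin n => if ∃ q ∈ l, q.1 = a ∧ (1 : ℝ) < q.2 then (1 : ℝ) else 0) =
      charVec (insert e h.selected) := by
    funext a
    rw [charVec]
    congr 1
    rw [Finset.mem_insert, History.mem_selected, eq_iff_iff]
    constructor
    · rintro ⟨q, hq, h1, h2⟩
      rw [hl, List.mem_append, List.mem_map, List.mem_singleton] at hq
      rcases hq with ⟨⟨a', o⟩, hq, rfl⟩ | rfl
      · have ha : a' = a := Fin.ext h1
        subst ha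
        rcases o with _ | _ | _
        · simp only [statusCode] at h2
          linarith
        · simp [statusCode] at h2
        · exact Or.inr hq
      · exact Or.inl (Fin.ext h1.symm)
    · rintro (rfl | ho)
      · exact ⟨((a : ℕ), 2), by simp [hl], rfl, by norm_num⟩
      · refine ⟨((a : ℕ), statusCode (some true)), ?_, rfl, ?_⟩
        · rw [hl, List.mem_append, List.mem_map]
          exact Or.inl ⟨_, ho, rfl⟩
        · norm_num [statusCode]
  have hsingle : (fun a : Fin n => if ∃ q ∈ [((e : ℕ), (2 : ℝ))], q.1 = a ∧ (1 : ℝ) < q.2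
      then (1 : ℝ) else 0) = charVec {e} := by
    funext a
    simp [charVec, Fin.ext_iff, eq_comm]
  have hconst : ∀ (c : ℕ) (x : ℝ), Computes O (.mapEntries (.ofIdx (.lit c))) [[x]] [(c : ℝ)] 11 := by
    intro c x
    have := computes_mapEntries (O := O) (r := .ofIdx (.lit c)) (n := 1) (L := [[x]]) rfl (by simp)
      (fun _ => (c : ℝ)) fun k s h9 hF => by simp [RExp.eval, IExp.eval]
    simpa [RExp.size, IExp.size] using this
  have hdot : ∑ a, charVec R a * charVec {e} a = if e ∈ R then 1 else 0 := by
    simp [charVec]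
  -- Naming the only product makes the final estimate of the running time linear.
  obtain ⟨T, hT⟩ : ∃ T, T = n * (t * 40 + 80) := ⟨_, rfl⟩
  have hist : ∀ (thr : ℝ) (l' : List (ℕ × ℝ)), l'.length ≤ t + 1 →
      Computes O .history [setList R, l'.map fun q => (q.1 : ℝ), l'.map Prod.snd, [thr]]
      (List.ofFn fun a : Fin n => if ∃ q ∈ l', q.1 = a ∧ thr < q.2 then 1 else 0) (T + 4) := by
    intro thr l' hl'
    refine (computes_history (charVec R) l' thr).mono (fun _ => id) ?_
    rw [hT]
    have := Nat.mul_le_mul_left n (show l'.length * 40 + 40 ≤ t * 40 + 80 by omega)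
    omega
  have hlenR := setList_length R
  have hlR : (pairList (setList R) (pairList rin rout)).length = n + rin.length + rout.length + 2 := by
    simp [pairList, hlenR]; omega
  have hlio : (pairList rin rout).length = rin.length + rout.length + 1 := by
    simp [pairList]
  have hlenE := setList_length (insert e h.selected)
  have hlenF := setList_length (insert e h.probed)
  have hlenG := setList_length {e}
  have hlI := (hin (insert e h.selected)).2
  have hlO := (hout (insert e h.probed)).2
  refine (Runs.call_seq (out := setList R) (t' := n * 40 + (rin.length + rout.length + 1) * 20 + 40) ?_
    (Runs.call_seq (out := pairList rin rout)
      (t' := n * 40 + (rin.length + rout.length + 1) * 60 + 40) ?_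
    (Runs.call_seq (out := rin) (t' := rin.length * 40 + rout.length * 20 + 40) ?_
    (Runs.call_seq (out := rout) (t' := rin.length * 40 + rout.length * 60 + 40) ?_
    (Runs.call_seq (out := l.map fun q => (q.1 : ℝ)) (t' := 15) ?_
    (Runs.call_seq (out := [2]) (t' := 11) ?_
    (Runs.call_seq (out := l.map Prod.snd) (t' := 15) ?_
    (Runs.call_seq (out := [0]) (t' := 11) ?_
    (Runs.call_seq (out := [1]) (t' := 11) ?_
    (Runs.call_seq (out := setList (insert e h.probed)) (t' := T + 4) ?_
    (Runs.call_seq (out := setList (insert e h.selected)) (t' := T + 4) ?_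
    (Runs.call_seq (out := setList {e}) (t' := T + 4) ?_
    (Runs.call_seq (out := [if e ∈ R then 1 else 0]) (t' := n * 15 + 8) ?_
    (Runs.call_seq (out := outIn (insert e h.selected)) (t' := t) ?_
    (Runs.call_seq (out := outOut (insert e h.probed)) (t' := t) ?_
    (Runs.call (out := [if e ∈ R ∧ Accepts (outIn (insert e h.selected)) ∧
      Accepts (outOut (insert e h.probed)) then 1 else 0]) (t := 60) ?_ ?_)))))))))))))))).mono
      (fun _ => id) ?_
  · simpa [hlenR, hlio] using computes_unpairFst (O := O) (setList R) (pairList rin rout)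
  · simpa [hlenR, hlio] using computes_unpairSnd (O := O) (setList R) (pairList rin rout)
  · simpa using computes_unpairFst (O := O) rin rout
  · simpa using computes_unpairSnd (O := O) rin rout
  · have := computes_append (O := O) (h.map fun q => ((q.1 : ℕ) : ℝ)) [((e : ℕ) : ℝ)]
    rw [hl1] at this
    simpa using this
  · simpa using hconst 2 ((e : ℕ) : ℝ)
  · have := computes_append (O := O) (h.map fun q => statusCode q.2) [2]
    rw [hl2] at this
    simpa using this
  · simpa using hconst 0 ((e : ℕ) : ℝ)
  · simpa using hconst 1 ((e : ℕ) : ℝ)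
  · have := hist 0 l (by omega)
    rw [hprobed] at this
    change Computes _ _ _ (setList (insert e h.probed)) _ at this
    simpa using this
  · have := hist 1 l (by omega)
    rw [hselected] at this
    change Computes _ _ _ (setList (insert e h.selected)) _ at this
    simpa using this
  · have := hist 1 [((e : ℕ), (2 : ℝ))] (by simp)
    rw [hsingle] at this
    change Computes _ _ _ (setList {e}) _ at this
    simpa using this
  · simp only [List.map_cons, List.map_nil]
    rw [← hdot]
    refine computes_sumEntries (by simp [hlenR]) (by simp) _ fun k s h9 hF => ?_
    simp [RExp.eval, IExp.eval, h9, hF.arr, setList]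
  · simpa using (hin (insert e h.selected)).1
  · simpa using (hout (insert e h.probed)).1
  · have := computes_allOnes (O := O) [if e ∈ R then 1 else 0] (outIn (insert e h.selected))
      (outOut (insert e h.probed))
    have h1 : Accepts [if e ∈ R then (1 : ℝ) else 0] ↔ e ∈ R := by simp [Accepts]
    simp only [h1] at this
    have hL : ∀ L, L = [[if e ∈ R then 1 else 0], outIn (insert e h.selected),
        outOut (insert e h.probed)] → Computes O .allOnes L [if e ∈ R ∧
        Accepts (outIn (insert e h.selected)) ∧ Accepts (outOut (insert e h.probed)) then 1 else 0]
        60 := by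
      rintro _ rfl
      convert this using 2
    exact hL _ (by simp)
  · simp
  · simp [chooseTime, hlenR, hlio, hlR, hlenE, hlenF, hlenG, hlen]
    rw [← hT]
    clear_value l
    generalize (outIn (insert e h.selected)).length = i at *
    generalize (outOut (insert e h.probed)).length = j at *
    generalize rin.length = i' at *
    generalize rout.length = j' at *
    generalize List.length h = k at *
    clear * - hrin hrout hlI hlO hh
    linarith

end

/-! ### Analysis of the greedy method with estimated marginal values -/

section
variable {α : Type}

/-- The invariant may depend on the number of steps made, as the fractional solution grows with it.
-/
lemma iterLaw_support {K : α → PMF α} (I : ℕ → α → Prop) {m : ℕ}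
    (hstep : ∀ k < m, ∀ a, I k a → ∀ a' ∈ (K a).support, I (k + 1) a') (k j : ℕ) (hj : j + k ≤ m)
    (a : α) (ha : I j a) : ∀ a' ∈ (iterLaw K k a).support, I (j + k) a' := by
  induction k generalizing j a with
  | zero =>
    intro a' ha'
    rw [iterLaw, PMF.mem_support_pure_iff] at ha'
    rw [ha']
    exact ha
  | succ k ih =>
    intro a' ha'
    rw [iterLaw, PMF.mem_support_bind_iff] at ha'
    obtain ⟨a₁, h1, h2⟩ := ha'
    have := ih (j + 1) (by omega) a₁ (hstep j (by omega) a ha a₁ h1) a' h2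
    rwa [add_assoc, add_comm 1 k] at this

/-- A potential that contracts in expectation. -/
lemma lexp_iterLaw_le {K : α → PMF α} (I : ℕ → α → Prop) {m : ℕ} {D : α → ℝ} {ρ c : ℝ}
    (hρ : 0 ≤ ρ) (hρ1 : ρ ≤ 1) (hc : 0 ≤ c) (hD : ∀ a, 0 ≤ D a)
    (hstep : ∀ k < m, ∀ a, I k a → ∀ a' ∈ (K a).support, I (k + 1) a')
    (hdec : ∀ k < m, ∀ a, I k a →
      lexp (K a) (fun a' => ENNReal.ofReal (D a')) ≤ ENNReal.ofReal (ρ * D a + c)) (k j : ℕ)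
    (hj : j + k ≤ m) (a : α) (ha : I j a) :
    lexp (iterLaw K k a) (fun a' => ENNReal.ofReal (D a')) ≤ ENNReal.ofReal (ρ ^ k * D a + k * c) := by
  induction k generalizing j a with
  | zero => simp [iterLaw, lexp_pure]
  | succ k ih =>
    rw [iterLaw, lexp_bind]
    have hk0 : 0 ≤ (k : ℝ) * c := by positivity
    have hρk : 0 ≤ ρ ^ k := pow_nonneg hρ k
    calc lexp (K a) (fun a₁ => lexp (iterLaw K k a₁) fun a' => ENNReal.ofReal (D a'))
        ≤ lexp (K a) fun a₁ => ENNReal.ofReal (ρ ^ k) * ENNReal.ofReal (D a₁) +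
            ENNReal.ofReal (k * c) := by
          refine lexp_mono fun a₁ h1 => ?_
          rw [← ENNReal.ofReal_mul hρk, ← ENNReal.ofReal_add (mul_nonneg hρk (hD _)) hk0]
          exact ih (j + 1) (by omega) a₁ (hstep j (by omega) a ha a₁ h1)
      _ = ENNReal.ofReal (ρ ^ k) * lexp (K a) (fun a₁ => ENNReal.ofReal (D a₁)) +
            ENNReal.ofReal (k * c) := by rw [lexp_add, lexp_const_mul, lexp_const]
      _ ≤ ENNReal.ofReal (ρ ^ k) * ENNReal.ofReal (ρ * D a + c) + ENNReal.ofReal (k * c) := by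
          gcongr
          exact hdec j (by omega) a ha
      _ ≤ _ := by
          have h0 : 0 ≤ ρ * D a + c := add_nonneg (mul_nonneg hρ (hD a)) hc
          rw [← ENNReal.ofReal_mul hρk, ← ENNReal.ofReal_add (mul_nonneg hρk h0) hk0]
          refine ENNReal.ofReal_le_ofReal ?_
          -- Earlier errors would be damped by later contractions; simply adding them up is accurate
          -- enough.
          have : ρ ^ k * c ≤ c := mul_le_of_le_one_left hc (pow_le_one₀ hρ hρ1)
          rw [pow_succ]
          push_cast
          nlinarith

end

/-! ### Accuracy of the sampled marginal values. -/

section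
variable {n : ℕ} {f : Finset (Fin n) → ℝ}

/-- Reconciles the classical decidability of equality of the general lemmas with the one of `Fin n`.
-/
lemma insert_classical (e : Fin n) (R : Finset (Fin n)) :
    @insert _ _ (@Finset.instInsert _ fun a b => Classical.propDecidable (a = b)) e R =
      insert e R := by
  ext a
  rw [@Finset.mem_insert _ (fun a b => Classical.propDecidable (a = b)), Finset.mem_insert]

lemma marginal_mem (hf : IsMonotoneSubmodular f) (e : Fin n) (R : Finset (Fin n)) :
    0 ≤ f (insert e R) - f R ∧ f (insert e R) - f R ≤ f {e} - f ∅ :=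
  ⟨sub_nonneg.2 (hf.mono _ _ (Finset.subset_insert e R)), by
    have := hf.marginal_anti e (Finset.empty_subset R)
    rw [insert_classical, insert_classical, Finset.insert_empty] at this
    exact this⟩

lemma expGain_fin (x : Fin n → ℝ) (e : Fin n) :
    (setExp x fun R => f (insert e R) - f R) = expGain f x e := by
  simp only [expGain, insert_classical]

/-- Variances of independent samples add up. A sample and its mean both lie between `0` and `f {e} -
f ∅`, which bounds each variance. In the induction, `v` absorbs the first sample and `c` its mean;
the cross term averages to zero. -/
lemma lexp_sampleKernel_sq_le (hf : IsMonotoneSubmodular f) {x : Fin n → ℝ}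
    (hx : ∀ e, 0 ≤ x e ∧ x e ≤ 1) (e : Fin n) (k : ℕ) (v : Fin n → ℝ) (c : ℝ) :
    lexp (iterLaw (sampleKernel f x) k v)
      (fun acc => ENNReal.ofReal ((acc e - (c + k * expGain f x e)) ^ 2)) ≤
      ENNReal.ofReal ((v e - c) ^ 2 + k * (f {e} - f ∅) ^ 2) := by
  induction k generalizing v c with
  | zero => simp [iterLaw, lexp_pure]
  | succ k ih =>
    set g := expGain f x e with hg
    set X : Finset (Fin n) → ℝ := fun R => f (insert e R) - f R with hX
    have hgX : setExp x X = g := expGain_fin x e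
    have hg0 : 0 ≤ g := expGain_nonneg hf hx e
    have hg1 : g ≤ f {e} - f ∅ := by
      rw [← setExp_const x (f {e} - f ∅), ← hgX]
      exact setExp_mono hx fun R => (marginal_mem hf e R).2
    rw [iterLaw, lexp_bind, sampleKernel, lexp_map]
    calc lexp (prodPMF x) _ ≤ lexp (prodPMF x) fun R =>
          ENNReal.ofReal ((v e + X R - (c + g)) ^ 2 + k * (f {e} - f ∅) ^ 2) := by
          refine lexp_mono fun R _ => ?_
          refine le_trans (le_of_eq ?_) (ih (fun e => v e + (f (insert e R) - f R)) (c + g))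
          congr 1
          funext acc
          congr 2
          push_cast
          ring
      _ = ENNReal.ofReal (setExp x fun R => (v e + X R - (c + g)) ^ 2 + k * (f {e} - f ∅) ^ 2) :=
          lexp_prodPMF hx fun R => by positivity
      _ ≤ _ := by
          refine ENNReal.ofReal_le_ofReal ?_
          calc (setExp x fun R => (v e + X R - (c + g)) ^ 2 + k * (f {e} - f ∅) ^ 2)
              ≤ setExp x fun R => 2 * (v e - c) * (X R - g) +
                ((v e - c) ^ 2 + (k + 1) * (f {e} - f ∅) ^ 2) := by
                refine setExp_mono hx fun R => ?_
                have h1 := (marginal_mem hf e R).1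
                have h2 := (marginal_mem hf e R).2
                have h3 : (X R - g) ^ 2 ≤ (f {e} - f ∅) ^ 2 :=
                  sq_le_sq' (by simp only [hX]; linarith) (by simp only [hX]; linarith)
                nlinarith
            _ = _ := by
                rw [setExp_add, setExp_const_mul, setExp_sub, hgX, setExp_const, setExp_const]
                push_cast
                ring

lemma abs_le_sq_div_add {x a : ℝ} (ha : 0 < a) : |x| ≤ 1 / (2 * a) * x ^ 2 + a / 2 := by
  have h1 : 0 ≤ (|x| - a) ^ 2 := sq_nonneg _
  rw [← sq_abs x]
  have h2 : 1 / (2 * a) * |x| ^ 2 + a / 2 - |x| = (|x| - a) ^ 2 / (2 * a) := by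
    field_simp; ring
  have : 0 ≤ (|x| - a) ^ 2 / (2 * a) := by positivity
  linarith

/-- The variance is at most `n ^ 4` times `V ^ 2` after scaling by `c`, so the expected deviation is
of order `n ^ 2 * V`. This is small compared to the scale `n ^ 4` of the sums. -/
lemma lexp_estimate_le (hf : IsMonotoneSubmodular f) (hn : 0 < n) {x : Fin n → ℝ}
    (hx : ∀ e, 0 ≤ x e ∧ x e ≤ 1) (e : Fin n) {c V : ℝ} (hc : 0 ≤ c) (hV : 0 < V)
    (hcV : c * (f {e} - f ∅) ≤ V) :
    lexp (estimateLaw f x) (fun acc => ENNReal.ofReal |acc e * c - n ^ 4 * (c * expGain f x e)|) ≤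
      ENNReal.ofReal (V * n ^ 2) := by
  have hn' : (0 : ℝ) < n := by exact_mod_cast hn
  -- The standard deviation is the optimal parameter in `abs_le_sq_div_add`; both terms of the bound
  -- then contribute at most `a / 2`.
  set a : ℝ := V * n ^ 2 with ha
  have ha0 : 0 < a := by positivity
  have hm0 : 0 ≤ f {e} - f ∅ := (marginal_mem hf e ∅).1.trans (marginal_mem hf e ∅).2
  calc lexp (estimateLaw f x) (fun acc => ENNReal.ofReal |acc e * c - n ^ 4 * (c * expGain f x e)|)
      ≤ lexp (estimateLaw f x) fun acc => ENNReal.ofReal (c ^ 2 / (2 * a)) *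
          ENNReal.ofReal ((acc e - (0 + (n ^ 4 : ℕ) * expGain f x e)) ^ 2) +
            ENNReal.ofReal (a / 2) := by
        refine lexp_mono fun acc _ => ?_
        rw [← ENNReal.ofReal_mul (by positivity), ← ENNReal.ofReal_add (by positivity) (by positivity)]
        refine ENNReal.ofReal_le_ofReal ((abs_le_sq_div_add ha0).trans (le_of_eq ?_))
        push_cast
        field_simp
        ring
    _ = ENNReal.ofReal (c ^ 2 / (2 * a)) * lexp (estimateLaw f x) (fun acc =>
          ENNReal.ofReal ((acc e - (0 + (n ^ 4 : ℕ) * expGain f x e)) ^ 2)) +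
            ENNReal.ofReal (a / 2) := by rw [lexp_add, lexp_const_mul, lexp_const]
    _ ≤ ENNReal.ofReal (c ^ 2 / (2 * a)) *
          ENNReal.ofReal ((0 - 0) ^ 2 + (n ^ 4 : ℕ) * (f {e} - f ∅) ^ 2) +
            ENNReal.ofReal (a / 2) := by
        gcongr
        exact lexp_sampleKernel_sq_le hf hx e (n ^ 4) (fun _ => 0) 0
    _ ≤ _ := by
        rw [← ENNReal.ofReal_mul (by positivity), ← ENNReal.ofReal_add (by positivity) (by positivity)]
        refine ENNReal.ofReal_le_ofReal ?_
        have h1 : (c * (f {e} - f ∅)) ^ 2 ≤ V ^ 2 := pow_le_pow_left₀ (mul_nonneg hc hm0) hcV 2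
        have h2 : c ^ 2 / (2 * a) * ((0 - 0) ^ 2 + (n ^ 4 : ℕ) * (f {e} - f ∅) ^ 2) =
            n ^ 4 / (2 * a) * (c * (f {e} - f ∅)) ^ 2 := by push_cast; ring
        have h3 : (n : ℝ) ^ 4 / (2 * a) * V ^ 2 = a / 2 := by
          rw [ha]; field_simp
        rw [h2]
        have h4 : (n : ℝ) ^ 4 / (2 * a) * (c * (f {e} - f ∅)) ^ 2 ≤ n ^ 4 / (2 * a) * V ^ 2 := by
          gcongr
        linarith

lemma estimateLaw_nonneg (hf : IsMonotoneSubmodular f) (x : Fin n → ℝ) :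
    ∀ acc ∈ (estimateLaw f x).support, ∀ e, 0 ≤ acc e :=
  iterLaw_support (K := sampleKernel f x) (fun _ (acc : Fin n → ℝ) => ∀ e, 0 ≤ acc e)
    (m := n ^ 4) (by
    intro k _ v hv v' hv' e
    rw [sampleKernel, PMF.mem_support_map_iff] at hv'
    obtain ⟨R, -, rfl⟩ := hv'
    exact add_nonneg (hv e) (marginal_mem hf e R).1) (n ^ 4) 0 (by omega) _ fun _ => le_rfl

end

/-! ### Feasibility of the vectors reached by the greedy method. -/

section
variable {n : ℕ} {O : OracleName → List ℝ → List ℝ} {f : Finset (Fin n) → ℝ}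
  {Finn Fout : Set (Finset (Fin n))} {Pin Pout : Set (Fin n → ℝ)}
  {sepIn sepOut : (Fin n → ℝ) → Option (Fin n → ℝ)} {p : Fin n → ℝ} {b : ℝ}

/-- The vectors of probing probabilities that respect both relaxations. -/
def probePolytope (Pin Pout : Set (Fin n → ℝ)) (p : Fin n → ℝ) : Set (Fin n → ℝ) :=
  {v | v ∈ Pout ∧ (fun e => p e * v e) ∈ Pin}

lemma convex_probePolytope (hin : Convex ℝ Pin) (hout : Convex ℝ Pout) :
    Convex ℝ (probePolytope Pin Pout p) := by
  intro v hv w hw s t hs ht hst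
  refine ⟨hout hv.1 hw.1 hs ht hst, ?_⟩
  convert hin hv.2 hw.2 hs ht hst using 1
  funext e
  simp only [Pi.add_apply, Pi.smul_apply, smul_eq_mul]
  ring

variable (hb : 0 ≤ b) (hb1 : b ≤ 1) (hOin : O .sepIn = sepAnswer sepIn)
  (hOout : O .sepOut = sepAnswer sepOut)
  (hsepIn : IsSeparationOracle Pin sepIn) (hsepOut : IsSeparationOracle Pout sepOut)
  (hFin : IsDownClosedFamily Finn) (hFout : IsDownClosedFamily Fout)
  (hPin : IsRelaxation Finn Pin) (hPout : IsRelaxation Fout Pout)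
  (hp : ∀ e, 0 ≤ p e ∧ p e ≤ 1) (hf : IsMonotoneSubmodular f)

lemma flagVec_eq (e : Fin n) : flagVec O n e = 0 ∨ flagVec O n e = 1 := by
  unfold flagVec; split_ifs <;> simp

section
include hOin hOout hsepIn hsepOut

lemma flagVec_ne_zero_iff (e : Fin n) :
    flagVec O n e ≠ 0 ↔ charVec {e} ∈ Pin ∧ charVec {e} ∈ Pout := by
  have hn : 0 < n := e.pos
  have h1 := sepAnswer_pos_iff hn hsepIn (charVec {e})
  have h2 := sepAnswer_pos_iff hn hsepOut (charVec {e})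
  rw [flagVec, hOin, hOout, setList]
  by_cases g1 : charVec {e} ∈ Pin <;> by_cases g2 : charVec {e} ∈ Pout <;>
    simp only [g1, g2, not_true_eq_false, not_false_eq_true, iff_false, iff_true, not_lt,
      Nat.le_zero] at h1 h2 <;> simp [g1, g2, h1, h2] <;>
    simp [← List.length_pos_iff, h1, h2]

end

section
include hOin hOout hsepIn hsepOut hFin hFout hPin hPout

lemma perceptronBest_mem (hn : 0 < n) {w : Fin n → ℝ} (hw : ∀ e, flagVec O n e = 0 → w e = 0) :
    perceptronBest O w p (flagVec O n) ∈ probePolytope Pin Pout p ∧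
      ∀ e, flagVec O n e = 0 → perceptronBest O w p (flagVec O n) e = 0 := by
  obtain ⟨h1, -, h2⟩ := perceptronState_mem (p := p) hn hOin hOout hsepIn hsepOut
    (hPin.zero_mem hFin) (hPout.zero_mem hFout) (flagVec_eq (O := O)) hw (n ^ 6)
  exact ⟨h1, h2⟩

lemma greedyKernel_support (hb : 0 ≤ b) (k : ℕ) (y : Fin n → ℝ)
    (hy : y ∈ (k * (b / (n * n))) • probePolytope Pin Pout p) :
    ∀ y' ∈ (greedyKernel O f b p (flagVec O n) y).support,
      y' ∈ (((k + 1 : ℕ) : ℝ) * (b / (n * n))) • probePolytope Pin Pout p := by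
  intro y' hy'
  rw [greedyKernel, PMF.mem_support_map_iff] at hy'
  obtain ⟨acc, -, rfl⟩ := hy'
  rcases Nat.eq_zero_or_pos n with rfl | hn
  · obtain ⟨u, hu, -⟩ := hy
    exact ⟨u, hu, Subsingleton.elim _ _⟩
  have hs : 0 ≤ b / ((n : ℝ) * n) := by positivity
  have hconv := convex_probePolytope (p := p) hPin.convex hPout.convex
  push_cast
  -- For a convex set, its dilates by two non-negative factors add up to the dilate by the sum.
  rw [add_mul, one_mul, hconv.add_smul (by positivity) hs]
  refine Set.add_mem_add hy (Set.smul_mem_smul_set (perceptronBest_mem hOin hOout hsepIn hsepOut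
    hFin hFout hPin hPout hn fun e he => ?_).1)
  rw [he, mul_zero, mul_zero]

lemma greedyLaw_support (hb : 0 ≤ b) :
    ∀ y ∈ (greedyLaw O f b p).support, y ∈ b • probePolytope Pin Pout p := by
  have h0 : (0 : Fin n → ℝ) ∈ probePolytope Pin Pout p := by
    refine ⟨hPout.zero_mem hFout, ?_⟩
    convert hPin.zero_mem hFin using 1
    funext e
    simp
  intro y hy
  have := iterLaw_support (fun k y => y ∈ ((k : ℝ) * (b / (n * n))) • probePolytope Pin Pout p)
    (m := n ^ 2) (fun k _ a ha => greedyKernel_support hOin hOout hsepIn hsepOut hFin hFout hPin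
      hPout hb k a ha) (n ^ 2) 0 (by omega) (fun _ => 0) (by
      refine ⟨0, h0, ?_⟩
      funext e
      simp) y hy
  rcases Nat.eq_zero_or_pos n with rfl | hn
  · exact ⟨0, h0, Subsingleton.elim _ _⟩
  · have hn' : (n : ℝ) ≠ 0 := by exact_mod_cast hn.ne'
    convert this using 2
    push_cast
    field_simp
    ring

end

end

/-! ### Expected value of the greedy method. -/

section
variable {n : ℕ} {O : OracleName → List ℝ → List ℝ} {f : Finset (Fin n) → ℝ}
  {Finn Fout : Set (Finset (Fin n))} {Pin Pout : Set (Fin n → ℝ)}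
  {sepIn sepOut : (Fin n → ℝ) → Option (Fin n → ℝ)} {p : Fin n → ℝ} {b : ℝ}
  (hb : 0 ≤ b) (hb1 : b ≤ 1) (hOin : O .sepIn = sepAnswer sepIn)
  (hOout : O .sepOut = sepAnswer sepOut)
  (hsepIn : IsSeparationOracle Pin sepIn) (hsepOut : IsSeparationOracle Pout sepOut)
  (hFin : IsDownClosedFamily Finn) (hFout : IsDownClosedFamily Fout)
  (hPin : IsRelaxation Finn Pin) (hPout : IsRelaxation Fout Pout)
  (hp : ∀ e, 0 ≤ p e ∧ p e ≤ 1) (hf : IsMonotoneSubmodular f)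
include hb hb1 hOin hOout hsepIn hsepOut hFin hFout hPin hPout hp hf

/-- How far the value of the fractional solution `y` falls short of `V`. -/
def deficit (f : Finset (Fin n) → ℝ) (p : Fin n → ℝ) (V : ℝ) (y : Fin n → ℝ) : ℝ :=
  max (V - setExp (fun e => y e * p e) f) 0

/-- One step of the greedy method with inexact weights. -/
lemma deficit_step_le (hn5 : 5 ≤ n) {T : ProbeTree (Fin n)} (hT : T.Legal Finn Fout)
    {y acc : Fin n → ℝ} (hy : ∀ e, 0 ≤ y e ∧ y e + b / (n * n) ≤ 1) (hacc : ∀ e, 0 ≤ acc e) :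
    deficit f p (T.value p f) (fun e => y e + b / (n * n) *
      perceptronBest O (fun e => acc e * (p e * flagVec O n e)) p (flagVec O n) e) ≤
      (1 - b / (n * n) * (1 - 2 / n)) * deficit f p (T.value p f) y +
        2 * (b / (n * n)) / n ^ 4 * ∑ e, |acc e * (p e * flagVec O n e) -
          n ^ 4 * (p e * flagVec O n e * expGain f (fun e => y e * p e) e)| := by
  have hn5' : (5 : ℝ) ≤ n := by exact_mod_cast hn5
  have hn0 : (0 : ℝ) < n := by linarith
  set s : ℝ := b / (n * n) with hs
  set flag := flagVec O n with hflag
  set x : Fin n → ℝ := fun e => y e * p e with hx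
  set g := expGain f x with hg
  set w : Fin n → ℝ := fun e => acc e * (p e * flag e) with hw
  set d := perceptronBest O w p flag with hd
  set Δ := ∑ e, |w e - n ^ 4 * (p e * flag e * g e)| with hΔ
  set z := T.probeProb p with hz
  set V := T.value p f with hV
  have hs0 : 0 ≤ s := by positivity
  have hsn : s * n ≤ 1 / n := by
    have : s * n = b / n := by rw [hs]; field_simp
    rw [this]; gcongr
  have hninv : 1 / (n : ℝ) ≤ 1 := by rw [div_le_one hn0]; linarith
  have hs1 : s ≤ 1 := by nlinarith
  have hy01 : ∀ e, 0 ≤ y e ∧ y e ≤ 1 := fun e => ⟨(hy e).1, by linarith [(hy e).2]⟩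
  have hx01 : ∀ e, 0 ≤ x e ∧ x e ≤ 1 := fun e =>
    ⟨mul_nonneg (hy01 e).1 (hp e).1, mul_le_one₀ (hy01 e).2 (hp e).1 (hp e).2⟩
  have hfl := flagVec_eq (O := O) (n := n)
  have hfl01 : ∀ e, 0 ≤ flag e ∧ flag e ≤ 1 := fun e => by
    rcases hfl e with h | h <;> rw [hflag, h] <;> norm_num
  have hw0 : ∀ e, 0 ≤ w e := fun e =>
    mul_nonneg (hacc e) (mul_nonneg (hp e).1 (hfl01 e).1)
  have hwfl : ∀ e, flag e = 0 → w e = 0 := fun e he => by simp [hw, he]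
  have hg0 : ∀ e, 0 ≤ g e := expGain_nonneg hf hx01
  obtain ⟨hdmem, hdfl⟩ := perceptronBest_mem (p := p) hOin hOout hsepIn hsepOut hFin hFout hPin
    hPout (by omega) hwfl
  have hd01 : ∀ e, 0 ≤ d e ∧ d e ≤ 1 := hPout.subset_cube _ hdmem.1
  have hzmem := hT.probeProb_mem hp
  -- No legal strategy probes an unmarked element, so restricting the optimization to marked ones
  -- loses nothing.
  have hzfl : ∀ e, flag e = 0 → z e = 0 := by
    intro e he
    refine hT.probeProb_eq_zero hFin hFout p fun h => ?_
    refine (flagVec_ne_zero_iff hOin hOout hsepIn hsepOut e).2 ⟨?_, ?_⟩ he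
    · exact (hPin.singleton_mem_iff hFin).2 h.1
    · exact (hPout.singleton_mem_iff hFout).2 h.2
  have hz01 : ∀ e, 0 ≤ z e ∧ z e ≤ 1 :=
    hPout.subset_cube _ (hPout.feasiblePolytope_subset hzmem.1)
  have hbest := perceptronBest_ge (p := p) (flag := flag) (by omega) hOin hOout hsepIn hsepOut hn5
    hPin.convex hPout.convex (hPin.zero_mem hFin) (hPout.zero_mem hFout) hPout.subset_cube hp hfl
    (fun e he => (flagVec_ne_zero_iff hOin hOout hsepIn hsepOut e).1 he) hw0 hwfl
    (hPout.feasiblePolytope_subset hzmem.1) (hPin.feasiblePolytope_subset hzmem.2) hzfl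
  rw [← hd] at hbest
  -- Estimated and true objective differ by at most `Δ`, up to the scale `n ^ 4`. This is used once
  -- for the direction `d` found and once for the benchmark `z`, whence `2 * Δ` below.
  have hclose : ∀ v : Fin n → ℝ, (∀ e, 0 ≤ v e ∧ v e ≤ 1) → (∀ e, flag e = 0 → v e = 0) →
      |∑ e, w e * v e - n ^ 4 * ∑ e, p e * v e * g e| ≤ Δ := by
    intro v hv hvfl
    rw [Finset.mul_sum, ← Finset.sum_sub_distrib]
    refine (Finset.abs_sum_le_sum_abs _ _).trans (Finset.sum_le_sum fun e _ => ?_)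
    have : w e * v e - n ^ 4 * (p e * v e * g e) = (w e - n ^ 4 * (p e * flag e * g e)) * v e := by
      rcases hfl e with h | h
      · rw [hvfl e h]; ring
      · simp only [hflag, h]; ring
    rw [this, abs_mul, abs_of_nonneg (hv e).1]
    exact mul_le_of_le_one_right (abs_nonneg _) (hv e).2
  have hcd := (abs_le.1 (hclose d hd01 hdfl)).2
  have hcz := (abs_le.1 (hclose z hz01 hzfl)).1
  have hval : V ≤ setExp x f + ∑ e, p e * z e * g e := T.value_le hp hx01 hf
  have hΔ0 : 0 ≤ Δ := Finset.sum_nonneg fun _ _ => abs_nonneg _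
  set M : ℝ := (n : ℝ) ^ 4 with hM
  have hM0 : 0 < M := by positivity
  set G := ∑ e, p e * d e * g e with hG
  have hG0 : 0 ≤ G := Finset.sum_nonneg fun e _ => mul_nonneg (mul_nonneg (hp e).1 (hd01 e).1) (hg0 e)
  set Z := ∑ e, p e * z e * g e with hZ
  have hGZ : (1 - 1 / (n : ℝ)) * Z - 2 * Δ / M ≤ G := by
    have h1 : 0 ≤ 1 / (n : ℝ) := by positivity
    have h2 : (1 - 1 / (n : ℝ)) * (M * Z - Δ) ≤ (1 - 1 / (n : ℝ)) * ∑ e, w e * z e :=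
      mul_le_mul_of_nonneg_left (by linarith) (by linarith)
    have h3 : M * ((1 - 1 / (n : ℝ)) * Z - 2 * Δ / M) ≤ M * G := by
      have : M * (2 * Δ / M) = 2 * Δ := by field_simp
      nlinarith
    exact le_of_mul_le_mul_left h3 hM0
  have hpd : ∀ e, 0 ≤ p e * d e ∧ p e * d e ≤ 1 := fun e =>
    ⟨mul_nonneg (hp e).1 (hd01 e).1, mul_le_one₀ (hp e).2 (hd01 e).1 (hd01 e).2⟩
  have hstep := setExp_step hf (u := x) (d := fun e => p e * d e) hs0 hs1 hpd hx01 (fun e => by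
    have h1 : s * d e ≤ s := mul_le_of_le_one_right hs0 (hd01 e).2
    have h2 : x e + s * (p e * d e) = (y e + s * d e) * p e := by simp only [hx]; ring
    rw [h2]
    exact mul_le_one₀ (by linarith [(hy e).2]) (hp e).1 (hp e).2)
  have hx' : (fun e => x e + s * (p e * d e)) = fun e => (y e + s * d e) * p e := by
    funext e; simp only [hx]; ring
  rw [hx', Fintype.card_fin] at hstep
  change setExp x f + s * (1 - s * n) * G ≤ _ at hstep
  -- A step of length at most `1 / n ^ 2` loses a factor `1 - 1 / n` to collisions. The approximate
  -- optimization loses another, and `(1 - q) ^ 2 ≥ 1 - 2 * q` combines them.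
  have h1 : s * ((1 - 1 / (n : ℝ)) * G) ≤ s * (1 - s * n) * G := by
    rw [mul_assoc]
    exact mul_le_mul_of_nonneg_left (mul_le_mul_of_nonneg_right (by linarith) hG0) hs0
  set F := setExp x f with hF
  set F' := setExp (fun e => (y e + s * d e) * p e) f with hF'
  have hdiv : 0 ≤ 2 * Δ / M := by positivity
  have herr : 2 * s / M * Δ = s * (2 * Δ / M) := by ring
  have hρ : 0 ≤ 1 - s * (1 - 2 / (n : ℝ)) := by
    have : 0 ≤ 2 / (n : ℝ) := by positivity
    nlinarith
  change max (V - F') 0 ≤ (1 - s * (1 - 2 / (n : ℝ))) * max (V - F) 0 + 2 * s / M * Δ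
  rw [herr]
  set q := 1 / (n : ℝ) with hq
  have hq0 : 0 ≤ q := by positivity
  have h2q : 2 / (n : ℝ) = 2 * q := by rw [hq]; ring
  rw [h2q] at hρ ⊢
  -- Once the value has reached `V` it stays there, as steps never decrease it. Truncating the
  -- deficit at `0` keeps it a non-negative potential.
  rcases le_total V F with hVF | hVF
  · have : V ≤ F' := by nlinarith [mul_nonneg hs0 (mul_nonneg (sub_nonneg.2 hninv) hG0)]
    rw [max_eq_right (by linarith), max_eq_right (by linarith)]
    have := mul_nonneg hs0 hdiv
    linarith
  · rw [max_eq_left (by linarith : 0 ≤ V - F)]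
    refine max_le ?_ (add_nonneg (mul_nonneg hρ (by linarith)) (mul_nonneg hs0 hdiv))
    have h3 : (1 - q) * ((1 - q) * (V - F) - 2 * Δ / M) ≤ (1 - q) * G := by
      refine mul_le_mul_of_nonneg_left (le_trans ?_ hGZ) (by linarith)
      have : (1 - q) * (V - F) ≤ (1 - q) * Z := mul_le_mul_of_nonneg_left (by linarith) (by linarith)
      linarith
    have h4 : (1 - 2 * q) * (V - F) - 2 * Δ / M ≤ (1 - q) * G := by
      refine le_trans ?_ h3
      nlinarith [mul_nonneg hq0 hdiv, mul_nonneg (mul_nonneg hq0 hq0) (sub_nonneg.2 hVF)]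
    have h5 := mul_le_mul_of_nonneg_left h4 hs0
    have h6 : (1 - s * (1 - 2 * q)) * (V - F) = V - F - s * ((1 - 2 * q) * (V - F)) := by ring
    rw [mul_sub s] at h5
    rw [h6]
    linarith

omit hb hb1 hOin hOout hsepIn hsepOut hFin hFout hPin hp hf in
lemma mem_scaled_cube {c : ℝ} (hc : 0 ≤ c) {y : Fin n → ℝ} (hy : y ∈ c • probePolytope Pin Pout p)
    (e : Fin n) : 0 ≤ y e ∧ y e ≤ c := by
  obtain ⟨v, hv, rfl⟩ := hy
  have := hPout.subset_cube v hv.1 e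
  exact ⟨mul_nonneg hc this.1, mul_le_of_le_one_right hc this.2⟩

/-- One step adds an expected error of at most `2 * s / n ^ 4` times `n` deviations of `V * n ^ 2`,
that is `2 * s * V / n`; over `n ^ 2` steps this makes `2 * b * V / n`. The assumption `hsingle`
ties the size of a sample to `V`. -/
lemma lexp_deficit_le (hn5 : 5 ≤ n) {T : ProbeTree (Fin n)} (hT : T.Legal Finn Fout)
    (hV : 0 < T.value p f)
    (hsingle : ∀ e, {e} ∈ Finn → {e} ∈ Fout → p e * (f {e} - f ∅) ≤ T.value p f) :
    lexp (greedyLaw O f b p) (fun y => ENNReal.ofReal (deficit f p (T.value p f) y)) ≤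
      ENNReal.ofReal ((1 - b / (n * n) * (1 - 2 / n)) ^ (n ^ 2) * T.value p f +
        2 * b / n * T.value p f) := by
  have hn5' : (5 : ℝ) ≤ n := by exact_mod_cast hn5
  have hn0 : (0 : ℝ) < n := by linarith
  set V := T.value p f with hVdef
  set s : ℝ := b / (n * n) with hs
  have hs0 : 0 ≤ s := by positivity
  have hsn : s * n ^ 2 = b := by rw [hs]; field_simp
  have hs1 : s ≤ 1 := by nlinarith
  have h2n : 2 / (n : ℝ) ≤ 1 := by rw [div_le_one hn0]; linarith
  have h2n0 : 0 ≤ 2 / (n : ℝ) := by positivity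
  have hx01 : ∀ y : Fin n → ℝ, (∀ e, 0 ≤ y e ∧ y e ≤ 1) → ∀ e, 0 ≤ y e * p e ∧ y e * p e ≤ 1 :=
    fun y hy e => ⟨mul_nonneg (hy e).1 (hp e).1, mul_le_one₀ (hy e).2 (hp e).1 (hp e).2⟩
  have hD0 : ∀ y, 0 ≤ deficit f p V y := fun y => le_max_right _ _
  have hmain := lexp_iterLaw_le (K := greedyKernel O f b p (flagVec O n))
    (fun k y => y ∈ ((k : ℝ) * s) • probePolytope Pin Pout p) (m := n ^ 2) (D := deficit f p V)
    (ρ := 1 - s * (1 - 2 / n)) (c := 2 * s / n * V) (by nlinarith) (by nlinarith) (by positivity) hD0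
    (fun k _ a ha => greedyKernel_support hOin hOout hsepIn hsepOut hFin hFout hPin hPout hb k a ha)
    (by
      intro k hk y hy
      have hks : ((k : ℝ) + 1) * s ≤ 1 := by
        -- Before the last step there is still room for one step below `1`, as the step lengths sum
        -- to `b ≤ 1`.
        have : ((k : ℝ) + 1) ≤ n ^ 2 := by exact_mod_cast hk
        nlinarith
      have hy' : ∀ e, 0 ≤ y e ∧ y e + s ≤ 1 := by
        intro e
        have := mem_scaled_cube hPout (by positivity) hy e
        exact ⟨this.1, by linarith [this.2]⟩
      have hy01 : ∀ e, 0 ≤ y e ∧ y e ≤ 1 := fun e => ⟨(hy' e).1, by linarith [(hy' e).2]⟩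
      rw [greedyKernel, lexp_map]
      have hfl := flagVec_eq (O := O) (n := n)
      set x : Fin n → ℝ := fun e => y e * p e with hx
      set Δ : (Fin n → ℝ) → Fin n → ℝ := fun acc e => |acc e * (p e * flagVec O n e) -
          n ^ 4 * (p e * flagVec O n e * expGain f x e)| with hΔ
      have hρ : 0 ≤ (1 - s * (1 - 2 / (n : ℝ))) * deficit f p V y :=
        mul_nonneg (by nlinarith) (hD0 y)
      calc lexp (estimateLaw f x) _ ≤ lexp (estimateLaw f x) fun acc =>
            ENNReal.ofReal ((1 - s * (1 - 2 / (n : ℝ))) * deficit f p V y) +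
              ENNReal.ofReal (2 * s / n ^ 4) * ∑ e, ENNReal.ofReal (Δ acc e) := by
            refine lexp_mono fun acc hacc => ?_
            rw [← ENNReal.ofReal_sum_of_nonneg fun e _ => abs_nonneg _,
              ← ENNReal.ofReal_mul (by positivity), ← ENNReal.ofReal_add hρ
                (mul_nonneg (by positivity) (Finset.sum_nonneg fun e _ => abs_nonneg _))]
            exact ENNReal.ofReal_le_ofReal (deficit_step_le hb hb1 hOin hOout hsepIn hsepOut hFin
              hFout hPin hPout hp hf hn5 hT hy' (estimateLaw_nonneg hf x acc hacc))
        _ = ENNReal.ofReal ((1 - s * (1 - 2 / (n : ℝ))) * deficit f p V y) +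
              ENNReal.ofReal (2 * s / n ^ 4) *
                ∑ e, lexp (estimateLaw f x) fun acc => ENNReal.ofReal (Δ acc e) := by
            rw [lexp_add, lexp_const, lexp_const_mul, lexp_sum]
        _ ≤ ENNReal.ofReal ((1 - s * (1 - 2 / (n : ℝ))) * deficit f p V y) +
              ENNReal.ofReal (2 * s / n ^ 4) * ∑ _e : Fin n, ENNReal.ofReal (V * n ^ 2) := by
            gcongr with e
            refine lexp_estimate_le hf (by omega) (hx01 y hy01) e ?_ hV ?_
            · refine mul_nonneg (hp e).1 ?_
              rcases hfl e with h | h <;> rw [h]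
              norm_num
            · rcases hfl e with h | h
              · rw [h, mul_zero, zero_mul]; exact hV.le
              · rw [h, mul_one]
                have h1 := (flagVec_ne_zero_iff hOin hOout hsepIn hsepOut e).1 (by rw [h]; norm_num)
                exact hsingle e ((hPin.singleton_mem_iff hFin).1 h1.1)
                  ((hPout.singleton_mem_iff hFout).1 h1.2)
        _ = _ := by
            rw [← ENNReal.ofReal_sum_of_nonneg fun e _ => by positivity,
              ← ENNReal.ofReal_mul (by positivity), ← ENNReal.ofReal_add hρ (by positivity)]
            congr 1
            simp only [Finset.sum_const, Finset.card_univ, Fintype.card_fin, nsmul_eq_mul]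
            field_simp)
    (n ^ 2) 0 (by omega) (fun _ => 0) (by
      refine ⟨0, ⟨hPout.zero_mem hFout, ?_⟩, ?_⟩
      · convert hPin.zero_mem hFin using 1
        funext e
        simp
      · funext e
        simp)
  refine hmain.trans (ENNReal.ofReal_le_ofReal ?_)
  have hDV : deficit f p V (fun _ => 0) ≤ V := by
    refine max_le ?_ hV.le
    have := setExp_nonneg (x := fun e => 0 * p e) (fun e => by simp) hf.nonneg
    linarith
  have hρ0 : 0 ≤ (1 - s * (1 - 2 / (n : ℝ))) ^ (n ^ 2) := pow_nonneg (by nlinarith) _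
  have h1 := mul_le_mul_of_nonneg_left hDV hρ0
  have h2 : ((n ^ 2 : ℕ) : ℝ) * (2 * s / n * V) = 2 * b / n * V := by
    rw [← hsn]; push_cast; ring
  rw [h2]
  linarith

omit hb hb1 hOin hOout hsepIn hsepOut hFout hPin hPout in
/-- The best among a tree and the trees that probe a single element. -/
lemma exists_tree_ge {T : ProbeTree (Fin n)} (hT : T.Legal Finn Fout) :
    ∃ T' : ProbeTree (Fin n), T'.Legal Finn Fout ∧ T.value p f ≤ T'.value p f ∧
      ∀ e, {e} ∈ Finn → {e} ∈ Fout → p e * (f {e} - f ∅) ≤ T'.value p f := by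
  set tree : Option (Fin n) → ProbeTree (Fin n) := fun o =>
    o.elim T fun e => .probe e .halt .halt with htree
  -- `none` stands for `T`, and `some e` for probing only `e`; the maximum is over the legal ones
  -- among these finitely many trees.
  obtain ⟨o, ho, hmax⟩ := Finset.exists_max_image
    (Finset.univ.filter fun o => (tree o).Legal Finn Fout) (fun o => (tree o).value p f)
    ⟨none, by simpa [htree] using hT⟩
  refine ⟨tree o, (Finset.mem_filter.1 ho).2, hmax none (by simpa [htree] using hT), fun e h1 h2 => ?_⟩
  refine le_trans ?_ (hmax (some e) ?_)
  · change _ ≤ setExp p fun A => f ((ProbeTree.probe e .halt .halt).selected A)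
    calc p e * (f {e} - f ∅) = setExp p (fun A => if e ∈ A then f {e} - f ∅ else 0) :=
          by
            have := (setExp_ite_mem p e (fun _ => f {e} - f ∅) fun _ => rfl).symm
            rw [setExp_const] at this
            convert this
      _ ≤ _ := by
          refine setExp_mono hp fun A => ?_
          have h0 := hf.nonneg ∅
          split_ifs with h
          · have : (ProbeTree.probe e .halt .halt).selected A = {e} := by
              ext a
              simp only [ProbeTree.selected, ProbeTree.probed, ite_self, Finset.mem_inter,
                Finset.mem_insert, Finset.notMem_empty, or_false, Finset.mem_singleton]
              exact ⟨fun h' => h'.1, fun h' => ⟨h', h' ▸ h⟩⟩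
            rw [this]
            linarith
          · exact hf.nonneg _
  · refine Finset.mem_filter.2 ⟨Finset.mem_univ _, fun A => ?_⟩
    have hprobed : (ProbeTree.probe e .halt .halt).probed A = {e} := by
      ext a
      simp [ProbeTree.probed]
    refine ⟨by simpa [htree, hprobed] using h2, hFin.down _ h1 _ ?_⟩
    intro a ha
    simp only [htree, Option.elim, ProbeTree.selected, hprobed, Finset.mem_inter] at ha
    exact ha.1

omit hOin hOout hsepIn hsepOut hFin hFout hPin hPout hp hf in
-- The power is at most `exp (-b + b * q)` with `q = 2 / n`. Multiplying this by `1 - b * q ≤ exp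
-- (-(b * q))` gives at most `exp (-b)`, and the missing part is at most `b * q ≤ q` because the
-- exponential is at most `1`.
lemma pow_contraction_le (hn5 : 5 ≤ n) :
    (1 - b / (n * n) * (1 - 2 / n)) ^ (n ^ 2) ≤ Real.exp (-b) + 2 / n := by
  have hn5' : (5 : ℝ) ≤ n := by exact_mod_cast hn5
  have hn0 : (0 : ℝ) < n := by linarith
  have hq1 : 2 / (n : ℝ) ≤ 1 := by rw [div_le_one hn0]; linarith
  have hq0 : 0 ≤ 2 / (n : ℝ) := by positivity
  set q := 2 / (n : ℝ) with hq
  set s : ℝ := b / (n * n) with hs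
  have hs0 : 0 ≤ s := by positivity
  have hsn : s * n ^ 2 = b := by rw [hs]; field_simp
  have hs1 : s ≤ 1 := by nlinarith
  calc (1 - s * (1 - q)) ^ (n ^ 2) ≤ Real.exp (-(s * (1 - q))) ^ (n ^ 2) :=
        pow_le_pow_left₀ (by nlinarith) (Real.one_sub_le_exp_neg _) _
    _ = Real.exp (-b + b * q) := by
        rw [← Real.exp_nat_mul]
        congr 1
        rw [← hsn]
        push_cast
        ring
    _ ≤ Real.exp (-b) + 2 / n := by
        have h1 : Real.exp (-b + b * q) * (1 - b * q) ≤ Real.exp (-b) := by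
          calc Real.exp (-b + b * q) * (1 - b * q)
              ≤ Real.exp (-b + b * q) * Real.exp (-(b * q)) :=
                mul_le_mul_of_nonneg_left (Real.one_sub_le_exp_neg _) (Real.exp_pos _).le
            _ = Real.exp (-b) := by rw [← Real.exp_add]; congr 1; ring
        have h2 : Real.exp (-b + b * q) ≤ 1 := Real.exp_le_one_iff.2 (by nlinarith)
        have h3 : Real.exp (-b + b * q) * (b * q) ≤ q := by
          have : b * q ≤ q := mul_le_of_le_one_left hq0 hb1
          nlinarith [mul_nonneg hb hq0, (Real.exp_pos (-b + b * q)).le]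
        linarith

/-- The greedy method finds a fractional solution of nearly optimal value in expectation. -/
theorem lexp_greedyLaw_ge {T : ProbeTree (Fin n)} (hT : T.Legal Finn Fout) :
    ENNReal.ofReal ((1 - Real.exp (-b) - 8 / ((n : ℝ) + 1)) * T.value p f) ≤
      lexp (greedyLaw O f b p) fun y => ENNReal.ofReal (setExp (fun e => y e * p e) f) := by
  have hexp : 0 < Real.exp (-b) := Real.exp_pos _
  obtain ⟨T', hT', hTT', hsingle⟩ := exists_tree_ge hFin hp hf hT
  have hT0 := T.value_nonneg hp hf
  -- For small `n` the perceptron guarantees nothing, but then `8 / (n + 1) ≥ 1` and the claim is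
  -- empty.
  rcases lt_or_ge n 5 with hn | hn5
  · have h8 : (1 : ℝ) ≤ 8 / ((n : ℝ) + 1) := by
      have : (n : ℝ) ≤ 4 := by exact_mod_cast (by omega : n ≤ 4)
      rw [le_div_iff₀ (by positivity)]
      linarith
    rw [ENNReal.ofReal_eq_zero.2 (mul_nonpos_of_nonpos_of_nonneg (by linarith) hT0)]
    exact zero_le
  have hn5' : (5 : ℝ) ≤ n := by exact_mod_cast hn5
  have hn0 : (0 : ℝ) < n := by linarith
  set V := T'.value p f with hV
  rcases (hT0.trans hTT').eq_or_lt with h0 | hVpos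
  · rw [le_antisymm (h0 ▸ hTT') hT0, mul_zero, ENNReal.ofReal_zero]
    exact zero_le
  have h4 : 4 / (n : ℝ) ≤ 8 / (n + 1) := by
    rw [div_le_div_iff₀ hn0 (by positivity)]
    linarith
  -- Only a non-negative factor allows replacing the value of `T` by the larger `V`.
  by_cases hneg : 1 - Real.exp (-b) - 8 / ((n : ℝ) + 1) ≤ 0
  · rw [ENNReal.ofReal_eq_zero.2 (mul_nonpos_of_nonpos_of_nonneg hneg hT0)]
    exact zero_le
  have hdef := lexp_deficit_le hb hb1 hOin hOout hsepIn hsepOut hFin hFout hPin hPout hp hf hn5 hT'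
    hVpos hsingle
  have hbound : (1 - b / (n * n) * (1 - 2 / n)) ^ (n ^ 2) * V + 2 * b / n * V ≤
      (Real.exp (-b) + 4 / n) * V := by
    rw [← add_mul]
    refine mul_le_mul_of_nonneg_right ?_ hVpos.le
    have h1 := pow_contraction_le hb hb1 hn5
    have h2 : 2 * b / (n : ℝ) ≤ 2 / n := by gcongr; linarith
    have h3 : 4 / (n : ℝ) = 2 / n + 2 / n := by ring
    linarith
  have hdef' := hdef.trans (ENNReal.ofReal_le_ofReal hbound)
  have hsum : ENNReal.ofReal V ≤
      lexp (greedyLaw O f b p) (fun y => ENNReal.ofReal (setExp (fun e => y e * p e) f)) +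
        ENNReal.ofReal ((Real.exp (-b) + 4 / n) * V) := by
    calc ENNReal.ofReal V = lexp (greedyLaw O f b p) fun _ => ENNReal.ofReal V :=
          (lexp_const _ _).symm
      _ ≤ lexp (greedyLaw O f b p) fun y => ENNReal.ofReal (setExp (fun e => y e * p e) f) +
            ENNReal.ofReal (deficit f p V y) := by
          refine lexp_mono fun y _ => ?_
          refine le_trans (ENNReal.ofReal_le_ofReal ?_) ENNReal.ofReal_add_le
          have := le_max_left (V - setExp (fun e => y e * p e) f) 0
          simp only [deficit]
          linarith
      _ ≤ _ := by
          rw [lexp_add]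
          gcongr
  have hc0 : 0 ≤ (Real.exp (-b) + 4 / n) * V := by positivity
  have h6 : ENNReal.ofReal (V - (Real.exp (-b) + 4 / n) * V) ≤
      lexp (greedyLaw O f b p) fun y => ENNReal.ofReal (setExp (fun e => y e * p e) f) := by
    rw [ENNReal.ofReal_sub _ hc0]
    exact tsub_le_iff_right.2 hsum
  refine le_trans (ENNReal.ofReal_le_ofReal ?_) h6
  have h7 := mul_le_mul_of_nonneg_left hTT' (le_of_not_ge hneg)
  have h8 : (1 - Real.exp (-b) - 8 / ((n : ℝ) + 1)) * V ≤ (1 - Real.exp (-b) - 4 / n) * V :=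
    mul_le_mul_of_nonneg_right (by linarith) hVpos.le
  linarith

end

/-! ### Polynomial bounds -/

/-- Bounded by a polynomial. -/
def PolyBounded (t : ℕ → ℕ) : Prop := ∃ q : Polynomial ℕ, ∀ m, t m ≤ q.eval m

namespace PolyBounded

variable {t u : ℕ → ℕ}

lemma const (c : ℕ) : PolyBounded fun _ => c := ⟨Polynomial.C c, fun m => by simp⟩

lemma id : PolyBounded fun m => m := ⟨Polynomial.X, fun m => by simp⟩

lemma add (h : PolyBounded t) (h' : PolyBounded u) : PolyBounded fun m => t m + u m := by
  obtain ⟨q, hq⟩ := h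
  obtain ⟨r, hr⟩ := h'
  exact ⟨q + r, fun m => by rw [Polynomial.eval_add]; exact add_le_add (hq m) (hr m)⟩

lemma mul (h : PolyBounded t) (h' : PolyBounded u) : PolyBounded fun m => t m * u m := by
  obtain ⟨q, hq⟩ := h
  obtain ⟨r, hr⟩ := h'
  exact ⟨q * r, fun m => by rw [Polynomial.eval_mul]; exact Nat.mul_le_mul (hq m) (hr m)⟩

lemma loopPow (h : PolyBounded t) (z k : ℕ) : PolyBounded fun m => loopPowTime z m (t m) k := by
  induction k with
  | zero => exact h
  | succ k ih => exact ((const z).add (id.mul (ih.add (const 1)))).add (const 1)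

end PolyBounded

/-- Natural coefficients make polynomials monotone, so bounds in `n` pass to bounds in the instance
size. -/
lemma polynomial_eval_mono (q : Polynomial ℕ) {m m' : ℕ} (h : m ≤ m') : q.eval m ≤ q.eval m' := by
  rw [Polynomial.eval_eq_sum_range, Polynomial.eval_eq_sum_range]
  gcongr

lemma polyBounded_prepareTime : PolyBounded fun n => prepareTime n 0 := by
  have hc := PolyBounded.const
  have hi := PolyBounded.id
  have h1 : PolyBounded sampleStepTime := ((hi.mul hi).add (hi.mul (hc 60))).add (hc 20)
  have h2 : PolyBounded estimateTime :=
    (((((((hc 2).mul hi).add (hc 2)).add h1).add hi).add (hc 1)).loopPow 1 4 |>.add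
      (hi.mul (hc 60))).add (hc 60)
  have h3 : PolyBounded perceptronTime :=
    ((((hi.mul (hc 240)).add (hc 300)).loopPow 1 6).add (hi.mul (hc 60))).add (hc 60)
  have h4 : PolyBounded greedyStepTime := ((h2.add h3).add (hi.mul (hc 60))).add (hc 60)
  exact (((((((((hc 3).mul hi).add (hc 5)).add h4).add hi).add (hc 1)).loopPow 1 2).add
    (hi.mul (((hc 4).mul hi).add (hc 40)))).add (hi.mul (hc 100))).add (hc (0 * 100)) |>.add (hc 200)

/-! ### The polynomial time algorithm -/

section
variable {O : OracleName → List ℝ → List ℝ} {acc : List ℝ → List ℝ} {c : Cmd Unit}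
  {L : List (List ℝ)} {t : ℕ}

/-- The time of `runRandom` includes the length of the output, so one bound controls both the steps
and the size of the description. -/
lemma computesP_runRandom (hO : O .constraints = acc)
    (h : ∀ r ∈ (c.runRandom (fun _ => acc) L).support, r.2 ≤ t) :
    ComputesP O (c.mapOracle fun _ => .constraints) L
      ((c.runRandom (fun _ => acc) L).map Prod.fst) t ∧
      ∀ l ∈ ((c.runRandom (fun _ => acc) L).map Prod.fst).support, l.length ≤ t := by
  subst hO
  have e := c.exec_mapOracle (M := PMF) biasedCoin O (fun _ => .constraints) (Store.ofLists L)
  have hmem : ∀ q ∈ (c.exec (M := PMF) biasedCoin (fun _ => O .constraints)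
      (Store.ofLists L)).support, q.2 + (q.1.block 0).length ≤ t := by
    intro q hq
    refine h (q.1.block 0, q.2 + (q.1.block 0).length) ?_
    rw [Cmd.runRandom, PMF.mem_support_map_iff]
    exact ⟨q, hq, rfl⟩
  refine ⟨⟨?_, ?_⟩, ?_⟩
  · rw [e, Cmd.runRandom, PMF.map_comp]
    rfl
  · intro q hq
    rw [e] at hq
    exact le_trans (Nat.le_add_right _ _) (hmem q hq)
  · intro l hl
    rw [Cmd.runRandom, PMF.map_comp, PMF.mem_support_map_iff] at hl
    obtain ⟨q, hq, rfl⟩ := hl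
    exact le_trans (Nat.le_add_left _ _) (hmem q hq)

lemma computes_runDet (hO : O .constraints = acc) (h : (c.runDet (fun _ => acc) L).2 ≤ t) :
    Computes O (c.mapOracle fun _ => .constraints) L (c.runDet (fun _ => acc) L).1 t ∧
      (c.runDet (fun _ => acc) L).1.length ≤ t := by
  subst hO
  have e := c.exec_mapOracle (M := Id) (fun _ => false) O (fun _ => .constraints) (Store.ofLists L)
  have e' : (c.mapOracle fun _ => OracleName.constraints).det O (Store.ofLists L) =
    c.exec (M := Id) (fun _ => false) (fun _ => O .constraints) (Store.ofLists L) := e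
  refine ⟨⟨?_, ?_⟩, ?_⟩
  · rw [e']; rfl
  · rw [e']; exact le_trans (Nat.le_add_right _ _) h
  · exact le_trans (Nat.le_add_left _ _) h

lemma Computes.runDet {c : Cmd OracleName} {out : List ℝ} (h : Computes O c L out t) :
    (c.runDet O L).1 = out ∧ (c.runDet O L).2 ≤ t + out.length := by
  refine ⟨h.1, ?_⟩
  change (c.det O (Store.ofLists L)).2 + ((c.det O (Store.ofLists L)).1.block 0).length ≤ _
  rw [h.1]
  exact Nat.add_le_add_right h.2 _

lemma ComputesP.runRandom {c : Cmd OracleName} {μ : PMF (List ℝ)} (h : ComputesP O c L μ t) :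
    (c.runRandom O L).map Prod.fst = μ ∧ ∀ r ∈ (c.runRandom O L).support,
      r.1 ∈ μ.support ∧ r.2 ≤ t + r.1.length := by
  constructor
  · rw [Cmd.runRandom, PMF.map_comp, ← h.law]
    rfl
  · intro r hr
    rw [Cmd.runRandom, PMF.mem_support_map_iff] at hr
    obtain ⟨q, hq, rfl⟩ := hr
    refine ⟨?_, Nat.add_le_add_right (h.time q hq) _⟩
    rw [← h.law, PMF.mem_support_map_iff]
    exact ⟨q, hq, rfl⟩

end

section
variable {n : ℕ}

/-- The family that an independence oracle describes. -/
def testFamily (test : Cmd Unit) (acc : List ℝ → List ℝ) (r : List ℝ) : Finset (Finset (Fin n)) :=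
  Finset.univ.filter fun S => Accepts (test.runDet (fun _ => acc) [setList S, r]).1

/-- On the points of `P`, the two programs implement the scheme in at most `t` steps. -/
def Implements (sample test : Cmd Unit) (acc : List ℝ → List ℝ) {F : Set (Finset (Fin n))}
    {P : Set (Fin n → ℝ)} (π : GreedyOCRS F P) (t : ℕ) : Prop :=
  ∀ x ∈ P, (∀ r ∈ (sample.runRandom (fun _ => acc) [List.ofFn x]).support, r.2 ≤ t ∧
      ∀ S : Finset (Fin n), (test.runDet (fun _ => acc) [setList S, r.1]).2 ≤ t) ∧
    (sample.runRandom (fun _ => acc) [List.ofFn x]).map (fun r => testFamily test acc r.1) = π.fam x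

/-- The descriptions of independence oracles that a program samples. -/
def descriptionLaw (sample : Cmd Unit) (acc : List ℝ → List ℝ) (x : Fin n → ℝ) : PMF (List ℝ) :=
  (sample.runRandom (fun _ => acc) [List.ofFn x]).map Prod.fst

variable {sample test : Cmd Unit} {acc : List ℝ → List ℝ} {F : Set (Finset (Fin n))}
  {P : Set (Fin n → ℝ)} {π : GreedyOCRS F P} {t : ℕ} {x : Fin n → ℝ}

lemma Implements.fam_eq (h : Implements sample test acc π t) (hx : x ∈ P) :
    (descriptionLaw sample acc x).map (testFamily test acc) = π.fam x := by
  rw [descriptionLaw, PMF.map_comp]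
  exact (h x hx).2

lemma Implements.mem (h : Implements sample test acc π t) (hx : x ∈ P) {r : List ℝ}
    (hr : r ∈ (descriptionLaw sample acc x).support) :
    r.length ≤ t ∧ testFamily test acc r ∈ (π.fam x).support ∧
      ∀ S : Finset (Fin n), (test.runDet (fun _ => acc) [setList S, r]).2 ≤ t := by
  refine ⟨?_, ?_, ?_⟩
  · exact (computesP_runRandom (O := fun _ => acc) rfl fun r hr => ((h x hx).1 r hr).1).2 r hr
  · rw [← h.fam_eq hx, PMF.mem_support_map_iff]
    exact ⟨r, hr, rfl⟩
  · rw [descriptionLaw, PMF.mem_support_map_iff] at hr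
    obtain ⟨q, hq, rfl⟩ := hr
    exact ((h x hx).1 q hq).2

end

section
variable {n : ℕ} {O : OracleName → List ℝ → List ℝ} {acc : List ℝ → List ℝ}
  {f : Finset (Fin n) → ℝ} {Finn Fout : Set (Finset (Fin n))} {Pin Pout : Set (Fin n → ℝ)}
  {πin : GreedyOCRS Finn Pin} {πout : GreedyOCRS Fout Pout}
  {sepIn sepOut : (Fin n → ℝ) → Option (Fin n → ℝ)} {p : Fin n → ℝ} {b cin cout : ℝ} {t : ℕ}
  {sampleIn testIn sampleOut testOut : Cmd Unit}

/-- The preparation with the sampling programs of the two schemes. -/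
abbrev Cmd.prepareWith (sampleIn sampleOut : Cmd Unit) : Cmd OracleName :=
  .prepare (sampleIn.mapOracle fun _ => .constraints) (sampleOut.mapOracle fun _ => .constraints)

/-- The online decisions with the independence tests of the two schemes. -/
abbrev Cmd.chooseWith (testIn testOut : Cmd Unit) : Cmd OracleName :=
  .choose (testIn.mapOracle fun _ => .constraints) (testOut.mapOracle fun _ => .constraints)

lemma computes_chooseWith (hO : O .constraints = acc) {rin rout : List ℝ}
    (hrin : rin.length ≤ t) (hrout : rout.length ≤ t)
    (hin : ∀ S : Finset (Fin n), (testIn.runDet (fun _ => acc) [setList S, rin]).2 ≤ t)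
    (hout : ∀ S : Finset (Fin n), (testOut.runDet (fun _ => acc) [setList S, rout]).2 ≤ t)
    (R : Finset (Fin n)) (h : History (Fin n)) (hh : h.length ≤ t) (e : Fin n) :
    Computes O (.chooseWith testIn testOut)
      (decideInput (pairList (setList R) (pairList rin rout)) h e)
      [if e ∈ R ∧ insert e h.selected ∈ testFamily testIn acc rin ∧
        insert e h.probed ∈ testFamily testOut acc rout then 1 else 0] (chooseTime n t) := by
  have := computes_choose (O := O) (testIn := testIn.mapOracle fun _ => .constraints)
    (testOut := testOut.mapOracle fun _ => .constraints) hrin hrout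
    (fun S => computes_runDet hO (hin S)) (fun S => computes_runDet hO (hout S)) R h hh e
  simpa only [testFamily, Finset.mem_filter, Finset.mem_univ, true_and] using this

lemma greedyAt_programAlgorithm (hO : O .constraints = acc) (prepare : Cmd OracleName)
    {rin rout : List ℝ} (hrin : rin.length ≤ t) (hrout : rout.length ≤ t)
    (hin : ∀ S : Finset (Fin n), (testIn.runDet (fun _ => acc) [setList S, rin]).2 ≤ t)
    (hout : ∀ S : Finset (Fin n), (testOut.runDet (fun _ => acc) [setList S, rout]).2 ≤ t)
    (R : Finset (Fin n)) :
    (programAlgorithm prepare (.chooseWith testIn testOut) O b p).GreedyAt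
      (pairList (setList R) (pairList rin rout)) R (testFamily testIn acc rin)
      (testFamily testOut acc rout) := by
  intro h e
  -- Greediness concerns histories of any length, including ones that never occur; enlarging the
  -- time bound makes the program analysis apply to all of them.
  have hm := le_max_left t (List.length h)
  have := (computes_chooseWith hO (t := max t (List.length h)) (hrin.trans hm) (hrout.trans hm)
    (fun S => (hin S).trans hm) (fun S => (hout S).trans hm) R h (le_max_right _ _) e).runDet.1
  change decide (Accepts _) = true ↔ _
  rw [this, decide_eq_true_iff, insert_classical, insert_classical]
  simp [Accepts, and_comm]

variable (hb : 0 ≤ b) (hb1 : b ≤ 1) (hObj : ∀ l, O .objective l = [f (listSet l)])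
  (hOacc : O .constraints = acc) (hOin : O .sepIn = sepAnswer sepIn)
  (hOout : O .sepOut = sepAnswer sepOut)
  (hsepIn : IsSeparationOracle Pin sepIn) (hsepOut : IsSeparationOracle Pout sepOut)
  (hFin : IsDownClosedFamily Finn) (hFout : IsDownClosedFamily Fout)
  (hPin : IsRelaxation Finn Pin) (hPout : IsRelaxation Fout Pout)
  (himpIn : Implements sampleIn testIn acc πin t) (himpOut : Implements sampleOut testOut acc πout t)
include hb hOin hOout hsepIn hsepOut hFin hFout hPin hPout

lemma mem_of_mem_greedyLaw {y : Fin n → ℝ} (hy : y ∈ (greedyLaw O f b p).support) :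
    y ∈ b • Pout ∧ (fun e => y e * p e) ∈ b • Pin := by
  obtain ⟨v, hv, rfl⟩ := greedyLaw_support hOin hOout hsepIn hsepOut hFin hFout hPin hPout hb y hy
  refine ⟨⟨v, hv.1, rfl⟩, ⟨_, hv.2, ?_⟩⟩
  funext e
  simp only [Pi.smul_apply, smul_eq_mul]
  ring

include hb1 hObj hOacc himpIn himpOut

lemma computesP_prepareWith :
    ComputesP O (.prepareWith sampleIn sampleOut) [[b], List.ofFn p]
      ((greedyLaw O f b p).bind fun y => (prodPMF y).bind fun R =>
        (descriptionLaw sampleIn acc fun e => y e * p e).bind fun rin =>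
        (descriptionLaw sampleOut acc y).map fun rout =>
          pairList (setList R) (pairList rin rout)) (prepareTime n t) := by
  refine computesP_prepare hObj (fun l => by rw [hOin]; exact sepAnswer_length _ _)
    (fun l => by rw [hOout]; exact sepAnswer_length _ _) (fun y hy => ?_) fun y hy => ?_
  · have := (mem_of_mem_greedyLaw hb hOin hOout hsepIn hsepOut hFin hFout hPin hPout hy).2
    exact computesP_runRandom hOacc fun r hr =>
      ((himpIn _ (hPin.smul_subset hFin hb hb1 this)).1 r hr).1
  · have := (mem_of_mem_greedyLaw hb hOin hOout hsepIn hsepOut hFin hFout hPin hPout hy).1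
    exact computesP_runRandom hOacc fun r hr =>
      ((himpOut _ (hPout.smul_subset hFout hb hb1 this)).1 r hr).1

/-- The seeds that occur. -/
lemma exists_of_mem_seeds {s : List ℝ}
    (hs : s ∈ (((Cmd.prepareWith sampleIn sampleOut).runRandom O [[b], List.ofFn p]).map
      Prod.fst).support) :
    ∃ y ∈ (greedyLaw O f b p).support, ∃ R : Finset (Fin n),
      ∃ rin ∈ (descriptionLaw sampleIn acc fun e => y e * p e).support,
      ∃ rout ∈ (descriptionLaw sampleOut acc y).support,
        s = pairList (setList R) (pairList rin rout) := by
  rw [(computesP_prepareWith hb hb1 hObj hOacc hOin hOout hsepIn hsepOut hFin hFout hPin hPout himpIn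
    himpOut).runRandom.1] at hs
  simp only [PMF.mem_support_bind_iff, PMF.mem_support_map_iff] at hs
  obtain ⟨y, hy, R, -, rin, hrin, rout, hrout, rfl⟩ := hs
  exact ⟨y, hy, R, rin, hrin, rout, hrout, rfl⟩

lemma runsInTime_programs (hn : n ≤ t) :
    RunsInTime (.prepareWith sampleIn sampleOut) (.chooseWith testIn testOut) O b p
      (prepareTime n t + chooseTime n t + n + 2 * t + 2) := by
  intro r hr
  have hrun := ((computesP_prepareWith hb hb1 hObj hOacc hOin hOout hsepIn hsepOut hFin hFout hPin
    hPout himpIn himpOut).runRandom.2 r hr).2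
  obtain ⟨y, hy, R, rin, hrin, rout, hrout, hs⟩ := exists_of_mem_seeds hb hb1 hObj hOacc hOin hOout
    hsepIn hsepOut hFin hFout hPin hPout himpIn himpOut (s := r.1)
    ((PMF.mem_support_map_iff _ _ _).2 ⟨r, hr, rfl⟩)
  have hmem := mem_of_mem_greedyLaw hb hOin hOout hsepIn hsepOut hFin hFout hPin hPout hy
  obtain ⟨i1, -, i3⟩ := himpIn.mem (hPin.smul_subset hFin hb hb1 hmem.2) hrin
  obtain ⟨o1, -, o3⟩ := himpOut.mem (hPout.smul_subset hFout hb hb1 hmem.1) hrout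
  have hlen : r.1.length = n + rin.length + rout.length + 2 := by
    rw [hs]; simp [pairList, setList_length]; omega
  refine ⟨by omega, fun h hh e => ?_⟩
  rw [hs]
  have := (computes_chooseWith hOacc i1 o1 i3 o3 R h (hh.trans hn) e).runDet.2
  simp only [List.length_singleton] at this
  omega

theorem isApproximation_programs (hp : ∀ e, 0 ≤ p e ∧ p e ≤ 1) (hf : IsMonotoneSubmodular f)
    (hcin : 0 ≤ cin) (hcin1 : cin ≤ 1) (hcout : 0 ≤ cout) (hcout1 : cout ≤ 1)
    (hin : πin.IsSelectable b cin) (hout : πout.IsSelectable b cout) :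
    IsApproximation Finn Fout p f ((1 - Real.exp (-b) - 8 / ((n : ℝ) + 1)) * cin * cout)
      (programAlgorithm (.prepareWith sampleIn sampleOut) (.chooseWith testIn testOut) O b p) := by
  set alg := programAlgorithm (.prepareWith sampleIn sampleOut) (.chooseWith testIn testOut) O b p
    with halg
  have hseed : ∀ y ∈ (greedyLaw O f b p).support, ∀ R : Finset (Fin n),
      ∀ rin ∈ (descriptionLaw sampleIn acc fun e => y e * p e).support,
      ∀ rout ∈ (descriptionLaw sampleOut acc y).support, ∀ (A : Finset (Fin n))
      (l : RevealOrder (Fin n)),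
      (alg.finalHistory (pairList (setList R) (pairList rin rout)) A l).probed ∈ Fout ∧
      (alg.finalHistory (pairList (setList R) (pairList rin rout)) A l).selected ∈ Finn ∧
      survivors (testFamily testIn acc rin) (testFamily testOut acc rout) R A ⊆
        (alg.finalHistory (pairList (setList R) (pairList rin rout)) A l).selected := by
    intro y hy R rin hrin rout hrout A l
    have hmem := mem_of_mem_greedyLaw hb hOin hOout hsepIn hsepOut hFin hFout hPin hPout hy
    have hxin := hPin.smul_subset hFin hb hb1 hmem.2
    have hxout := hPout.smul_subset hFout hb hb1 hmem.1
    obtain ⟨i1, i2, i3⟩ := himpIn.mem hxin hrin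
    obtain ⟨o1, o2, o3⟩ := himpOut.mem hxout hrout
    have hg := greedyAt_programAlgorithm (b := b) (p := p) hOacc
      (Cmd.prepareWith sampleIn sampleOut) i1 o1 i3 o3 R
    obtain ⟨h1, h2, h3⟩ := hg.finalHistory (πin.empty_mem _ hxin _ i2) (πout.empty_mem _ hxout _ o2)
      A l
    exact ⟨πout.subset_feasible _ hxout _ o2 _ h1, πin.subset_feasible _ hxin _ i2 _ h2, h3⟩
  have hlaw := (computesP_prepareWith (p := p) hb hb1 hObj hOacc hOin hOout hsepIn
    hsepOut hFin hFout hPin hPout himpIn himpOut).runRandom.1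
  refine ⟨fun s hs A l => ?_, fun adv T hT => ?_⟩
  · obtain ⟨y, hy, R, rin, hrin, rout, hrout, rfl⟩ := exists_of_mem_seeds hb hb1 hObj hOacc hOin
      hOout hsepIn hsepOut hFin hFout hPin hPout himpIn himpOut hs
    have := hseed y hy R rin hrin rout hrout A l
    exact ⟨this.1, this.2.1⟩
  · have hval := alg.value_ge hp hf adv (greedyLaw O f b p) (fun y => πin.fam fun e => y e * p e)
      (fun y => πout.fam y) (fun y hy => hPout.subset_cube _ (hPout.smul_subset hFout hb hb1
        (mem_of_mem_greedyLaw hb hOin hOout hsepIn hsepOut hFin hFout hPin hPout hy).1))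
      hcin hcin1 hcout hcout1
      (fun y hy e => by
        rw [← GreedyOCRS.selectProb_eq]
        exact hin _ (mem_of_mem_greedyLaw hb hOin hOout hsepIn hsepOut hFin hFout hPin hPout hy).2 e)
      (fun y hy e => by
        rw [← GreedyOCRS.selectProb_eq]
        exact hout _ (mem_of_mem_greedyLaw hb hOin hOout hsepIn hsepOut hFin hFout hPin hPout hy).1
          e)
      (fun A => by
        -- The adversary sees the whole seed, that is `R` and both descriptions; its order may vary
        -- with all of them, and the bound by the survivors holds for each seed separately.
        have e1 : lexp alg.law (fun s => ENNReal.ofReal (f (alg.finalHistory s A (adv s A)).selected)) =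
            lexp (greedyLaw O f b p) fun y => lexp (prodPMF y) fun R =>
              lexp (descriptionLaw sampleIn acc fun e => y e * p e) fun rin =>
              lexp (descriptionLaw sampleOut acc y) fun rout => ENNReal.ofReal
                (f (alg.finalHistory (pairList (setList R) (pairList rin rout)) A
                  (adv (pairList (setList R) (pairList rin rout)) A)).selected) :=
          (congrArg (fun μ : PMF (List ℝ) => lexp μ fun s =>
            ENNReal.ofReal (f (alg.finalHistory s A (adv s A)).selected)) hlaw).trans
            (by simp only [lexp_bind, lexp_map])
        rw [e1]
        refine lexp_mono fun y hy => lexp_mono fun R _ => ?_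
        have hmem := mem_of_mem_greedyLaw hb hOin hOout hsepIn hsepOut hFin hFout hPin hPout hy
        -- Passes from random families to random descriptions of them.
        rw [← himpIn.fam_eq (hPin.smul_subset hFin hb hb1 hmem.2), lexp_map]
        refine lexp_mono fun rin hrin => ?_
        rw [← himpOut.fam_eq (hPout.smul_subset hFout hb hb1 hmem.1), lexp_map]
        refine lexp_mono fun rout hrout => ?_
        exact ENNReal.ofReal_le_ofReal (hf.mono _ _ (hseed y hy R rin hrin rout hrout A _).2.2))
    have hgreedy := lexp_greedyLaw_ge hb hb1 hOin hOout hsepIn hsepOut hFin hFout hPin hPout hp hf hT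
    have hcc : 0 ≤ cin * cout := mul_nonneg hcin hcout
    have := (mul_le_mul_right hgreedy (ENNReal.ofReal (cin * cout))).trans hval
    rw [← ENNReal.ofReal_mul hcc, ENNReal.ofReal_le_ofReal_iff (alg.value_nonneg hp hf adv)] at this
    refine le_trans (le_of_eq ?_) this
    ring

end

end OCRS

end

/-! ### Assembly of both parts. -/

theorem mainTheorem12 :
    ∃ ε : ℕ → ℝ, Tendsto ε atTop (𝓝 0) ∧
      ∀ b cin cout : ℝ, 0 ≤ b → b ≤ 1 → 0 ≤ cin → cin ≤ 1 → 0 ≤ cout → cout ≤ 1 →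
        -- existence of the approximation
        (∀ (N : Type) [Fintype N] (Finn Fout : Set (Finset N)) (Pin Pout : Set (N → ℝ))
          (πin : OCRS.GreedyOCRS Finn Pin) (πout : OCRS.GreedyOCRS Fout Pout),
          OCRS.IsDownClosedFamily Finn → OCRS.IsDownClosedFamily Fout →
          OCRS.IsRelaxation Finn Pin → OCRS.IsRelaxation Fout Pout →
          πin.IsSelectable b cin → πout.IsSelectable b cout →
          ∀ (p : N → ℝ) (f : Finset N → ℝ),
            (∀ e, 0 ≤ p e ∧ p e ≤ 1) → OCRS.IsMonotoneSubmodular f →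
            ∃ alg : OCRS.ProbingAlgorithm N,
              OCRS.IsApproximation Finn Fout p f
                ((1 - Real.exp (-b) - ε (Fintype.card N)) * cin * cout) alg) ∧
        -- polynomial running time, given efficient schemes and separation oracles
        (∀ (ι : Type) (size n : ι → ℕ) (acc : ι → List ℝ → List ℝ)
          (Finn Fout : ∀ i, Set (Finset (Fin (n i)))) (Pin Pout : ∀ i, Set (Fin (n i) → ℝ))
          (πin : ∀ i, OCRS.GreedyOCRS (Finn i) (Pin i))
          (πout : ∀ i, OCRS.GreedyOCRS (Fout i) (Pout i)),
          (∀ i, n i ≤ size i) →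
          (∀ i, OCRS.IsDownClosedFamily (Finn i)) → (∀ i, OCRS.IsDownClosedFamily (Fout i)) →
          (∀ i, OCRS.IsRelaxation (Finn i) (Pin i)) → (∀ i, OCRS.IsRelaxation (Fout i) (Pout i)) →
          (∀ i, (πin i).IsSelectable b cin) → (∀ i, (πout i).IsSelectable b cout) →
          OCRS.Efficient size n acc πin → OCRS.Efficient size n acc πout →
          ∃ (prepare choose : OCRS.Cmd OCRS.OracleName) (q : Polynomial ℕ),
            ∀ (i : ι) (sepIn sepOut : (Fin (n i) → ℝ) → Option (Fin (n i) → ℝ))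
              (p : Fin (n i) → ℝ) (f : Finset (Fin (n i)) → ℝ),
              OCRS.IsSeparationOracle (Pin i) sepIn → OCRS.IsSeparationOracle (Pout i) sepOut →
              (∀ e, 0 ≤ p e ∧ p e ≤ 1) → OCRS.IsMonotoneSubmodular f →
              OCRS.RunsInTime prepare choose (OCRS.oracles (acc i) sepIn sepOut f) b p
                (q.eval (size i)) ∧
              OCRS.IsApproximation (Finn i) (Fout i) p f
                ((1 - Real.exp (-b) - ε (n i)) * cin * cout)
                (OCRS.programAlgorithm prepare choose
                  (OCRS.oracles (acc i) sepIn sepOut f) b p)) := by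
  refine ⟨fun n => 8 / ((n : ℝ) + 1), ?_, ?_⟩
  · simpa [div_eq_mul_inv] using (tendsto_one_div_add_atTop_nhds_zero_nat (𝕜 := ℝ)).const_mul 8
  intro b cin cout hb hb1 hcin hcin1 hcout hcout1
  refine ⟨?_, ?_⟩
  · intro N _ Finn Fout Pin Pout πin πout hFin hFout hPin hPout hin hout p f hp hf
    obtain ⟨alg, hlegal, halg⟩ := OCRS.exists_isApproximation hb hb1 hcin hcin1 hcout hcout1 πin πout
      hFin hFout hPin hPout hin hout hp hf
    refine ⟨alg, hlegal, fun adv T hT => le_trans ?_ (halg adv T hT)⟩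
    refine mul_le_mul_of_nonneg_right (mul_le_mul_of_nonneg_right (mul_le_mul_of_nonneg_right ?_ hcin)
      hcout) (T.value_nonneg hp hf)
    exact sub_le_self _ (by positivity)
  · intro ι size n acc Finn Fout Pin Pout πin πout hsize hFin hFout hPin hPout hin hout heffIn heffOut
    obtain ⟨sampleIn, testIn, qIn, hIn⟩ := heffIn
    obtain ⟨sampleOut, testOut, qOut, hOut⟩ := heffOut
    obtain ⟨q, hq⟩ := OCRS.polyBounded_prepareTime
    -- One bound for the programs of both schemes and, through the last summand, for the length of
    -- the histories.
    set r : Polynomial ℕ := qIn + qOut + Polynomial.X with hr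
    refine ⟨.prepareWith sampleIn sampleOut, .chooseWith testIn testOut,
      q + r * 100 + (100 * (Polynomial.X * (r * 40 + 80)) + Polynomial.X * 1000 + r * 1000 + 1000) +
        Polynomial.X + 2 * r + 2, ?_⟩
    intro i sepIn sepOut p f hsepIn hsepOut hp hf
    have hrs : r.eval (size i) = qIn.eval (size i) + qOut.eval (size i) + size i := by
      simp [hr]
    have hn := hsize i
    have himpIn : OCRS.Implements sampleIn testIn (acc i) (πin i) (r.eval (size i)) := by
      intro x hx
      refine ⟨fun s hs => ⟨?_, fun S => ?_⟩, (hIn i x hx).2⟩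
      · have := ((hIn i x hx).1 s hs).1
        omega
      · have := ((hIn i x hx).1 s hs).2 S
        omega
    have himpOut : OCRS.Implements sampleOut testOut (acc i) (πout i) (r.eval (size i)) := by
      intro x hx
      refine ⟨fun s hs => ⟨?_, fun S => ?_⟩, (hOut i x hx).2⟩
      · have := ((hOut i x hx).1 s hs).1
        omega
      · have := ((hOut i x hx).1 s hs).2 S
        omega
    refine ⟨?_, OCRS.isApproximation_programs hb hb1 (fun _ => rfl) rfl rfl rfl hsepIn hsepOut
      (hFin i) (hFout i) (hPin i) (hPout i) himpIn himpOut hp hf hcin hcin1 hcout hcout1 (hin i)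
      (hout i)⟩
    have htime := OCRS.runsInTime_programs (p := p) (f := f)
      (O := OCRS.oracles (acc i) sepIn sepOut f) hb hb1 (fun _ => rfl) rfl
      rfl rfl hsepIn hsepOut (hFin i) (hFout i) (hPin i) (hPout i) himpIn himpOut (by omega)
    intro s hs
    have hle : OCRS.prepareTime (n i) (r.eval (size i)) + OCRS.chooseTime (n i) (r.eval (size i)) +
        n i + 2 * r.eval (size i) + 2 ≤ Polynomial.eval (size i) (q + r * 100 + (100 *
          (Polynomial.X * (r * 40 + 80)) + Polynomial.X * 1000 + r * 1000 + 1000) +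
        Polynomial.X + 2 * r + 2) := by
      -- The time of the schemes enters the preparation additively, so the polynomial bound in `n`
      -- alone suffices for the rest.
      have h1 : OCRS.prepareTime (n i) (r.eval (size i)) =
          OCRS.prepareTime (n i) 0 + r.eval (size i) * 100 := by
        simp only [OCRS.prepareTime]; omega
      have h2 : OCRS.prepareTime (n i) 0 ≤ q.eval (size i) := (hq (n i)).trans (OCRS.polynomial_eval_mono q hn)
      have h3 : n i * (r.eval (size i) * 40 + 80) ≤ size i * (r.eval (size i) * 40 + 80) :=
        Nat.mul_le_mul_right _ hn
      simp only [Polynomial.eval_add, Polynomial.eval_mul, Polynomial.eval_X, Polynomial.eval_ofNat,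
        OCRS.chooseTime, h1]
      omega
    exact ⟨((htime s hs).1).trans hle, fun h hh e => ((htime s hs).2 h hh e).trans hle⟩
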